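/- **Model.** Terrestrial base stations (TBSs) form a homogeneous Poisson process of density $\lambda_T>0$ in the plane. Independently, aerial base stations (ABSs) hover at height $h>0$ and their horizontal positions form a homogeneous Poisson process of density $\lambda_A>0$. The typical user (UE) is at the origin. Given the positions, the link to an ABS at horizontal distance $x$ is LoS ($s=L$) with probability $P_L(x)=\bigl[1+a\exp\bigl(-b\bigl(\tfrac{180}{\pi}\arctan(\tfrac hx-c)-d\bigr)\bigr)\bigr]^{-1}$, where $a,b>0$ and $c,d\in\mathbb R$ (for instance $(c,d)=(0,a)$ or $(c,d)=(a,0)$), and NLoS ($s=N$) with probability $P_N=1-P_L$. A link in state $s$ of length $\rho=\sqrt{x^2+h^2}$ has path loss $C_s\rho^{-\alpha_s}$, with $C_s>0$ and $\alpha_s>2$, and channel gain with law $\Gamma(m_s,1/m_s)$, with $m_s\ge1$ an integer. All link states and gains are independent given the positions. ABSs transmit with power $P_A>0$, the noise power is $\sigma_A^2\ge0$, and the power coefficients satisfy $a_m>a_n>0$, $a_m+a_n=1$ and $0<\beta<1$ (imperfect SIC). Let $R_{T,0}$, $R_{L,0}$, $R_{N,0}$ be the distances to the nearest TBS, LoS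 ABS and NLoS ABS, and put $\eta_s=a_nP_AC_s$ and $\eta_T=G_MP_TC_T$, where $G_M,P_T,C_T>0$. Let $\alpha_T>0$ and let $R_B>0$ be the LoS radius of the TBSs. The UE is associated with the nearest LoS ABS (event $B_L$) if $\eta_LR_{L,0}^{-\alpha_L}$ exceeds both $\eta_NR_{N,0}^{-\alpha_N}$ and $\eta_TR_{T,0}^{-\alpha_T}\mathbf 1(R_{T,0}\le R_B)$. It is associated with the nearest NLoS ABS (event $B_N$) if $\eta_NR_{N,0}^{-\alpha_N}>\eta_LR_{L,0}^{-\alpha_L}$ and $R_{T,0}>R_B$; a NLoS ABS is never chosen if a TBS lies within $R_B$. Put $A_s=\mathbb P(B_s)$ and $A_A=\mathbb P(B_L\cup B_N)$. The serving ABS, in state $s$, also serves a fixed UE at distance $R_f\ge h$ with an independent gain $H_{s,f}\sim\Gamma(m_s,1/m_s)$. The typical UE is *near* if $R_{s,0}\le R_f$ and *far* otherwise. Let $I_A$ be the total power received by the typical UE from all ABSs but the serving one; the fixed UE is assumed to see the same interference. Let $g_t=P_AC_sR_{s,0}^{-\alpha_s}H_{s,0}$ and $g_f=P_AC_sR_f^{-\alpha_s}H_{s,f}$.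 The SINRs are $$\gamma^s_{t,near}=\frac{a_ng_t}{I_A+\sigma_A^2+\beta a_mg_t},\quad \gamma^s_{f,near}=\frac{a_mg_f}{a_ng_f+I_A+\sigma_A^2},\quad \gamma^s_{t,far}=\frac{a_mg_t}{a_ng_t+I_A+\sigma_A^2},\quad \gamma^s_{f,far}=\frac{a_ng_f}{I_A+\sigma_A^2+\beta a_mg_f}.$$ For $c\in\{near,far\}$, $u\in\{t,f\}$ let $R_{c|s}=\mathbb E[(\log_2(1+\gamma^s_{t,c})+\log_2(1+\gamma^s_{f,c}))\mathbf 1_c\mid B_s]$, where $\mathbf 1_c$ is the indicator of case $c$, and $\bar F_{\gamma^s_{u,c}}(z)=\mathbb P(c,\ \gamma^s_{u,c}>z\mid B_s)$. Let $R_A$ be the conditional expectation, given $B_L\cup B_N$, of the sum rate $\log_2(1+\gamma^s_{t,c})+\log_2(1+\gamma^s_{f,c})$ in the state $s$ and the case $c$ that occur. **Theorem.** $A_L,A_N>0$, $A_A=A_L+A_N$, all these rates are integrable, and $$R_A=\frac{A_L}{A_A}\bigl(R_{near|LoS}+R_{far|LoS}\bigr)+\frac{A_N}{A_A}\bigl(R_{near|NLoS}+R_{far|NLoS}\bigr),$$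 where, for $s=L$ (LoS) and $s=N$ (NLoS), $$R_{near|s}=\frac1{\ln2}\int_0^{\frac{a_n}{\beta a_m}}\frac{\bar F_{\gamma^s_{t,near}}(z)}{1+z}dz+\frac1{\ln2}\int_0^{\frac{a_m}{a_n}}\frac{\bar F_{\gamma^s_{f,near}}(z)}{1+z}dz,\qquad R_{far|s}=\frac1{\ln2}\int_0^{\frac{a_n}{\beta a_m}}\frac{\bar F_{\gamma^s_{f,far}}(z)}{1+z}dz+\frac1{\ln2}\int_0^{\frac{a_m}{a_n}}\frac{\bar F_{\gamma^s_{t,far}}(z)}{1+z}dz,$$ and each CCDF vanishes for $z$ at or above the upper limit of its integral. Below that limit it is approximated, $\bar F_{\gamma^s_{u,c}}(z)\approx\tilde F_{\gamma^s_{u,c}}(z)$, by $$\tilde F_{\gamma^s_{u,c}}(z)=\sum_{i=1}^{2}\int_{J_c}\Bigl[\sum_{k=1}^{m_s}(-1)^{k+1}\tbinom{m_s}{k}e^{-\varphi(z)\frac{kb_sd^{\alpha_s}\sigma_A^2}{P_AC_s}}L_{I_A}\Bigl(\varphi(z)\tfrac{kb_sd^{\alpha_s}}{P_AC_s}\Bigr)\Bigr]f_{\hat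 R_{s,0},i}(r)\,dr .$$ Here $J_{near}=[h,R_f]$ and $J_{far}=[R_f,\infty)$; $d=r$ for $u=t$ and $d=R_f$ for $u=f$; $\varphi(z)=f_1(z)=\frac{z}{a_n-\beta a_mz}$ for $(u,c)=(t,near),(f,far)$ and $\varphi(z)=f_2(z)=\frac{z}{a_m-a_nz}$ otherwise; $b_s=m_s(m_s!)^{-1/m_s}$. With $s'$ the state other than $s$ and $\tau_s(r)=\max\{h,(\eta_{s'}/\eta_s)^{1/\alpha_{s'}}r^{\alpha_s/\alpha_{s'}}\}$, $$L_{I_A}(v)=\prod_{t\in\{L,N\}}\exp\Bigl(-2\pi\lambda_A\int_{w_t(r)}^\infty\Bigl(1-\bigl(1+\tfrac{vP_AC_t}{m_t(x^2+h^2)^{\alpha_t/2}}\bigr)^{-m_t}\Bigr)P_t(x)x\,dx\Bigr),\quad w_s(r)=\sqrt{r^2-h^2},\ w_{s'}(r)=\sqrt{\tau_s(r)^2-h^2}.$$ Put $V_s(r)=\exp(-2\pi\lambda_A\int_0^{\sqrt{r^2-h^2}}xP_s(x)dx)$, $f_{R_{s,0}}(r)=2\pi\lambda_A\,r\,P_s(\sqrt{r^2-h^2})V_s(r)$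 and $Q_T=1-e^{-\pi\lambda_TR_B^2}$. Then, for $r\ge h$, $f_{\hat R_{s,0},1}(r)=\frac{f_{R_{s,0}}(r)}{A_s}V_{s'}(\tau_s(r))(1-Q_T)$ and $f_{\hat R_{N,0},2}=0$. Moreover, $f_{\hat R_{L,0},2}(r)=\frac{f_{R_{L,0}}(r)}{A_L}\bigl[e^{-\pi\lambda_T\tau_T(r)^2}-(1-Q_T)\bigr]V_N(\tau_L(r))$ for $r\le(\eta_L/\eta_T)^{1/\alpha_L}R_B^{\alpha_T/\alpha_L}$ and $0$ for larger $r$, where $\tau_T(r)=(\eta_T/\eta_L)^{1/\alpha_T}r^{\alpha_L/\alpha_T}$. The approximation "$\approx$" means the following. With $T=\varphi(z)D^{\alpha_s}(I_A+\sigma_A^2)/(P_AC_s)$, where $D=R_{s,0}$ for $u=t$ and $D=R_f$ for $u=f$, one has $\bar F_{\gamma^s_{u,c}}(z)=\mathbb E[G_s(T)\mathbf 1_c\mid B_s]$, where $G_s$ is the CCDF of $\Gamma(m_s,1/m_s)$. Replacing $G_s(x)$ by Alzer's approximation $1-(1-e^{-b_sx})^{m_s}$ gives exactly $\tilde F_{\gamma^s_{u,c}}(z)$.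 One has $\bar F_{\gamma^s_{u,c}}\le\tilde F_{\gamma^s_{u,c}}$, with equality if $m_s=1$. Consequently $R_{c|s}$ is at most the same expression with $\tilde F$ in place of $\bar F$, with equality if $m_s=1$, and $R_A$ is at most the combination of these four expressions with weights $A_L/A_A$, $A_N/A_A$, with equality if $m_L=m_N=1$. -/

import Mathlib

open MeasureTheory ProbabilityTheory Set
open scoped ENNReal NNReal

noncomputable section

namespace Noma

/-! ### Poisson point processes -/

/-- The number of indices `i` for which the random point `X i ω` lies in `A`. -/
def pointCount {Ω E : Type*} (X : ℕ → Ω → E) (A : Set E) (ω : Ω) : ℕ∞ :=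
  {i : ℕ | X i ω ∈ A}.encard

/-- The sequence `X 0, X 1, …` of random points enumerates a Poisson point process with intensity
measure `ν`: the numbers of points in finitely many pairwise disjoint measurable sets of finite
`ν`-measure are independent Poisson variables whose means are the `ν`-measures of the sets. -/
structure IsPoissonProcess {Ω E : Type*} [MeasurableSpace Ω] [MeasurableSpace E]
    (X : ℕ → Ω → E) (ν : Measure E) (μ : Measure Ω) : Prop where
  measurable : ∀ i, Measurable (X i)
  counts : ∀ (n : ℕ) (A : Fin n → Set E), (∀ k, MeasurableSet (A k)) →
    (∀ j k, j ≠ k → Disjoint (A j) (A k)) → (∀ k, ν (A k) < ∞) → ∀ c : Fin n → ℕ,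
      μ {ω | ∀ k, pointCount X (A k) ω = (c k : ℕ∞)} =
        ∏ k, poissonMeasure (ν (A k)).toNNReal {c k}

/-! ### Parameters -/

/-- State of an air-to-ground link. -/
inductive Link where
  | los
  | nlos
  deriving DecidableEq

/-- The opposite link state. -/
def Link.other : Link → Link
  | .los => .nlos
  | .nlos => .los

/-- Position of the typical UE relative to the fixed UE that is paired with it. -/
inductive Position where
  | near
  | far

/-- The two UEs served by the associated ABS. -/
inductive User where
  | typical
  | fixed

/-- Parameters of the two-tier network. Quantities that depend on the state of an air-to-ground
link are functions on `Link`. -/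
structure Params where
  /-- density of the TBSs -/
  lamT : ℝ
  /-- density of the ABSs -/
  lamA : ℝ
  /-- height of the ABSs -/
  h : ℝ
  /-- radius of the mmWave LoS ball -/
  RB : ℝ
  /-- distance between the fixed UE and its ABS -/
  Rf : ℝ
  /-- S-curve parameter `a` -/
  sa : ℝ
  /-- S-curve parameter `b` -/
  sb : ℝ
  /-- S-curve offset inside the arctangent -/
  sc : ℝ
  /-- S-curve offset of the elevation angle in degrees -/
  sd : ℝ
  /-- path loss exponents of the TBS links -/
  alphaT : ℝ
  /-- path loss exponents of the ABS links -/
  alpha : Link → ℝ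
  /-- additive loss of the TBS links -/
  CT : ℝ
  /-- additive loss of the ABS links -/
  C : Link → ℝ
  /-- Nakagami fading parameters of the ABS links -/
  m : Link → ℕ
  /-- transmit power of the TBSs -/
  PT : ℝ
  /-- main-lobe gain -/
  GM : ℝ
  /-- transmit power of the ABSs -/
  PA : ℝ
  /-- power allocation factor for the far UE -/
  am : ℝ
  /-- power allocation factor for the near UE -/
  an : ℝ
  /-- imperfect SIC coefficient -/
  beta : ℝ
  /-- noise power of the ABS tier -/
  sigma2 : ℝ

namespace Params

/-- The admissible range of the parameters. -/
structure Admissible (p : Params) : Prop where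
  lamT_pos : 0 < p.lamT
  lamA_pos : 0 < p.lamA
  h_pos : 0 < p.h
  RB_pos : 0 < p.RB
  h_le_Rf : p.h ≤ p.Rf
  sa_pos : 0 < p.sa
  sb_pos : 0 < p.sb
  alphaT_pos : 0 < p.alphaT
  two_lt_alpha : ∀ s, 2 < p.alpha s
  CT_pos : 0 < p.CT
  C_pos : ∀ s, 0 < p.C s
  m_pos : ∀ s, 1 ≤ p.m s
  PT_pos : 0 < p.PT
  GM_pos : 0 < p.GM
  PA_pos : 0 < p.PA
  an_pos : 0 < p.an
  an_lt_am : p.an < p.am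
  am_add_an : p.am + p.an = 1
  beta_pos : 0 < p.beta
  beta_lt_one : p.beta < 1
  sigma2_nonneg : 0 ≤ p.sigma2

variable (p : Params)

/-- The probability that a link of horizontal length `x` is LoS, given by the S-curve
`1 / (1 + a exp (-b ((180 / π) arctan (h / x - c) - d)))`. -/
def losProb (x : ℝ) : ℝ :=
  1 / (1 + p.sa * Real.exp (-p.sb * (180 / Real.pi * Real.arctan (p.h / x - p.sc) - p.sd)))

/-- The probability that a link of horizontal length `x` is in the given state. -/
def linkProb : Link → ℝ → ℝ
  | .los, x => p.losProb x
  | .nlos, x => 1 - p.losProb x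

/-- `η_L`, `η_N`: average power received by the near UE at distance `1` from an ABS. -/
def eta (s : Link) : ℝ := p.an * p.PA * p.C s

/-- `η_T`: average power received at distance `1` from a TBS. -/
def etaT : ℝ := p.GM * p.PT * p.CT

end Params

/-! ### The random network -/

/-- Random variables that describe the network seen by the typical UE at the origin. The actual
channel gain of ABS `i` is `gain s i` when its link is in state `s`. -/
structure Network (Ω : Type*) where
  /-- positions of the TBSs -/
  tbs : ℕ → Ω → EuclideanSpace ℝ (Fin 2)
  /-- horizontal positions of the ABSs -/
  abs : ℕ → Ω → EuclideanSpace ℝ (Fin 2)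
  /-- uniform variables that decide which links are LoS -/
  vis : ℕ → Ω → ℝ
  /-- channel gains between the typical UE and the ABSs -/
  gain : Link → ℕ → Ω → ℝ
  /-- channel gain between the fixed UE and the serving ABS, when that ABS is in state `s` -/
  fixedGain : Link → Ω → ℝ

/-- Index set of the real-valued marks. -/
inductive MarkIdx where
  | vis (i : ℕ)
  | gain (s : Link) (i : ℕ)
  | fixedGain (s : Link)

namespace Network

variable {Ω : Type*} [MeasurableSpace Ω] (N : Network Ω) (p : Params)

/-- All real-valued marks as a single family. -/
def marks : MarkIdx → Ω → ℝ
  | .vis i => N.vis i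
  | .gain s i => N.gain s i
  | .fixedGain s => N.fixedGain s

/-- The link of ABS `i` is LoS with probability `P_L(x)`, where `x` is its horizontal distance,
independently of everything else. -/
def state (i : ℕ) (ω : Ω) : Link :=
  if N.vis i ω ≤ p.losProb ‖N.abs i ω‖ then .los else .nlos

/-- Distance between the typical UE and ABS `i`. -/
def dist (i : ℕ) (ω : Ω) : ℝ := √(‖N.abs i ω‖ ^ 2 + p.h ^ 2)

/-- Index of the nearest ABS in state `s`. -/
def nearest (s : Link) (ω : Ω) : ℕ :=
  sInf {i | N.state p i ω = s ∧ ∀ j, N.state p j ω = s → N.dist p i ω ≤ N.dist p j ω}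

/-- `R_{L,0}`, `R_{N,0}`: distance to the nearest ABS in state `s`. -/
def R (s : Link) (ω : Ω) : ℝ := N.dist p (N.nearest p s ω) ω

/-- `R_{T,0}`: distance to the nearest TBS. -/
def RT (ω : Ω) : ℝ := ⨅ i, ‖N.tbs i ω‖

/-- Average power received from the nearest ABS in state `s`. -/
def power (s : Link) (ω : Ω) : ℝ := p.eta s * N.R p s ω ^ (-p.alpha s)

/-- Average power received from the nearest TBS. -/
def powerT (ω : Ω) : ℝ :=
  if N.RT ω ≤ p.RB then p.etaT * N.RT ω ^ (-p.alphaT) else 0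

/-- The event that the typical UE is associated with an ABS in state `s`. Association is by largest
average received power, and a NLoS ABS is never chosen when there is a TBS in the LoS ball
(outside that ball TBSs contribute no power). -/
def assoc : Link → Set Ω
  | .los => {ω | N.power p .nlos ω < N.power p .los ω ∧ N.powerT p ω < N.power p .los ω}
  | .nlos => {ω | N.power p .los ω < N.power p .nlos ω ∧ p.RB < N.RT ω}

/-- The event that the typical UE is associated with the ABS tier. -/
def assocABS : Set Ω := N.assoc p .los ∪ N.assoc p .nlos

/-- Interference from all ABSs other than the serving one, the nearest one in state `s`. -/
def interference (s : Link) (ω : Ω) : ℝ :=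
  ∑' i : ℕ, if i = N.nearest p s ω then 0 else
    p.PA * p.C (N.state p i ω) * N.dist p i ω ^ (-p.alpha (N.state p i ω)) *
      N.gain (N.state p i ω) i ω

/-- Distance between a UE and the serving ABS in state `s`. -/
def userDist : User → Link → Ω → ℝ
  | .typical, s, ω => N.R p s ω
  | .fixed, _, _ => p.Rf

/-- Channel gain between a UE and the serving ABS in state `s`. -/
def userGain : User → Link → Ω → ℝ
  | .typical, s, ω => N.gain s (N.nearest p s ω) ω
  | .fixed, s, ω => N.fixedGain s ω

/-- Full power that a UE receives from the serving ABS in state `s`. -/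
def signal (u : User) (s : Link) (ω : Ω) : ℝ :=
  p.PA * p.C s * N.userDist p u s ω ^ (-p.alpha s) * N.userGain p u s ω

/-- SINR for the own message of the nearer UE, after imperfect SIC. -/
def sinrSIC (u : User) (s : Link) (ω : Ω) : ℝ :=
  p.an * N.signal p u s ω /
    (N.interference p s ω + p.sigma2 + p.beta * p.am * N.signal p u s ω)

/-- SINR for the own message of the farther UE, which treats the other message as noise. -/
def sinrDirect (u : User) (s : Link) (ω : Ω) : ℝ :=
  p.am * N.signal p u s ω /
    (p.an * N.signal p u s ω + N.interference p s ω + p.sigma2)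

/-- SINR of UE `u` when the serving ABS is in state `s` and the typical UE is in position `c`. -/
def sinr : Position → User → Link → Ω → ℝ
  | .near, .typical => N.sinrSIC p .typical
  | .near, .fixed => N.sinrDirect p .fixed
  | .far, .fixed => N.sinrSIC p .fixed
  | .far, .typical => N.sinrDirect p .typical

/-- The event that the typical UE is the near (far) UE, when the serving ABS is in state `s`. -/
def caseEvent : Position → Link → Set Ω
  | .near, s => {ω | N.R p s ω ≤ p.Rf}
  | .far, s => {ω | p.Rf < N.R p s ω}

/-- Sum of the rates of the two UEs in position `c`, in bit/s/Hz. -/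
def pairRate (c : Position) (s : Link) (ω : Ω) : ℝ :=
  Real.logb 2 (1 + N.sinr p c .typical s ω) + Real.logb 2 (1 + N.sinr p c .fixed s ω)

open Classical in
/-- Rate contributed by position `c`, when the serving ABS is in state `s`. -/
def caseRate (c : Position) (s : Link) (ω : Ω) : ℝ :=
  if ω ∈ N.caseEvent p c s then N.pairRate p c s ω else 0

open Classical in
/-- Rate of the pair of UEs in the ABS tier. -/
def tierRate (ω : Ω) : ℝ :=
  if ω ∈ N.assoc p .los then N.caseRate p .near .los ω + N.caseRate p .far .los ω
  else if ω ∈ N.assoc p .nlos then N.caseRate p .near .nlos ω + N.caseRate p .far .nlos ω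
  else 0

/-- The standing assumptions on the network: two independent homogeneous Poisson processes, and,
independent of them, independent marks with the uniform and the `Γ(m, 1/m)` distributions. -/
structure IsModel (μ : Measure Ω) : Prop where
  tbs_poisson : IsPoissonProcess N.tbs (ENNReal.ofReal p.lamT • volume) μ
  abs_poisson : IsPoissonProcess N.abs (ENNReal.ofReal p.lamA • volume) μ
  marks_measurable : ∀ k, Measurable (N.marks k)
  vis_law : ∀ i, μ.map (N.vis i) = volume.restrict (Icc (0 : ℝ) 1)
  gain_law : ∀ s i, μ.map (N.gain s i) = gammaMeasure (p.m s) (p.m s)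
  fixedGain_law : ∀ s, μ.map (N.fixedGain s) = gammaMeasure (p.m s) (p.m s)
  marks_indep : iIndepFun N.marks μ
  tbs_abs_indep : IndepFun (fun ω i => N.tbs i ω) (fun ω i => N.abs i ω) μ
  points_marks_indep :
    IndepFun (fun ω => ((fun i => N.tbs i ω), (fun i => N.abs i ω))) (fun ω k => N.marks k ω) μ

variable (μ : Measure Ω)

/-- `A_L`, `A_N`: association probabilities. -/
def A (s : Link) : ℝ := μ.real (N.assoc p s)

/-- `A_A`: probability of association with the ABS tier. -/
def AA : ℝ := μ.real (N.assocABS p)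

/-- `R_A`: ergodic rate of a typical UE that is associated with the ABS tier. -/
def ergodicRate : ℝ := ∫ ω, N.tierRate p ω ∂(cond μ (N.assocABS p))

/-- `R_{near|LoS}`, `R_{far|LoS}`, `R_{near|NLoS}`, `R_{far|NLoS}`: contribution of position `c` to
the ergodic rate of a typical UE that is associated with an ABS in state `s`. -/
def componentRate (c : Position) (s : Link) : ℝ :=
  ∫ ω, N.caseRate p c s ω ∂(cond μ (N.assoc p s))

/-- CCDF of the SINR of UE `u` in position `c`, given association with an ABS in state `s`. -/
def ccdf (c : Position) (u : User) (s : Link) (z : ℝ) : ℝ :=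
  (cond μ (N.assoc p s)).real (N.caseEvent p c s ∩ {ω | z < N.sinr p c u s ω})

end Network

/-! ### Thresholds and the approximation of the Gamma distribution -/

namespace Params

variable (p : Params)

/-- Supremum of the attainable SINR of UE `u` in position `c`. -/
def zMax : Position → User → ℝ
  | .near, .typical => p.an / (p.beta * p.am)
  | .near, .fixed => p.am / p.an
  | .far, .fixed => p.an / (p.beta * p.am)
  | .far, .typical => p.am / p.an

/-- `f₁`. -/
def f₁ (z : ℝ) : ℝ := z / (p.an - p.beta * p.am * z)

/-- `f₂`. -/
def f₂ (z : ℝ) : ℝ := z / (p.am - p.an * z)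

/-- The function, `f₁` or `f₂`, that belongs to UE `u` in position `c`. -/
def f : Position → User → ℝ → ℝ
  | .near, .typical => p.f₁
  | .near, .fixed => p.f₂
  | .far, .fixed => p.f₁
  | .far, .typical => p.f₂

end Params

/-- CCDF of the Gamma distribution `Γ(m, 1/m)`. -/
def gammaTail (m : ℕ) (x : ℝ) : ℝ := (gammaMeasure m m).real (Ioi x)

/-- `b = m (m!)^(-1/m)`. -/
def alzerConst (m : ℕ) : ℝ := m * (m.factorial : ℝ) ^ (-(1 / (m : ℝ)))

/-- Alzer's approximation `1 - (1 - e^{-b x})^m` of the CCDF of `Γ(m, 1/m)`. -/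
def alzerTail (m : ℕ) (x : ℝ) : ℝ := 1 - (1 - Real.exp (-(alzerConst m * x))) ^ m

/-- The channel gain that UE `u` in position `c` needs in order that its SINR exceeds `z`. -/
def Network.gainThreshold {Ω : Type*} (N : Network Ω) (p : Params) (c : Position) (u : User)
    (s : Link) (z : ℝ) (ω : Ω) : ℝ :=
  p.f c u z * N.userDist p u s ω ^ p.alpha s * (N.interference p s ω + p.sigma2) /
    (p.PA * p.C s)

/-! ### Analytic expressions -/

namespace Params

variable (p : Params)

/-- The smallest possible distance of an ABS in the other state, when the UE is associated with an
ABS in state `s` at distance `r`. -/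
def tau (s : Link) (r : ℝ) : ℝ :=
  max p.h ((p.eta s.other / p.eta s) ^ (1 / p.alpha s.other) *
    r ^ (p.alpha s / p.alpha s.other))

/-- `τ_{T|L}`: the smallest possible distance of a TBS, when the UE is associated with a LoS ABS at
distance `r`. -/
def tauT (r : ℝ) : ℝ :=
  (p.etaT / p.eta .los) ^ (1 / p.alphaT) * r ^ (p.alpha .los / p.alphaT)

/-- `l_{L,T}`: the largest association distance of a LoS ABS, when there is a TBS in the LoS
ball. -/
def lLT : ℝ :=
  (p.eta .los / p.etaT) ^ (1 / p.alpha .los) * p.RB ^ (p.alphaT / p.alpha .los)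

/-- `Q_T`: the probability that there is a TBS in the LoS ball. -/
def QT : ℝ := 1 - Real.exp (-(Real.pi * p.lamT * p.RB ^ 2))

/-- The probability that no ABS in state `s` is at distance less than `r`. -/
def voidProb (s : Link) (r : ℝ) : ℝ :=
  Real.exp (-(2 * Real.pi * p.lamA * ∫ x in (0 : ℝ)..√(r ^ 2 - p.h ^ 2), x * p.linkProb s x))

/-- `f_{R_{L,0}}`, `f_{R_{N,0}}`: density of the distance to the nearest ABS in state `s`
(for `r ≥ h`). -/
def nearestPdf (s : Link) (r : ℝ) : ℝ :=
  2 * Real.pi * p.lamA * r * p.linkProb s √(r ^ 2 - p.h ^ 2) * p.voidProb s r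

/-- Density (for `r ≥ h`) of the distance to the serving ABS in state `s`, whose association
probability is `A`. Index `0` is the part without a TBS in the LoS ball, index `1` the part with
one, which is absent for NLoS ABSs. For `r` with `tau s r = h` the factor `voidProb` is `1`. -/
def servingPdf (A : ℝ) : Link → Fin 2 → ℝ → ℝ
  | s, 0, r => p.nearestPdf s r / A * p.voidProb s.other (p.tau s r) * (1 - p.QT)
  | .los, 1, r =>
      if r ≤ p.lLT then
        p.nearestPdf .los r / A *
          (Real.exp (-(Real.pi * p.lamT * p.tauT r ^ 2)) - (1 - p.QT)) *
          p.voidProb .nlos (p.tau .los r)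
      else 0
  | .nlos, 1, _ => 0

/-- Lower horizontal limit for interferers in state `t`, when the UE is associated with an ABS in
state `s` at distance `r`. -/
def wLow (s t : Link) (r : ℝ) : ℝ :=
  if t = s then √(r ^ 2 - p.h ^ 2) else √(p.tau s r ^ 2 - p.h ^ 2)

/-- Laplace transform at `v` of the interference from the ABSs in state `t`. -/
def laplacePart (s t : Link) (r v : ℝ) : ℝ :=
  Real.exp (-(2 * Real.pi * p.lamA * ∫ x in Ioi (p.wLow s t r),
    (1 - ((1 + v * p.PA * p.C t / (p.m t * (x ^ 2 + p.h ^ 2) ^ (p.alpha t / 2))) ^ p.m t)⁻¹) *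
      p.linkProb t x * x))

/-- `L_{I_A}`: Laplace transform at `v` of the interference, when the UE is associated with an ABS
in state `s` at distance `r`. -/
def laplaceIA (s : Link) (r v : ℝ) : ℝ := p.laplacePart s .los r v * p.laplacePart s .nlos r v

/-- The bracket `∑_{k=1}^m (-1)^{k+1} (m choose k) e^{-y k b d^α σ² / (P C)} L(y k b d^α / (P C))`
for a UE at distance `d` from the serving ABS. -/
def bracket (s : Link) (y d r : ℝ) : ℝ :=
  ∑ k ∈ Finset.Icc 1 (p.m s), (-1 : ℝ) ^ (k + 1) * ((p.m s).choose k : ℝ) *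
    Real.exp (-(y * (k * alzerConst (p.m s) * d ^ p.alpha s * p.sigma2 / (p.PA * p.C s)))) *
    p.laplaceIA s r (y * (k * alzerConst (p.m s) * d ^ p.alpha s / (p.PA * p.C s)))

/-- The distance of UE `u` from the serving ABS, when that of the typical UE is `r`. -/
def distAt : User → ℝ → ℝ
  | .typical, r => r
  | .fixed, _ => p.Rf

/-- The range of the serving distance in position `c`. -/
def caseRange : Position → Set ℝ
  | .near => Ioc p.h p.Rf
  | .far => Ioi p.Rf

/-- Analytic expression that approximates the SINR CCDF of UE `u` in position `c`. -/
def ccdfApprox (A : ℝ) (c : Position) (u : User) (s : Link) (z : ℝ) : ℝ :=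
  ∑ i : Fin 2, ∫ r in p.caseRange c,
    p.bracket s (p.f c u z) (p.distAt u r) r * p.servingPdf A s i r

/-- `(1 / ln 2)` times the truncated integrals of `F z / (1 + z)`, for a family `F` of CCDFs. -/
def rateOfCcdf (F : User → ℝ → ℝ) (c : Position) : ℝ :=
  1 / Real.log 2 * (∫ z in (0 : ℝ)..p.zMax c .typical, F .typical z / (1 + z)) +
    1 / Real.log 2 * (∫ z in (0 : ℝ)..p.zMax c .fixed, F .fixed z / (1 + z))

end Params

end Noma

end

open MeasureTheory ProbabilityTheory Set
open scoped ENNReal NNReal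

noncomputable section

namespace Noma

open Filter Topology

/-! ### Infinite products of numbers in `[0, 1]` -/

/-! Every one of the four SINRs has the form `a * S / (J + b * S)`, with `S` the full power from the
serving ABS and `J` interference plus noise (`sinr_eq`). As a function of `S` this is increasing and
bounded by `a / b`. Hence the CCDF vanishes from `a / b` on, and below it the event that the SINR
exceeds `z` says that the gain of the served UE exceeds an explicit threshold (`lt_sinr_iff`). That
gain is independent of the threshold and of the association, so the CCDF is the mean of the Gamma
tail at the threshold (`ccdf_eq_integral`). The layer cake formula `integral_logb_one_add` turns
CCDFs into rates, and the disjointness of the two association events gives the weights of the total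
rate.

The Gamma tail lies below Alzer's expression (`gammaTail_le_alzerTail`), with equality for shape
one. A binomial expansion turns Alzer's expression into a combination of exponentials that are
linear in the interference. All that remains to be known is therefore the law of the serving
distance, weighted by the Laplace transform of the interference: `setLIntegral_laplace`.

For this joint law, the integral over the association event is written as a sum over all ABSs that
might be the serving one (`setLIntegral_assoc`). Given the positions, integrating out the
independent marks leaves a product over the other ABSs of a number `avoid` in `[0, 1]`: the
probability that such an ABS does not win the association, weighted by the Laplace transform of its
power. The Mecke formula converts the sum into an integral over the plane, and the product into the
exponential of minus the integral of `1 - avoid`. Splitting the latter by link state, and each state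
at its threshold radius, gives the void probabilities and the Laplace factors. The independent TBSs
contribute one more factor, and polar coordinates give the density in the slant distance.

The Mecke formula is derived from the independence and Poisson laws of the counts. On finitely many
cells it is the identity `E[n c^(n-1)] = r e^(-r(1-c))` for a Poisson variable of mean `r`
(`mecke_cells`). Simple functions and monotone convergence extend it to product functionals
(`mecke`), and dyadic discretisation extends it to functionals that depend on the distinguished
point (`mecke_antitone`). It also shows that ties between ABSs have probability zero
(`ae_forall_ne`), so that strict and non-strict comparisons agree almost surely. -/

/-- The infinite product of a sequence of numbers in `[0, 1]`. -/
def infProd (w : ℕ → ℝ≥0∞) : ℝ≥0∞ := ⨅ n, ∏ j ∈ Finset.range n, w j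

lemma antitone_prod_range {w : ℕ → ℝ≥0∞} (hw : ∀ j, w j ≤ 1) :
    Antitone fun n => ∏ j ∈ Finset.range n, w j := by
  refine antitone_nat_of_succ_le fun n => ?_
  rw [Finset.prod_range_succ]
  exact mul_le_of_le_one_right' (hw n)

lemma tendsto_infProd {w : ℕ → ℝ≥0∞} (hw : ∀ j, w j ≤ 1) :
    Tendsto (fun n => ∏ j ∈ Finset.range n, w j) atTop (𝓝 (infProd w)) :=
  tendsto_atTop_iInf (antitone_prod_range hw)

lemma infProd_le_one (w : ℕ → ℝ≥0∞) : infProd w ≤ 1 :=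
  (iInf_le _ 0).trans (by simp)

lemma infProd_mono {w w' : ℕ → ℝ≥0∞} (h : ∀ j, w j ≤ w' j) : infProd w ≤ infProd w' :=
  iInf_mono fun _ => Finset.prod_le_prod' fun j _ => h j

@[fun_prop]
lemma Measurable.infProd {α : Type*} [MeasurableSpace α] {w : α → ℕ → ℝ≥0∞}
    (hw : ∀ j, Measurable fun a => w a j) : Measurable fun a => infProd (w a) :=
  Measurable.iInf fun _ => Finset.measurable_prod _ fun j _ => hw j

/-- Both sides are double infima, which commute; a finite product is continuous along the decreasing
limit because its factors are finite. -/
lemma infProd_iInf {w : ℕ → ℕ → ℝ≥0∞} (hw : ∀ n j, w n j ≤ 1) (h : Antitone w) :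
    infProd (fun j => ⨅ n, w n j) = ⨅ n, infProd (w n) := by
  unfold infProd
  rw [iInf_comm]
  refine iInf_congr fun m => ?_
  refine tendsto_nhds_unique (ENNReal.tendsto_finsetProd_of_ne_top (Finset.range m)
      (f := fun j n => w n j) (a := fun j => ⨅ n, w n j)
      (fun j _ => tendsto_atTop_iInf fun a b hab => h hab j) fun j _ => ?_)
    (tendsto_atTop_iInf fun a b hab => Finset.prod_le_prod' fun j _ => h hab j)
  exact ((iInf_le _ 0).trans (hw 0 j)).trans_lt ENNReal.one_lt_top |>.ne

/-! ### The function `e^{-a}` on `[0, ∞]` -/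

/-- `e^{-a}` for `a ∈ [0, ∞]`. -/
def negExp (a : ℝ≥0∞) : ℝ≥0∞ := EReal.exp (-(a : EReal))

lemma continuous_negExp : Continuous negExp :=
  ENNReal.continuous_exp.comp (continuous_neg.comp continuous_coe_ennreal_ereal)

lemma antitone_negExp : Antitone negExp := fun _ _ hab =>
  EReal.exp_monotone (EReal.neg_le_neg_iff.2 (EReal.coe_ennreal_le_coe_ennreal_iff.2 hab))

@[simp] lemma negExp_zero : negExp 0 = 1 := by simp [negExp]

lemma negExp_le_one (a : ℝ≥0∞) : negExp a ≤ 1 := by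
  simpa using antitone_negExp (zero_le (a := a))

lemma negExp_ofReal {x : ℝ} (hx : 0 ≤ x) :
    negExp (ENNReal.ofReal x) = ENNReal.ofReal (Real.exp (-x)) := by
  rw [negExp, EReal.coe_ennreal_ofReal, max_eq_left hx, ← EReal.coe_neg, EReal.exp_coe]

lemma negExp_add (a b : ℝ≥0∞) : negExp (a + b) = negExp a * negExp b := by
  rw [negExp, EReal.coe_ennreal_add, EReal.neg_add (by simp) (by simp), sub_eq_add_neg,
    EReal.exp_add, negExp, negExp]

/-! ### Poisson sums -/

lemma lintegral_poissonMeasure (r : ℝ≥0) (f : ℕ → ℝ≥0∞) :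
    ∫⁻ n, f n ∂(poissonMeasure r) =
      ∑' n, ENNReal.ofReal (Real.exp (-r) * r ^ n / n.factorial) * f n := by
  simp [poissonMeasure, lintegral_sum_measure]

lemma hasSum_exp_mul (r c : ℝ) :
    HasSum (fun n : ℕ => Real.exp (-r) * r ^ n / n.factorial * c ^ n)
      (Real.exp (-(r * (1 - c)))) := by
  have h := (NormedSpace.expSeries_div_hasSum_exp (𝔸 := ℝ) (r * c)).mul_left (Real.exp (-r))
  rw [← Real.exp_eq_exp_ℝ, ← Real.exp_add] at h
  have h1 : -(r * (1 - c)) = -r + r * c := by ring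
  rw [h1]
  have h2 : (fun n : ℕ => Real.exp (-r) * r ^ n / n.factorial * c ^ n) =
      fun n : ℕ => Real.exp (-r) * ((r * c) ^ n / n.factorial) := by
    ext n; rw [mul_pow]; ring
  rwa [h2]

/-- The generating function: the contribution of a cell that does not contain the distinguished
point. -/
lemma lintegral_pow_poissonMeasure (r : ℝ≥0) {c : ℝ} (hc : 0 ≤ c) :
    ∫⁻ n, ENNReal.ofReal c ^ n ∂(poissonMeasure r) =
      ENNReal.ofReal (Real.exp (-(r * (1 - c)))) := by
  rw [lintegral_poissonMeasure, ← (hasSum_exp_mul r c).tsum_eq,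
    ENNReal.ofReal_tsum_of_nonneg (fun n => by positivity) (hasSum_exp_mul r c).summable]
  refine tsum_congr fun n => ?_
  rw [← ENNReal.ofReal_pow hc, ← ENNReal.ofReal_mul (by positivity)]

/-- The term `n = 0` vanishes, and `n / n! = 1 / (n - 1)!` shifts the series to the generating
function. This is the Mecke formula for a single cell. -/
lemma lintegral_mul_pow_poissonMeasure (r : ℝ≥0) {c : ℝ} (hc : 0 ≤ c) :
    ∫⁻ n, n * ENNReal.ofReal c ^ (n - 1) ∂(poissonMeasure r) =
      r * ENNReal.ofReal (Real.exp (-(r * (1 - c)))) := by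
  rw [lintegral_poissonMeasure, ← (hasSum_exp_mul r c).tsum_eq,
    ENNReal.ofReal_tsum_of_nonneg (fun n => by positivity) (hasSum_exp_mul r c).summable,
    ← ENNReal.tsum_mul_left, tsum_eq_zero_add' ENNReal.summable]
  simp only [Nat.cast_zero, zero_mul, mul_zero, zero_add, Nat.add_sub_cancel]
  refine tsum_congr fun n => ?_
  rw [← ENNReal.ofReal_pow hc, ← ENNReal.ofReal_coe_nnreal (p := r), ← ENNReal.ofReal_natCast,
    ← ENNReal.ofReal_mul (by positivity), ← ENNReal.ofReal_mul (by positivity),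
    ← ENNReal.ofReal_mul (by positivity)]
  congr 1
  rw [Nat.factorial_succ]
  have : (n.factorial : ℝ) ≠ 0 := by positivity
  push_cast
  field_simp
  ring

/-! ### Counts of a Poisson process -/

section Poisson

variable {Ω E : Type*} [MeasurableSpace Ω] [MeasurableSpace E]

/-- The number of points in a set, as a natural number (`0` if it is infinite). -/
def natCount (X : ℕ → Ω → E) (A : Set E) (ω : Ω) : ℕ := (pointCount X A ω).toNat

omit [MeasurableSpace Ω] [MeasurableSpace E] in
lemma pointCount_eq_tsum (X : ℕ → Ω → E) (A : Set E) (ω : Ω) :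
    (pointCount X A ω : ℝ≥0∞) = ∑' i, A.indicator 1 (X i ω) := by
  rw [pointCount, ← ENNReal.tsum_set_one,
    tsum_subtype {i | X i ω ∈ A} (fun _ => (1 : ℝ≥0∞))]
  rfl

lemma measurableSet_pointCount_eq {X : ℕ → Ω → E} (hX : ∀ i, Measurable (X i)) {A : Set E}
    (hA : MeasurableSet A) (c : ℕ∞) : MeasurableSet {ω | pointCount X A ω = c} := by
  have : {ω | pointCount X A ω = c} =
      {ω | ∑' i, A.indicator (1 : E → ℝ≥0∞) (X i ω) = c} := by
    ext ω
    rw [mem_ofPred_eq, mem_ofPred_eq, ← pointCount_eq_tsum, ENat.toENNReal_inj]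
  rw [this]
  exact (Measurable.tsum fun i => (measurable_one.indicator hA).comp (hX i))
    (measurableSet_singleton _)

lemma measurable_natCount {X : ℕ → Ω → E} (hX : ∀ i, Measurable (X i)) {A : Set E}
    (hA : MeasurableSet A) : Measurable (natCount X A) := by
  refine measurable_to_countable' fun c => ?_
  have : natCount X A ⁻¹' {c} = {ω | pointCount X A ω = c} ∪
      {ω | pointCount X A ω = ⊤ ∧ c = 0} := by
    ext ω
    rw [mem_preimage, mem_singleton_iff, natCount, mem_union, mem_ofPred_eq, mem_ofPred_eq]
    induction pointCount X A ω with
    | top => simp [eq_comm]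
    | coe n => simp
  rw [this]
  refine (measurableSet_pointCount_eq hX hA c).union ?_
  by_cases hc : c = 0
  · simpa [hc] using measurableSet_pointCount_eq hX hA ⊤
  · simp [hc]

namespace IsPoissonProcess

variable {X : ℕ → Ω → E} {ν : Measure E} {μ : Measure Ω} [IsProbabilityMeasure μ]

/-- The probabilities of the finite counts are Poisson weights, which sum to one; nothing is left
for an infinite count. -/
lemma ae_pointCount_eq (h : IsPoissonProcess X ν μ) {A : Set E} (hA : MeasurableSet A)
    (hν : ν A < ∞) : ∀ᵐ ω ∂μ, pointCount X A ω = natCount X A ω := by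
  have h1 : μ (⋃ c : ℕ, {ω | pointCount X A ω = c}) = 1 := by
    rw [measure_iUnion]
    · have h2 : ∀ c : ℕ, μ {ω | pointCount X A ω = c} = poissonMeasure (ν A).toNNReal {c} := by
        intro c
        simpa using h.counts 1 (fun _ => A) (fun _ => hA)
          (fun j k hjk => (hjk (Subsingleton.elim _ _)).elim) (fun _ => hν) (fun _ => c)
      simp_rw [h2]
      have h3 := Measure.tsum_indicator_apply_singleton (poissonMeasure (ν A).toNNReal) univ
        MeasurableSet.univ
      simpa using h3
    · intro a b hab
      refine Set.disjoint_left.2 fun ω ha hb => hab ?_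
      exact_mod_cast (ha.symm.trans hb : (a : ℕ∞) = b)
    · exact fun c => measurableSet_pointCount_eq h.measurable hA c
  have h3 := (prob_compl_eq_zero_iff (MeasurableSet.iUnion fun c : ℕ =>
    measurableSet_pointCount_eq h.measurable hA c)).2 h1
  filter_upwards [measure_eq_zero_iff_ae_notMem.1 h3] with ω hω
  simp only [mem_compl_iff, mem_iUnion, not_not] at hω
  obtain ⟨c, hc⟩ := hω
  rw [mem_ofPred_eq] at hc
  rw [natCount, hc, ENat.toNat_natCast]

/-- The counts in disjoint sets are independent Poisson variables. -/
lemma map_natCount (h : IsPoissonProcess X ν μ) {n : ℕ} {A : Fin n → Set E}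
    (hA : ∀ k, MeasurableSet (A k)) (hd : Pairwise (Function.onFun Disjoint A))
    (hν : ∀ k, ν (A k) < ∞) :
    μ.map (fun ω k => natCount X (A k) ω) =
      Measure.pi fun k => poissonMeasure (ν (A k)).toNNReal := by
  have hm : Measurable fun ω k => natCount X (A k) ω :=
    measurable_pi_lambda _ fun k => measurable_natCount h.measurable (hA k)
  refine Measure.ext_of_singleton fun c => ?_
  rw [Measure.map_apply hm (measurableSet_singleton _), Measure.pi_singleton,
    ← h.counts n A hA (fun j k hjk => hd hjk) hν c]
  refine measure_congr ?_
  filter_upwards [ae_all_iff.2 fun k => h.ae_pointCount_eq (hA k) (hν k)] with ω hω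
  refine propext ?_
  change (fun k => natCount X (A k) ω) = c ↔ ∀ k, pointCount X (A k) ω = c k
  simp [hω, funext_iff]

lemma lintegral_prod_natCount (h : IsPoissonProcess X ν μ) {n : ℕ} {A : Fin n → Set E}
    (hA : ∀ k, MeasurableSet (A k)) (hd : Pairwise (Function.onFun Disjoint A))
    (hν : ∀ k, ν (A k) < ∞) (φ : Fin n → ℕ → ℝ≥0∞) :
    ∫⁻ ω, ∏ k, φ k (natCount X (A k) ω) ∂μ =
      ∏ k, ∫⁻ j, φ k j ∂(poissonMeasure (ν (A k)).toNNReal) := by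
  have hm : Measurable fun ω k => natCount X (A k) ω :=
    measurable_pi_lambda _ fun k => measurable_natCount h.measurable (hA k)
  rw [← lintegral_map (f := fun c : Fin n → ℕ => ∏ k, φ k (c k)) (by fun_prop) hm,
    h.map_natCount hA hd hν, lintegral_prod_eq_prod_lintegral_of_indepFun Finset.univ _
      (iIndepFun_pi (X := φ) fun k => (Measurable.of_discrete).aemeasurable) (by fun_prop)]
  refine Finset.prod_congr rfl fun k _ => ?_
  exact (measurePreserving_eval (fun k => poissonMeasure (ν (A k)).toNNReal) k).lintegral_comp
    Measurable.of_discrete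

end IsPoissonProcess

end Poisson

/-! ### The Mecke formula -/

lemma infProd_eq_of_eventuallyEq {w : ℕ → ℝ≥0∞} (hw : ∀ j, w j ≤ 1) {a : ℝ≥0∞}
    (h : ∀ᶠ n in atTop, ∏ j ∈ Finset.range n, w j = a) : infProd w = a :=
  tendsto_nhds_unique (tendsto_infProd hw) (tendsto_const_nhds.congr' (h.mono fun _ hn => hn.symm))

/-- The product of `g` over all points of a sequence but the `i`-th one. -/
def othersProd {E : Type*} (g : E → ℝ≥0∞) (x : ℕ → E) (i : ℕ) : ℝ≥0∞ :=
  infProd fun j => if j = i then 1 else g (x j)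

lemma othersProd_le_one {E : Type*} (g : E → ℝ≥0∞) (x : ℕ → E) (i : ℕ) : othersProd g x i ≤ 1 :=
  infProd_le_one _

lemma othersProd_iInf {E : Type*} {g : ℕ → E → ℝ≥0∞} (hg : ∀ n y, g n y ≤ 1) (h : Antitone g)
    (x : ℕ → E) (i : ℕ) : othersProd (fun y => ⨅ n, g n y) x i = ⨅ n, othersProd (g n) x i := by
  unfold othersProd
  rw [← infProd_iInf (fun n j => by split_ifs <;> simp [hg])
    (fun a b hab j => by dsimp only; split_ifs; exacts [le_rfl, h hab _])]
  congr 1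
  ext j
  split_ifs <;> simp

lemma othersProd_mono {E : Type*} {g g' : E → ℝ≥0∞} (h : ∀ y, g y ≤ g' y) (x : ℕ → E) (i : ℕ) :
    othersProd g x i ≤ othersProd g' x i :=
  infProd_mono fun j => by split_ifs; exacts [le_rfl, h _]

/-- Monotone convergence from above for the counting measure, which requires the first sum to be
finite. -/
lemma tsum_iInf_eq {a : ℕ → ℕ → ℝ≥0∞} (h : Antitone a) (hfin : ∑' i, a 0 i ≠ ∞) :
    ∑' i, ⨅ n, a n i = ⨅ n, ∑' i, a n i := by
  simp only [← lintegral_count] at hfin ⊢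
  exact lintegral_iInf (fun _ => Measurable.of_discrete) h hfin

/-- For a function that is constant on disjoint cells, the product over the points depends only on
the counts. Omitting the distinguished point lowers the exponent of its own cell by one. -/
lemma othersProd_cells {E : Type*} {n : ℕ} {A : Fin n → Set E}
    (hd : Pairwise (Function.onFun Disjoint A)) {c : Fin n → ℝ≥0∞} (hc : ∀ k, c k ≤ 1)
    {x : ℕ → E} (hfin : ∀ k, {j | x j ∈ A k}.Finite) {l : Fin n} {i : ℕ} (hi : x i ∈ A l) :
    othersProd (fun y => ∏ k, (A k).mulIndicator (fun _ => c k) y) x i =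
      ∏ k, c k ^ ({j | x j ∈ A k}.ncard - if k = l then 1 else 0) := by
  classical
  have hle : ∀ y, ∏ k, (A k).mulIndicator (fun _ => c k) y ≤ 1 := fun y =>
    Finset.prod_le_one' fun k _ => by
      by_cases h : y ∈ A k <;> simp [h, hc]
  refine infProd_eq_of_eventuallyEq (fun j => ?_) ?_
  · split_ifs; exacts [le_rfl, hle _]
  -- The cells hold finitely many points, and any other point has factor one, so the partial
  -- products are eventually constant.
  have hev : ∀ᶠ n in atTop, ∀ k, ∀ j ∈ {j | x j ∈ A k}, j < n := by
    rw [eventually_all]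
    intro k
    obtain ⟨b, hb⟩ := (hfin k).bddAbove
    filter_upwards [eventually_gt_atTop b] with n hn j hj
    exact (hb hj).trans_lt hn
  filter_upwards [hev] with m hm
  have h1 : ∀ j, (if j = i then 1 else ∏ k, (A k).mulIndicator (fun _ => c k) (x j)) =
      ∏ k, if j ∈ {j | x j ∈ A k} \ {i} then c k else 1 := by
    intro j
    by_cases hj : j = i
    · simp [hj]
    · simp [hj, mulIndicator]
  simp_rw [h1]
  rw [Finset.prod_comm]
  refine Finset.prod_congr rfl fun k _ => ?_
  rw [Finset.prod_ite, Finset.prod_const_one, mul_one, Finset.prod_const]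
  congr 1
  have h2 : ((Finset.range m).filter fun j => j ∈ {j | x j ∈ A k} \ {i} : Finset ℕ) =
      ({j | x j ∈ A k} \ {i} : Set ℕ) := by
    ext j
    simp only [Finset.coe_filter, Finset.mem_range, mem_ofPred_eq, and_iff_right_iff_imp]
    exact fun hj => hm k j hj.1
  rw [← Set.ncard_coe_finset, h2]
  by_cases hk : k = l
  · subst hk
    rw [if_pos rfl]
    exact Set.ncard_sdiff_singleton_of_mem (s := {j | x j ∈ A k}) hi
  · rw [if_neg hk, Set.sdiff_singleton_eq_self, Nat.sub_zero]
    exact fun h => Set.disjoint_left.1 (hd hk) h hi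

lemma measurable_mulIndicator {E : Type*} [MeasurableSpace E] {f : E → ℝ≥0∞} (hf : Measurable f)
    {A : Set E} (hA : MeasurableSet A) : Measurable (A.mulIndicator f) := by
  classical
  rw [← Set.piecewise_eq_mulIndicator]
  exact hf.piecewise hA measurable_const

section Poisson

variable {Ω E : Type*} [MeasurableSpace Ω] [MeasurableSpace E]

@[fun_prop]
lemma Measurable.othersProd {α : Type*} [MeasurableSpace α] {g : α → E → ℝ≥0∞}
    (hg : Measurable (Function.uncurry g)) {X : ℕ → α → E} (hX : ∀ i, Measurable (X i)) (i : ℕ) :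
    Measurable fun a => othersProd (g a) (fun j => X j a) i := by
  refine Measurable.infProd fun j => ?_
  split_ifs
  · exact measurable_const
  · exact hg.comp (measurable_id.prodMk (hX j))

namespace IsPoissonProcess

variable {X : ℕ → Ω → E} {ν : Measure E} {μ : Measure Ω} [IsProbabilityMeasure μ]

/-- Every point in the cell `A l` contributes the same product, so the sum over points is a product
of functions of the counts, with the extra factor `n` for that cell. The counts are independent, and
the two Poisson sums evaluate each factor. -/
lemma mecke_cells (h : IsPoissonProcess X ν μ) {n : ℕ} {A : Fin n → Set E}
    (hA : ∀ k, MeasurableSet (A k)) (hd : Pairwise (Function.onFun Disjoint A))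
    (hν : ∀ k, ν (A k) < ∞) {c : Fin n → ℝ} (hc0 : ∀ k, 0 ≤ c k) (hc1 : ∀ k, c k ≤ 1)
    (l : Fin n) {g : E → ℝ≥0∞}
    (hg : g = fun y => ∏ k, (A k).mulIndicator (fun _ => ENNReal.ofReal (c k)) y) :
    ∑' i, ∫⁻ ω, (A l).indicator 1 (X i ω) * othersProd g (fun j => X j ω) i ∂μ =
      ν (A l) * negExp (∫⁻ y, (1 - g y) ∂ν) := by
  have hgm : Measurable g := by
    rw [hg]
    exact Finset.measurable_prod _ fun k _ => measurable_mulIndicator measurable_const (hA k)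
  have hm : ∀ i, Measurable fun ω =>
      (A l).indicator 1 (X i ω) * othersProd g (fun j => X j ω) i := fun i =>
    ((measurable_one.indicator (hA l)).comp (h.measurable i)).mul
      (Measurable.othersProd (g := fun _ => g) (hgm.comp measurable_snd) h.measurable i)
  have hcle : ∀ k, ENNReal.ofReal (c k) ≤ 1 := fun k => ENNReal.ofReal_le_one.2 (hc1 k)
  rw [← lintegral_tsum fun i => (hm i).aemeasurable]
  -- If `A l` is empty, the truncated exponent is harmless, because the count in front of it is
  -- zero.
  have h1 : ∀ᵐ ω ∂μ, ∑' i, (A l).indicator 1 (X i ω) * othersProd g (fun j => X j ω) i =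
      ∏ k, (if k = l then (natCount X (A k) ω : ℝ≥0∞) else 1) *
        ENNReal.ofReal (c k) ^ (natCount X (A k) ω - if k = l then 1 else 0) := by
    filter_upwards [ae_all_iff.2 fun k => h.ae_pointCount_eq (hA k) (hν k)] with ω hω
    have hfin : ∀ k, {j | X j ω ∈ A k}.Finite := fun k =>
      Set.encard_ne_top_iff.1 (by
        have := hω k
        rw [pointCount] at this
        rw [this]
        exact ENat.natCast_ne_top _)
    have hterm : ∀ i, (A l).indicator 1 (X i ω) * othersProd g (fun j => X j ω) i =
        (A l).indicator 1 (X i ω) * ∏ k, ENNReal.ofReal (c k) ^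
          (natCount X (A k) ω - if k = l then 1 else 0) := by
      intro i
      by_cases hi : X i ω ∈ A l
      · rw [hg, othersProd_cells hd hcle hfin hi]
        rfl
      · simp [hi]
    simp_rw [hterm]
    rw [ENNReal.tsum_mul_right, ← pointCount_eq_tsum, hω l, Finset.prod_mul_distrib,
      Finset.prod_ite_eq' Finset.univ l]
    simp
  rw [lintegral_congr_ae h1, h.lintegral_prod_natCount hA hd hν
    fun k m => (if k = l then (m : ℝ≥0∞) else 1) *
      ENNReal.ofReal (c k) ^ (m - if k = l then 1 else 0)]
  have h2 : ∀ k, ∫⁻ m, (if k = l then (m : ℝ≥0∞) else 1) *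
      ENNReal.ofReal (c k) ^ (m - if k = l then 1 else 0) ∂(poissonMeasure (ν (A k)).toNNReal) =
      (if k = l then ν (A k) else 1) *
        negExp (ν (A k) * ENNReal.ofReal (1 - c k)) := by
    intro k
    have h3 : negExp (ν (A k) * ENNReal.ofReal (1 - c k)) =
        ENNReal.ofReal (Real.exp (-((ν (A k)).toNNReal * (1 - c k)))) := by
      rw [← negExp_ofReal (mul_nonneg (NNReal.coe_nonneg _) (sub_nonneg.2 (hc1 k))),
        ENNReal.ofReal_mul (NNReal.coe_nonneg _), ENNReal.ofReal_coe_nnreal,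
        ENNReal.coe_toNNReal (hν k).ne]
    by_cases hk : k = l
    · simp only [hk, if_true]
      rw [lintegral_mul_pow_poissonMeasure _ (hc0 l), ← hk, h3, ENNReal.coe_toNNReal (hν k).ne]
    · simp only [hk, if_false, one_mul, Nat.sub_zero]
      rw [lintegral_pow_poissonMeasure _ (hc0 k), h3]
  rw [Finset.prod_congr rfl fun k _ => h2 k, Finset.prod_mul_distrib,
    Finset.prod_ite_eq' Finset.univ l, if_pos (Finset.mem_univ _)]
  congr 1
  -- Since the cells are disjoint, at most one factor of `g y` differs from one, and the complement
  -- of the product is a sum.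
  have h4 : ∀ y, 1 - g y = ∑ k, (A k).indicator (fun _ => ENNReal.ofReal (1 - c k)) y := by
    intro y
    rw [hg]
    by_cases hy : ∃ k, y ∈ A k
    · obtain ⟨k, hk⟩ := hy
      have hne : ∀ k', k' ≠ k → y ∉ A k' := fun k' hk' hy' =>
        Set.disjoint_left.1 (hd hk') hy' hk
      dsimp only
      rw [Finset.prod_eq_single k (fun k' _ hk' => by simp [hne k' hk']) (by simp),
        Finset.sum_eq_single k (fun k' _ hk' => by simp [hne k' hk']) (by simp)]
      simp [hk, ENNReal.ofReal_sub _ (hc0 k)]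
    · push Not at hy
      simp [hy]
  simp_rw [h4]
  rw [lintegral_finsetSum _ fun k _ => measurable_const.indicator (hA k)]
  simp_rw [lintegral_indicator_const (hA _)]
  have h5 : ∀ s : Finset (Fin n), ∏ k ∈ s, negExp (ν (A k) * ENNReal.ofReal (1 - c k)) =
      negExp (∑ k ∈ s, ENNReal.ofReal (1 - c k) * ν (A k)) := by
    intro s
    induction s using Finset.cons_induction with
    | empty => simp
    | cons a s ha ih => rw [Finset.prod_cons, Finset.sum_cons, negExp_add, ih, mul_comm (ν _)]
  exact h5 _

/-- Monotone convergence from above on both sides. Restricting the distinguished point to a set of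
finite intensity makes the initial integrals finite. -/
lemma mecke_limit {B : Set E} (hB : ν B < ∞) {W : ℕ → ℕ → Ω → ℝ≥0∞} {D : ℕ → E → ℝ≥0∞}
    (hBm : MeasurableSet B) (hX : ∀ i, Measurable (X i))
    (hWm : ∀ n i, Measurable (W n i)) (hDm : ∀ n, Measurable (D n)) (hW : Antitone W)
    (hD : Antitone D) (hD1 : ∀ y, D 0 y ≤ 1)
    (hid : ∀ n, ∑' i, ∫⁻ ω, B.indicator 1 (X i ω) * W n i ω ∂μ = ∫⁻ y in B, D n y ∂ν)
    (hW1 : ∀ i ω, W 0 i ω ≤ 1) :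
    ∑' i, ∫⁻ ω, B.indicator 1 (X i ω) * (⨅ n, W n i ω) ∂μ = ∫⁻ y in B, ⨅ n, D n y ∂ν := by
  have hDfin : ∫⁻ y in B, D 0 y ∂ν ≠ ∞ :=
    ((lintegral_mono hD1).trans_lt (by simpa using hB)).ne
  have hb : ∀ i, Measurable fun ω => B.indicator (1 : E → ℝ≥0∞) (X i ω) := fun i =>
    (measurable_one.indicator hBm).comp (hX i)
  rw [lintegral_iInf hDm hD hDfin]
  simp_rw [← hid]
  rw [← tsum_iInf_eq (a := fun n i => ∫⁻ ω, B.indicator 1 (X i ω) * W n i ω ∂μ)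
    (fun a b hab i => lintegral_mono fun ω => mul_le_mul_right (hW hab i ω) _)
    (by rw [hid]; exact hDfin)]
  refine tsum_congr fun i => ?_
  rw [← lintegral_iInf (f := fun n ω => B.indicator 1 (X i ω) * W n i ω)
    (fun n => (hb i).mul (hWm n i)) (fun a b hab ω => mul_le_mul_right (hW hab i ω) _)]
  · refine lintegral_congr fun ω => ?_
    by_cases hω : X i ω ∈ B <;> simp [hω]
  · refine ((lintegral_mono (g := fun _ => 1) fun ω => ?_).trans_lt (by simp)).ne
    by_cases hω : X i ω ∈ B <;> simp [hω, hW1]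

-- As functionals of `f`, the two sides are integrals against measures: a sum of images of `W i •
-- μ`, and `D • ν`. By an exhaustion with sets of finite `ν`-measure, it suffices to compare them on
-- such sets.
omit [IsProbabilityMeasure μ] in
lemma mecke_ext [SigmaFinite ν] (hX : ∀ i, Measurable (X i)) {W : ℕ → Ω → ℝ≥0∞}
    (hWm : ∀ i, Measurable (W i)) {D : E → ℝ≥0∞} (hDm : Measurable D)
    (h : ∀ B, MeasurableSet B → ν B < ∞ →
      ∑' i, ∫⁻ ω, B.indicator 1 (X i ω) * W i ω ∂μ = ∫⁻ y in B, D y ∂ν)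
    {f : E → ℝ≥0∞} (hf : Measurable f) :
    ∑' i, ∫⁻ ω, f (X i ω) * W i ω ∂μ = ∫⁻ y, f y * D y ∂ν := by
  have h1 : ∀ {f : E → ℝ≥0∞}, Measurable f → ∑' i, ∫⁻ ω, f (X i ω) * W i ω ∂μ =
      ∫⁻ y, f y ∂(Measure.sum fun i => (μ.withDensity (W i)).map (X i)) := by
    intro f hf
    rw [lintegral_sum_measure]
    refine tsum_congr fun i => ?_
    rw [lintegral_map hf (hX i)]
    refine Eq.trans ?_ (lintegral_withDensity_eq_lintegral_mul _ (hWm i) (hf.comp (hX i))).symm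
    exact lintegral_congr fun ω => mul_comm _ _
  have h2 : (Measure.sum fun i => (μ.withDensity (W i)).map (X i)) = ν.withDensity D := by
    ext B hB
    rw [← inter_univ B, ← iUnion_spanningSets ν, inter_iUnion,
      (monotone_const.inter (monotone_spanningSets ν)).measure_iUnion,
      (monotone_const.inter (monotone_spanningSets ν)).measure_iUnion]
    refine iSup_congr fun n => ?_
    have hm : MeasurableSet (B ∩ spanningSets ν n) := hB.inter (measurableSet_spanningSets ν n)
    rw [withDensity_apply _ hm, ← h _ hm
      ((measure_mono inter_subset_right).trans_lt (measure_spanningSets_lt_top ν n)),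
      h1 (measurable_one.indicator hm), lintegral_indicator_one hm]
  rw [h1 hf, h2, lintegral_withDensity_eq_lintegral_mul _ hDm hf]
  exact lintegral_congr fun ω => mul_comm _ _

/-- The level sets of the simple function, cut along `B`, form a finite partition of `S`. The
formula for cells is applied to each piece inside `B`, and the results are added. -/
lemma mecke_simple (h : IsPoissonProcess X ν μ) {B S : Set E} (hB : MeasurableSet B)
    (hS : MeasurableSet S) (hBS : B ⊆ S) (hν : ν S < ∞) (s : SimpleFunc E ℝ≥0∞)
    (hs : ∀ y, s y ≤ 1) {g : E → ℝ≥0∞} (hg : g = S.mulIndicator s) :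
    ∑' i, ∫⁻ ω, B.indicator 1 (X i ω) * othersProd g (fun j => X j ω) i ∂μ =
      ν B * negExp (∫⁻ y, (1 - g y) ∂ν) := by
  classical
  have e := (Fintype.equivFin (s.range × Bool)).symm
  -- The Boolean coordinate records membership in `B`, so that `B` is a union of cells.
  set A' : s.range × Bool → Set E := fun κ =>
    S ∩ (s ⁻¹' {κ.1.1} ∩ {y | (y ∈ B) = (κ.2 = true)}) with hA'
  have hA'B : ∀ v b, A' (v, b) = S ∩ (s ⁻¹' {v.1} ∩ if b then B else Bᶜ) := by
    intro v b
    ext y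
    cases b <;> simp [hA']
  have hmA' : ∀ κ, MeasurableSet (A' κ) := by
    rintro ⟨v, b⟩
    rw [hA'B]
    refine hS.inter ((s.measurableSet_fiber _).inter ?_)
    cases b
    exacts [by simpa using hB.compl, by simpa using hB]
  have hdA' : Pairwise (Function.onFun Disjoint A') := by
    rintro ⟨v, b⟩ ⟨v', b'⟩ hne
    refine Set.disjoint_left.2 fun y hy hy' => hne ?_
    simp only [hA', mem_inter_iff, mem_preimage, mem_singleton_iff, mem_ofPred_eq] at hy hy'
    refine Prod.ext (Subtype.ext (hy.2.1.symm.trans hy'.2.1)) ?_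
    exact Bool.eq_iff_iff.2 (hy.2.2 ▸ hy'.2.2 ▸ Iff.rfl)
  have hνA' : ∀ κ, ν (A' κ) < ∞ := fun κ => (measure_mono inter_subset_left).trans_lt hν
  have hval : ∀ κ : s.range × Bool, (κ.1.1 : ℝ≥0∞) ≤ 1 := fun κ => by
    obtain ⟨y, hy⟩ := SimpleFunc.mem_range.1 κ.1.2
    rw [← hy]
    exact hs y
  have hgprod : g = fun y => ∏ k, (A' (e k)).mulIndicator
      (fun _ => ENNReal.ofReal ((e k).1.1).toReal) y := by
    ext y
    rw [hg]
    rw [e.prod_comp fun κ => (A' κ).mulIndicator (fun _ => ENNReal.ofReal (κ.1.1).toReal) y]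
    by_cases hy : y ∈ S
    · have hκ : y ∈ A' (⟨s y, s.mem_range_self y⟩, decide (y ∈ B)) := by
        simp [hA', hy]
      rw [Finset.prod_eq_single (⟨s y, s.mem_range_self y⟩, decide (y ∈ B))]
      · rw [mulIndicator_of_mem hy, mulIndicator_of_mem hκ, ENNReal.ofReal_toReal]
        exact ((hs y).trans_lt ENNReal.one_lt_top).ne
      · intro κ _ hne
        exact mulIndicator_of_notMem (fun h' => Set.disjoint_left.1 (hdA' hne) h' hκ) _
      · simp
    · rw [mulIndicator_of_notMem hy, Finset.prod_eq_one]
      exact fun κ _ => mulIndicator_of_notMem (fun h' => hy h'.1) _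
  have hcell : ∀ v : s.range,
      ∑' i, ∫⁻ ω, (A' (v, true)).indicator 1 (X i ω) * othersProd g (fun j => X j ω) i ∂μ =
        ν (A' (v, true)) * negExp (∫⁻ y, (1 - g y) ∂ν) := by
    intro v
    have := h.mecke_cells (A := A' ∘ e) (fun k => hmA' _)
      (fun a b hab => hdA' (e.injective.ne hab)) (fun k => hνA' _)
      (c := fun k => ((e k).1.1).toReal) (fun k => ENNReal.toReal_nonneg)
      (fun k => ENNReal.toReal_le_of_le_ofReal zero_le_one (by simpa using hval (e k)))
      (e.symm (v, true)) hgprod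
    simpa using this
  have hBind : ∀ y, B.indicator (1 : E → ℝ≥0∞) y =
      ∑ v : s.range, (A' (v, true)).indicator 1 y := by
    intro y
    by_cases hy : y ∈ B
    · have hκ : y ∈ A' (⟨s y, s.mem_range_self y⟩, true) := by simp [hA', hBS hy, hy]
      rw [Finset.sum_eq_single ⟨s y, s.mem_range_self y⟩]
      · rw [indicator_of_mem hy, indicator_of_mem hκ]
      · intro v _ hne
        refine indicator_of_notMem (fun h' => Set.disjoint_left.1 (hdA' ?_) h' hκ) _
        exact fun h0 => hne (congrArg Prod.fst h0)
      · simp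
    · rw [indicator_of_notMem hy, Finset.sum_eq_zero]
      exact fun v _ => indicator_of_notMem (fun h' => hy (by simpa [hA'] using h'.2.2)) _
  have hgm : Measurable g := by rw [hg]; exact measurable_mulIndicator s.measurable hS
  have hνB : ν B = ∑ v : s.range, ν (A' (v, true)) := by
    simp_rw [← lintegral_indicator_one hB, hBind, ← lintegral_indicator_one (hmA' _)]
    exact lintegral_finsetSum _ fun v _ => measurable_one.indicator (hmA' _)
  simp_rw [hBind, Finset.sum_mul]
  have hsum : ∀ i, ∫⁻ ω, ∑ v : s.range,
      (A' (v, true)).indicator 1 (X i ω) * othersProd g (fun j => X j ω) i ∂μ =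
      ∑ v : s.range, ∫⁻ ω,
        (A' (v, true)).indicator 1 (X i ω) * othersProd g (fun j => X j ω) i ∂μ := fun i =>
    lintegral_finsetSum _ fun v _ =>
      ((measurable_one.indicator (hmA' _)).comp (h.measurable i)).mul
        (Measurable.othersProd (g := fun _ => g) (hgm.comp measurable_snd) h.measurable i)
  simp_rw [hsum]
  rw [Summable.tsum_finsetSum fun _ _ => ENNReal.summable, hνB, Finset.sum_mul]
  exact Finset.sum_congr rfl fun v _ => hcell v

/-- The Mecke formula for a product functional. -/
theorem mecke [SigmaFinite ν] (h : IsPoissonProcess X ν μ) {f g : E → ℝ≥0∞} (hf : Measurable f)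
    (hg : Measurable g) (hg1 : ∀ y, g y ≤ 1) :
    ∑' i, ∫⁻ ω, f (X i ω) * othersProd g (fun j => X j ω) i ∂μ =
      ∫⁻ y, f y * negExp (∫⁻ y', (1 - g y') ∂ν) ∂ν := by
  refine mecke_ext h.measurable (fun i => Measurable.othersProd (g := fun _ => g)
    (hg.comp measurable_snd) h.measurable i) measurable_const (fun B hB hνB => ?_) hf
  -- Simple functions increase to `1 - g`. They are cut off to sets `S n` of finite measure that
  -- contain `B`, and the corresponding `gn n` decrease to `g`.
  set s : ℕ → SimpleFunc E ℝ≥0∞ := SimpleFunc.eapprox fun y => 1 - g y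
  have hsle : ∀ n y, s n y ≤ 1 - g y := fun n y => 
    (le_iSup (fun n => (SimpleFunc.eapprox (fun y => 1 - g y) n : E → ℝ≥0∞) y) n).trans
      (SimpleFunc.iSup_eapprox_apply (measurable_const.sub hg) y).le
  set S : ℕ → Set E := fun n => B ∪ spanningSets ν n
  have hSm : ∀ n, MeasurableSet (S n) := fun n => hB.union (measurableSet_spanningSets ν n)
  have hSν : ∀ n, ν (S n) < ∞ := fun n =>
    measure_union_lt_top hνB (measure_spanningSets_lt_top ν n)
  have hSmono : Monotone S := fun a b hab => union_subset_union_right _ (monotone_spanningSets ν hab)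
  set gn : ℕ → E → ℝ≥0∞ := fun n => (S n).mulIndicator ((s n).map fun v => 1 - v) with hgn
  have hgn1 : ∀ n y, gn n y ≤ 1 := fun n y => by
    by_cases hy : y ∈ S n <;> simp [hgn, hy]
  have hgnm : ∀ n, Measurable (gn n) := fun n => measurable_mulIndicator (SimpleFunc.measurable _) (hSm n)
  have hsub : ∀ n y, 1 - gn n y = (S n).indicator (s n) y := fun n y => by
    by_cases hy : y ∈ S n
    · simp only [hgn, mulIndicator_of_mem hy, indicator_of_mem hy, SimpleFunc.map_apply]
      exact ENNReal.sub_sub_cancel ENNReal.one_ne_top ((hsle n y).trans tsub_le_self)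
    · simp [hgn, hy]
  have hind_mono : Monotone fun n => (S n).indicator (s n) := fun a b hab y => by
    by_cases hy : y ∈ S a
    · simp only [indicator_of_mem hy, indicator_of_mem (hSmono hab hy)]
      exact SimpleFunc.monotone_eapprox _ hab y
    · simp [hy]
  have hind_sup : ∀ y, ⨆ n, (S n).indicator (s n) y = 1 - g y := by
    intro y
    refine le_antisymm (iSup_le fun n => ?_) ?_
    · by_cases hy : y ∈ S n <;> simp [hy, hsle]
    · refine (SimpleFunc.iSup_eapprox_apply (measurable_const.sub hg) y).symm.le.trans ?_
      refine iSup_le fun n => ?_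
      obtain ⟨m, hm⟩ : ∃ m, y ∈ spanningSets ν m := 
        mem_iUnion.1 (by rw [iUnion_spanningSets]; trivial)
      have hy : y ∈ S (max n m) := Or.inr (monotone_spanningSets ν (le_max_right n m) hm)
      refine le_trans ?_ (le_iSup _ (max n m))
      rw [indicator_of_mem hy]
      exact SimpleFunc.monotone_eapprox _ (le_max_left n m) y
  have hgn_eq : ∀ n y, gn n y = 1 - (S n).indicator (s n) y := fun n y => by
    rw [← hsub, ENNReal.sub_sub_cancel ENNReal.one_ne_top (hgn1 n y)]
  have hgn_anti : Antitone gn := fun a b hab y => by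
    rw [hgn_eq, hgn_eq]
    exact tsub_le_tsub_left (hind_mono hab y) _
  have hgn_inf : ∀ y, ⨅ n, gn n y = g y := fun y => by
    simp_rw [hgn_eq]
    rw [← ENNReal.sub_iSup (by simp), hind_sup,
      ENNReal.sub_sub_cancel ENNReal.one_ne_top (hg1 y)]
  have hneg_inf : negExp (∫⁻ y', (1 - g y') ∂ν) = ⨅ n, negExp (∫⁻ y', (1 - gn n y') ∂ν) := by
    simp_rw [hsub, ← hind_sup]
    rw [lintegral_iSup (fun n => (s n).measurable.indicator (hSm n)) hind_mono]
    have hmono : Monotone fun n => ∫⁻ y', (S n).indicator (s n) y' ∂ν :=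
      fun a b hab => lintegral_mono (hind_mono hab)
    exact tendsto_nhds_unique ((continuous_negExp.tendsto _).comp (tendsto_atTop_iSup hmono))
      (tendsto_atTop_iInf (antitone_negExp.comp_monotone hmono))
  have key := mecke_limit (μ := μ) hνB (W := fun n i ω => othersProd (gn n) (fun j => X j ω) i)
    (D := fun n _ => negExp (∫⁻ y', (1 - gn n y') ∂ν)) hB h.measurable
    (fun n i => Measurable.othersProd (g := fun _ => gn n)
      ((hgnm n).comp measurable_snd) h.measurable i) (fun n => measurable_const)
    (fun a b hab i ω => othersProd_mono (hgn_anti hab) _ _)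
    (fun a b hab _ => antitone_negExp (lintegral_mono fun y =>
      tsub_le_tsub_left (hgn_anti hab y) _)) (fun _ => negExp_le_one _)
    (fun n => by
      rw [h.mecke_simple hB (hSm n) subset_union_left (hSν n) _
        (fun y => by simp) rfl, setLIntegral_const, mul_comm])
    (fun i ω => othersProd_le_one _ _ _)
  rw [hneg_inf, ← key]
  refine tsum_congr fun i => lintegral_congr fun ω => ?_
  rw [← othersProd_iInf hgn1 hgn_anti]
  simp_rw [hgn_inf]

/-- The Mecke formula, when the functional of the other points depends on a discrete function of
the distinguished point. -/
theorem mecke_discrete [SigmaFinite ν] (h : IsPoissonProcess X ν μ) {f : E → ℝ≥0∞}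
    (hf : Measurable f) {q : E → ℕ} (hq : Measurable q) {g : ℕ → E → ℝ≥0∞}
    (hg : ∀ a, Measurable (g a)) (hg1 : ∀ a y, g a y ≤ 1) :
    ∑' i, ∫⁻ ω, f (X i ω) * othersProd (g (q (X i ω))) (fun j => X j ω) i ∂μ =
      ∫⁻ y, f y * negExp (∫⁻ y', (1 - g (q y) y') ∂ν) ∂ν := by
  have hqs : ∀ a, MeasurableSet (q ⁻¹' {a}) := fun a => hq (measurableSet_singleton a)
  -- Decomposing `f` along the fibres of `q` freezes the functional on each fibre, where the plain
  -- Mecke formula applies.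
  have hpt : ∀ y (F : ℕ → ℝ≥0∞), f y * F (q y) = ∑' a, (q ⁻¹' {a}).indicator f y * F a := by
    intro y F
    rw [tsum_eq_single (q y)]
    · rw [indicator_of_mem (by simp)]
    · intro a ha
      rw [indicator_of_notMem (by simpa using ha.symm), zero_mul]
  have hm : ∀ i a, Measurable fun ω => (q ⁻¹' {a}).indicator f (X i ω) *
      othersProd (g a) (fun j => X j ω) i := fun i a =>
    ((hf.indicator (hqs a)).comp (h.measurable i)).mul (Measurable.othersProd (g := fun _ => g a)
      ((hg a).comp measurable_snd) h.measurable i)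
  have h1 : ∀ i, ∫⁻ ω, f (X i ω) * othersProd (g (q (X i ω))) (fun j => X j ω) i ∂μ =
      ∑' a, ∫⁻ ω, (q ⁻¹' {a}).indicator f (X i ω) * othersProd (g a) (fun j => X j ω) i ∂μ := by
    intro i
    rw [← lintegral_tsum fun a => (hm i a).aemeasurable]
    exact lintegral_congr fun ω => hpt _ fun a => othersProd (g a) (fun j => X j ω) i
  simp_rw [h1]
  rw [ENNReal.tsum_comm]
  simp_rw [fun a => h.mecke (hf.indicator (hqs a)) (hg a) (hg1 a)]
  rw [← lintegral_tsum fun a => ((hf.indicator (hqs a)).mul_const _).aemeasurable]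
  exact lintegral_congr fun y => (hpt y fun a => negExp (∫⁻ y', (1 - g a y') ∂ν)).symm

end IsPoissonProcess

end Poisson

/-! ### Dyadic approximation from below -/

/-- The largest multiple of `2^{-n}` that is at most `r`. -/
def dyadicFloor (n : ℕ) (r : ℝ≥0) : ℝ≥0 := ⌊2 ^ n * r⌋₊ / 2 ^ n

lemma dyadicFloor_le (n : ℕ) (r : ℝ≥0) : dyadicFloor n r ≤ r := by
  rw [dyadicFloor, div_le_iff₀ (by positivity), mul_comm]
  exact Nat.floor_le (by positivity)

lemma monotone_dyadicFloor (r : ℝ≥0) : Monotone fun n => dyadicFloor n r := by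
  refine monotone_nat_of_le_succ fun n => ?_
  rw [dyadicFloor, dyadicFloor, div_le_div_iff₀ (by positivity) (by positivity), pow_succ (2 : ℝ≥0)]
  have h : (2 * ⌊2 ^ n * r⌋₊ : ℕ) ≤ ⌊2 ^ n * 2 * r⌋₊ := Nat.le_floor (by
    push_cast
    calc (2 : ℝ≥0) * ⌊2 ^ n * r⌋₊ ≤ 2 * (2 ^ n * r) := by
          gcongr; exact Nat.floor_le (by positivity)
      _ = 2 ^ n * 2 * r := by ring)
  calc (⌊2 ^ n * r⌋₊ : ℝ≥0) * (2 ^ n * 2) = (2 * ⌊2 ^ n * r⌋₊ : ℕ) * 2 ^ n := by push_cast; ring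
    _ ≤ _ := by gcongr

lemma tendsto_dyadicFloor (r : ℝ≥0) :
    Tendsto (fun n => dyadicFloor n r) atTop (𝓝[≤] r) := by
  refine tendsto_nhdsWithin_iff.2 ⟨?_, Eventually.of_forall fun n => dyadicFloor_le n r⟩
  have h := (tendsto_nat_floor_mul_div_atTop (R := ℝ) (a := r) r.coe_nonneg).comp
    (tendsto_pow_atTop_atTop_of_one_lt (r := (2 : ℝ)) (by norm_num))
  rw [← NNReal.tendsto_coe]
  refine h.congr fun n => ?_
  have : ⌊(2 : ℝ) ^ n * r⌋₊ = ⌊2 ^ n * r⌋₊ := by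
    exact Nonneg.nat_floor_coe (2 ^ n * r)
  simp [dyadicFloor, mul_comm (r : ℝ), this]

section Poisson

variable {Ω E : Type*} [MeasurableSpace Ω] [MeasurableSpace E]

/-- A function that is decreasing and left-continuous in its first argument is the infimum of its
dyadic approximations. -/
lemma eq_iInf_dyadicFloor {G : ℝ≥0 → ℝ≥0∞} (hG : Antitone G)
    {r : ℝ≥0} (hc : ContinuousWithinAt G (Iic r) r) : G r = ⨅ n, G (dyadicFloor n r) :=
  tendsto_nhds_unique (hc.tendsto.comp (tendsto_dyadicFloor r))
    (tendsto_atTop_iInf fun _ _ hab => hG (monotone_dyadicFloor r hab))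

lemma measurable_floor_two_pow_mul (n : ℕ) :
    Measurable fun r : ℝ≥0 => ⌊2 ^ n * r⌋₊ :=
  Nat.measurable_floor.comp (measurable_const.mul measurable_id)

lemma measurable_uncurry_dyadicFloor {G : ℝ≥0 → E → ℝ≥0∞} (hGm : ∀ r, Measurable (G r)) (n : ℕ) :
    Measurable fun z : ℝ≥0 × E => G (dyadicFloor n z.1) z.2 := by
  have h : Measurable fun z : ℕ × E => G (z.1 / 2 ^ n) z.2 :=
    measurable_from_prod_countable_right fun a => hGm (a / 2 ^ n)
  exact h.comp (((measurable_floor_two_pow_mul n).comp measurable_fst).prodMk measurable_snd)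

namespace IsPoissonProcess

variable {X : ℕ → Ω → E} {ν : Measure E} {μ : Measure Ω} [IsProbabilityMeasure μ]

-- The dyadic floors increase to `r`, so by monotonicity and left-continuity `1 - G` increases to
-- its value at `r`. Monotone convergence and the continuity of `negExp` finish the argument.
omit [MeasurableSpace Ω] [IsProbabilityMeasure μ] in
lemma negExp_lintegral_eq_iInf {G : ℝ≥0 → E → ℝ≥0∞} (hGm : ∀ r, Measurable (G r))
    (hG : ∀ y, Antitone fun r => G r y)
    (hGc : ∀ y r, ContinuousWithinAt (fun r => G r y) (Iic r) r) (r : ℝ≥0) :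
    negExp (∫⁻ y, (1 - G r y) ∂ν) = ⨅ n, negExp (∫⁻ y, (1 - G (dyadicFloor n r) y) ∂ν) := by
  have hmono : Monotone fun n y => 1 - G (dyadicFloor n r) y := fun a b hab y =>
    tsub_le_tsub_left (hG y (monotone_dyadicFloor _ hab)) _
  have h1 : ∀ y, 1 - G r y = ⨆ n, (1 - G (dyadicFloor n r) y) := fun y => by
    rw [eq_iInf_dyadicFloor (hG y) (hGc y r), ENNReal.sub_iInf]
  simp_rw [h1]
  rw [lintegral_iSup (f := fun n y => 1 - G (dyadicFloor n r) y)
    (fun n => measurable_const.sub (hGm _)) hmono]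
  have hmono' : Monotone fun n => ∫⁻ y, (1 - G (dyadicFloor n r) y) ∂ν :=
    fun a b hab => lintegral_mono (hmono hab)
  exact tendsto_nhds_unique ((continuous_negExp.tendsto _).comp (tendsto_atTop_iSup hmono'))
    (tendsto_atTop_iInf (antitone_negExp.comp_monotone hmono'))

/-- The Mecke formula for product functionals that depend, in a decreasing and left-continuous way,
on a numerical function of the distinguished point. -/
theorem mecke_antitone [SigmaFinite ν] (h : IsPoissonProcess X ν μ) {f : E → ℝ≥0∞}
    (hf : Measurable f) {q : E → ℝ≥0} (hq : Measurable q) {G : ℝ≥0 → E → ℝ≥0∞}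
    (hGm : ∀ r, Measurable (G r)) (hG1 : ∀ r y, G r y ≤ 1) (hG : ∀ y, Antitone fun r => G r y)
    (hGc : ∀ y r, ContinuousWithinAt (fun r => G r y) (Iic r) r) :
    ∑' i, ∫⁻ ω, f (X i ω) * othersProd (G (q (X i ω))) (fun j => X j ω) i ∂μ =
      ∫⁻ y, f y * negExp (∫⁻ y', (1 - G (q y) y') ∂ν) ∂ν := by
  -- Rounding the numerical parameter down to a dyadic number makes the functional depend on a
  -- natural number only. As `G` is decreasing and left-continuous, both sides of the discrete
  -- formula decrease to the wanted ones.
  set W : ℕ → ℕ → Ω → ℝ≥0∞ := fun n i ω =>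
    othersProd (G (dyadicFloor n (q (X i ω)))) (fun j => X j ω) i with hWdef
  set D : ℕ → E → ℝ≥0∞ := fun n y =>
    negExp (∫⁻ y', (1 - G (dyadicFloor n (q y)) y') ∂ν) with hDdef
  have hD : ∀ y, negExp (∫⁻ y', (1 - G (q y) y') ∂ν) = ⨅ n, D n y := fun y =>
    negExp_lintegral_eq_iInf hGm hG hGc (q y)
  have hDm : ∀ n, Measurable (D n) := by
    intro n
    have h2 : Measurable fun a : ℕ => negExp (∫⁻ y', (1 - G (a / 2 ^ n) y') ∂ν) :=
      Measurable.of_discrete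
    exact h2.comp ((measurable_floor_two_pow_mul n).comp hq)
  have hWm : ∀ n i, Measurable (W n i) := by
    intro n i
    have h1 : Measurable fun z : Ω × E => (q (X i z.1), z.2) :=
      ((hq.comp (h.measurable i)).comp measurable_fst).prodMk measurable_snd
    have h2 := (measurable_uncurry_dyadicFloor hGm n).comp h1
    exact Measurable.othersProd (g := fun ω => G (dyadicFloor n (q (X i ω)))) h2 h.measurable i
  have hW : ∀ i ω, othersProd (G (q (X i ω))) (fun j => X j ω) i = ⨅ n, W n i ω := by
    intro i ω
    rw [hWdef]
    dsimp only
    rw [← othersProd_iInf (fun n y => hG1 _ _)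
      (fun a b hab y => hG y (monotone_dyadicFloor _ hab))]
    congr 1
    ext y
    exact eq_iInf_dyadicFloor (hG y) (hGc y _)
  have hWanti : Antitone W := fun a b hab i ω =>
    othersProd_mono (fun y => hG y (monotone_dyadicFloor (q (X i ω)) hab)) (fun j => X j ω) i
  have hDanti : Antitone D := fun a b hab y => antitone_negExp (lintegral_mono fun y' =>
    tsub_le_tsub_left (hG y' (monotone_dyadicFloor (q y) hab)) _)
  simp_rw [hW, hD]
  refine mecke_ext h.measurable (fun i => Measurable.iInf fun n => hWm n i) (Measurable.iInf hDm)
    (fun B hB hνB => ?_) hf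
  refine mecke_limit hνB hB h.measurable hWm hDm hWanti hDanti (fun _ => negExp_le_one _)
    (fun n => ?_) (fun i ω => othersProd_le_one _ _ _)
  refine (h.mecke_discrete (measurable_one.indicator hB)
    (q := fun y => ⌊2 ^ n * q y⌋₊) ((measurable_floor_two_pow_mul n).comp hq)
    (g := fun a => G (a / 2 ^ n)) (fun a => hGm _) (fun a y => hG1 _ _)).trans ?_
  rw [← lintegral_indicator hB]
  refine lintegral_congr fun y => ?_
  by_cases hy : y ∈ B <;> simp [hy, hDdef, dyadicFloor]

/-! ### The Campbell formula and the almost sure absence of ties -/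

/-- The Campbell formula. -/
theorem campbell [SigmaFinite ν] (h : IsPoissonProcess X ν μ) {f : E → ℝ≥0∞}
    (hf : Measurable f) : ∑' i, ∫⁻ ω, f (X i ω) ∂μ = ∫⁻ y, f y ∂ν := by
  have := h.mecke hf (g := fun _ => 1) measurable_const (fun _ => le_rfl)
  simpa [othersProd, infProd] using this

/-- Two points of a Poisson process almost surely do not satisfy a given equation. -/
theorem ae_forall_ne [SigmaFinite ν] (h : IsPoissonProcess X ν μ) {a b : E → ℝ}
    (ha : Measurable a) (hb : Measurable b) (ha0 : ∀ y, 0 ≤ a y) (hb0 : ∀ y, 0 ≤ b y)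
    (hfin : ∀ t, ν {y | a y ≤ t} < ∞) (hnull : ∀ t, ν {y | a y = t} = 0) :
    ∀ᵐ ω ∂μ, ∀ i j, j ≠ i → a (X j ω) ≠ b (X i ω) := by
  -- The product of `cell n k` over the other points vanishes as soon as one of them has its value
  -- of `a` in the `k`-th dyadic interval. Taking the interval of `b (X i ω)` detects every
  -- coincidence, and the intervals shrink as `n` grows.
  set cell : ℕ → ℕ → E → ℝ≥0∞ := fun n k => {y | ⌊2 ^ n * a y⌋₊ = k}ᶜ.indicator 1 with hcell
  have hfa : ∀ n, Measurable fun y => ⌊2 ^ n * a y⌋₊ := fun n =>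
    Nat.measurable_floor.comp (measurable_const.mul ha)
  have hfb : ∀ n, Measurable fun y => ⌊2 ^ n * b y⌋₊ := fun n =>
    Nat.measurable_floor.comp (measurable_const.mul hb)
  have hcm : ∀ n k, MeasurableSet {y | ⌊2 ^ n * a y⌋₊ = k} := fun n k =>
    hfa n (measurableSet_singleton k)
  have hcellm : ∀ n k, Measurable (cell n k) := fun n k =>
    measurable_one.indicator (hcm n k).compl
  have hcell1 : ∀ n k y, cell n k y ≤ 1 := fun n k y =>
    Set.indicator_le_self' (fun _ _ => zero_le) y
  set bad : ℕ → Set Ω := fun i => {ω | ∃ j, j ≠ i ∧ a (X j ω) = b (X i ω)} with hbad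
  have hbadm : ∀ i, MeasurableSet (bad i) := by
    intro i
    have : bad i = ⋃ j, {ω | j ≠ i ∧ a (X j ω) = b (X i ω)} := by ext; simp [hbad]
    rw [this]
    exact MeasurableSet.iUnion fun j => (MeasurableSet.const _).inter
      (measurableSet_eq_fun (ha.comp (h.measurable j)) (hb.comp (h.measurable i)))
  have hcellval : ∀ n x, ∫⁻ y, (1 - cell n ⌊2 ^ n * b x⌋₊ y) ∂ν =
      ν {y | ⌊2 ^ n * a y⌋₊ = ⌊2 ^ n * b x⌋₊} := by
    intro n x
    rw [← lintegral_indicator_one (hcm n _)]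
    refine lintegral_congr fun y => ?_
    by_cases hy : y ∈ {y | ⌊2 ^ n * a y⌋₊ = ⌊2 ^ n * b x⌋₊}
    · rw [hcell, indicator_of_mem hy]
      simp [indicator_of_notMem (notMem_compl_iff.2 hy)]
    · rw [hcell, indicator_of_notMem hy]
      simp [indicator_of_mem (mem_compl hy)]
  have hlim : ∀ x, Tendsto (fun n => negExp (∫⁻ y, (1 - cell n ⌊2 ^ n * b x⌋₊ y) ∂ν)) atTop
      (𝓝 1) := by
    intro x
    simp_rw [hcellval]
    -- Continuity from above along neighbourhoods of a null level set; `hfin` makes the first of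
    -- them finite.
    have h0 : Tendsto (fun n : ℕ => ν {y | |a y - b x| ≤ (1 / 2) ^ n}) atTop (𝓝 0) := by
      have hset : {y | a y = b x} = ⋂ n : ℕ, {y | |a y - b x| ≤ (1 / 2) ^ n} := by
        ext y
        simp only [mem_ofPred_eq, mem_iInter]
        constructor
        · intro hy n
          simp [hy]
        · intro hy
          have := ge_of_tendsto' (tendsto_pow_atTop_nhds_zero_of_lt_one (r := (1 / 2 : ℝ))
            (by norm_num) (by norm_num)) hy
          exact sub_eq_zero.1 (abs_nonpos_iff.1 this)
      rw [← hnull (b x), hset]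
      refine tendsto_measure_iInter_atTop (fun n => ?_) ?_ ⟨0, ?_⟩
      · exact (measurableSet_le (continuous_abs.measurable.comp (ha.sub_const _))
          measurable_const).nullMeasurableSet
      · intro m n hmn y hy
        have hy' : |a y - b x| ≤ (1 / 2) ^ n := hy
        exact hy'.trans (pow_le_pow_of_le_one (by norm_num) (by norm_num) hmn)
      · refine ((measure_mono fun y hy => ?_).trans_lt (hfin (b x + 1))).ne
        have hy' : |a y - b x| ≤ (1 / 2) ^ 0 := hy
        have := (abs_le.1 hy').2
        simp only [pow_zero] at this
        change a y ≤ b x + 1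
        linarith
    have h1 : Tendsto (fun n : ℕ => ν {y | ⌊2 ^ n * a y⌋₊ = ⌊2 ^ n * b x⌋₊}) atTop (𝓝 0) := by
      refine tendsto_of_tendsto_of_tendsto_of_le_of_le tendsto_const_nhds h0
        (fun _ => zero_le) fun n => measure_mono fun y hy => ?_
      have e1 := Nat.floor_le (a := 2 ^ n * a y) (mul_nonneg (by positivity) (ha0 y))
      have e2 := Nat.floor_le (a := 2 ^ n * b x) (mul_nonneg (by positivity) (hb0 x))
      have e3 := Nat.lt_floor_add_one (2 ^ n * a y)
      have e4 := Nat.lt_floor_add_one (2 ^ n * b x)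
      have hy' : ⌊2 ^ n * a y⌋₊ = ⌊2 ^ n * b x⌋₊ := hy
      rw [hy'] at e1 e3
      change |a y - b x| ≤ (1 / 2) ^ n
      have e5 : |2 ^ n * (a y - b x)| ≤ 1 := abs_le.2 ⟨by linarith, by linarith⟩
      rw [abs_mul, abs_of_pos (by positivity : (0 : ℝ) < 2 ^ n)] at e5
      rw [one_div, inv_pow, ← one_div, le_div_iff₀ (by positivity), mul_comm]
      exact e5
    rw [← negExp_zero]
    exact (continuous_negExp.tendsto 0).comp h1
  have hzero : ∀ m, ∀ᵐ ω ∂μ, ∀ i, X i ω ∈ spanningSets ν m → ω ∉ bad i := by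
    intro m
    set B := spanningSets ν m with hBdef
    have hB : MeasurableSet B := measurableSet_spanningSets ν m
    have hνB : ν B < ∞ := measure_spanningSets_lt_top ν m
    have hXB : ∀ i, Measurable fun ω => B.indicator (1 : E → ℝ≥0∞) (X i ω) := fun i =>
      (measurable_one.indicator hB).comp (h.measurable i)
    set K := ∑' i, ∫⁻ ω, B.indicator 1 (X i ω) * (bad i).indicator 1 ω ∂μ with hK
    -- A point with a coincidence has product zero and any other point has product at most one, so
    -- together they count each point of `B` at most once. The integral tends to `ν B`, which forces
    -- `K = 0`.
    have hle : ∀ n : ℕ, K + ∫⁻ x in B,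
        negExp (∫⁻ y, (1 - cell n ⌊2 ^ n * b x⌋₊ y) ∂ν) ∂ν ≤ ν B := by
      intro n
      have e := h.mecke_discrete (measurable_one.indicator hB) (hfb n) (hcellm n) (hcell1 n)
      have e' : ∫⁻ x in B, negExp (∫⁻ y, (1 - cell n ⌊2 ^ n * b x⌋₊ y) ∂ν) ∂ν =
          ∫⁻ x, B.indicator 1 x * negExp (∫⁻ y, (1 - cell n ⌊2 ^ n * b x⌋₊ y) ∂ν) ∂ν := by
        rw [← lintegral_indicator hB]
        refine lintegral_congr fun y => ?_
        by_cases hy : y ∈ B <;> simp [hy]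
      rw [e', ← e, hK, ← ENNReal.tsum_add, ← lintegral_indicator_one hB,
        ← h.campbell (measurable_one.indicator hB)]
      refine ENNReal.tsum_le_tsum fun i => ?_
      rw [← lintegral_add_left (f := fun ω => B.indicator 1 (X i ω) * (bad i).indicator 1 ω)
        ((hXB i).mul (measurable_one.indicator (hbadm i)))]
      refine lintegral_mono fun ω => ?_
      rw [← mul_add]
      refine mul_le_of_le_one_right' ?_
      by_cases hω : ω ∈ bad i
      · obtain ⟨j, hji, hj⟩ := hω
        have : othersProd (cell n ⌊2 ^ n * b (X i ω)⌋₊) (fun j => X j ω) i = 0 := by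
          refine le_antisymm ((iInf_le _ (j + 1)).trans ?_) zero_le
          rw [Finset.prod_eq_zero (Finset.self_mem_range_succ j)]
          rw [if_neg hji]
          refine indicator_of_notMem (notMem_compl_iff.2 ?_) _
          change ⌊2 ^ n * a (X j ω)⌋₊ = _
          rw [hj]
        rw [this, add_zero]
        exact Set.indicator_le_self' (fun _ _ => zero_le) _
      · rw [indicator_of_notMem hω, zero_add]
        exact othersProd_le_one _ _ _
    have hlimB : Tendsto (fun n : ℕ => ∫⁻ x in B,
        negExp (∫⁻ y, (1 - cell n ⌊2 ^ n * b x⌋₊ y) ∂ν) ∂ν) atTop (𝓝 (∫⁻ _ in B, 1 ∂ν)) := by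
      refine tendsto_lintegral_of_dominated_convergence (fun _ => 1) (fun n => ?_)
        (fun n => Eventually.of_forall fun x => negExp_le_one _) (by simpa using hνB.ne)
        (Eventually.of_forall hlim)
      have : Measurable fun k : ℕ => negExp (∫⁻ y, (1 - cell n k y) ∂ν) := Measurable.of_discrete
      exact this.comp (hfb n)
    have hK0 : K = 0 := by
      have := le_of_tendsto' (tendsto_const_nhds.add hlimB) hle
      rw [setLIntegral_one] at this
      by_contra hne
      exact absurd this (not_le.2 (by
        rw [add_comm]; exact ENNReal.lt_add_right hνB.ne hne))
    rw [ENNReal.tsum_eq_zero] at hK0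
    refine ae_all_iff.2 fun i => ?_
    have := (lintegral_eq_zero_iff
      ((hXB i).mul (measurable_one.indicator (hbadm i)))).1 (hK0 i)
    filter_upwards [this] with ω hω hi hbi
    simp [hi, hbi] at hω
  filter_upwards [ae_all_iff.2 hzero] with ω hω i j hji heq
  obtain ⟨m, hm⟩ : ∃ m, X i ω ∈ spanningSets ν m :=
    mem_iUnion.1 (by rw [iUnion_spanningSets]; trivial)
  exact hω m i hm ⟨j, hji, heq⟩

end IsPoissonProcess

end Poisson

/-! ### The Gamma distribution -/

section Gamma

variable {m : ℕ}

lemma isProbabilityMeasure_gamma (hm : 1 ≤ m) : IsProbabilityMeasure (gammaMeasure m m) :=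
  isProbabilityMeasure_gammaMeasure (by positivity) (by positivity)

lemma gammaMeasure_Iic_zero {a r : ℝ} : gammaMeasure a r (Iic 0) = 0 := by
  rw [gammaMeasure, withDensity_apply _ measurableSet_Iic,
    ← setLIntegral_congr Iio_ae_eq_Iic, lintegral_gammaPDF_of_nonpos le_rfl]

lemma ae_gammaMeasure_pos {a r : ℝ} : ∀ᵐ y ∂(gammaMeasure a r), 0 < y := by
  rw [ae_iff]
  simp only [not_lt]
  exact gammaMeasure_Iic_zero

lemma gammaTail_eq (hm : 1 ≤ m) (x : ℝ) : gammaTail m x = 1 - cdf (gammaMeasure m m) x := by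
  have := isProbabilityMeasure_gamma hm
  rw [gammaTail, cdf_eq_real, ← compl_Iic, probReal_compl_eq_one_sub measurableSet_Iic]

/-- Multiplying the density by `e^(-v y)` gives, up to a constant, the Gamma density with the same
shape and rate `m + v`; the constant is the Laplace transform. -/
lemma lintegral_exp_gammaMeasure (hm : 1 ≤ m) {v : ℝ} (hv : 0 ≤ v) :
    ∫⁻ y, ENNReal.ofReal (Real.exp (-(v * y))) ∂(gammaMeasure m m) =
      ENNReal.ofReal (((1 + v / m) ^ m)⁻¹) := by
  have hm0 : (0 : ℝ) < m := by exact_mod_cast hm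
  have hpdf : Measurable (gammaPDF m m) := (measurable_gammaPDFReal _ _).ennreal_ofReal
  rw [gammaMeasure, lintegral_withDensity_eq_lintegral_mul _ hpdf (by fun_prop)]
  have h1 : ∀ y, (gammaPDF m m * fun y => ENNReal.ofReal (Real.exp (-(v * y)))) y =
      ENNReal.ofReal (((1 + v / m) ^ m)⁻¹) * gammaPDF m (m + v) y := by
    intro y
    simp only [Pi.mul_apply, gammaPDF]
    rw [← ENNReal.ofReal_mul (gammaPDFReal_nonneg hm0 hm0 _), ← ENNReal.ofReal_mul (by positivity)]
    congr 1
    rw [gammaPDFReal, gammaPDFReal]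
    split_ifs
    · have h2 : Real.exp (-((m + v) * y)) = Real.exp (-(m * y)) * Real.exp (-(v * y)) := by
        rw [← Real.exp_add]; ring_nf
      have h3 : (1 + v / m : ℝ) = (m + v) / m := by field_simp
      rw [h2, h3, Real.rpow_natCast, Real.rpow_natCast, div_pow]
      have : (m + v : ℝ) ^ m ≠ 0 := by positivity
      field_simp
    · simp
  simp_rw [h1]
  rw [lintegral_const_mul (f := gammaPDF m (m + v)) _ (measurable_gammaPDFReal _ _).ennreal_ofReal,
    lintegral_gammaPDF_eq_one hm0 (by positivity), mul_one]

/-- Multiplying the density by `y` gives exactly the density of shape `m + 1`, because shape and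
rate are equal. -/
lemma lintegral_id_gammaMeasure (hm : 1 ≤ m) :
    ∫⁻ y, ENNReal.ofReal y ∂(gammaMeasure m m) = 1 := by
  have hm0 : (0 : ℝ) < m := by exact_mod_cast hm
  have hpdf : Measurable (gammaPDF m m) := (measurable_gammaPDFReal _ _).ennreal_ofReal
  rw [gammaMeasure, lintegral_withDensity_eq_lintegral_mul _ hpdf (by fun_prop)]
  have h1 : ∀ᵐ y ∂(volume : Measure ℝ),
      (gammaPDF m m * fun y => ENNReal.ofReal y) y = gammaPDF (m + 1) m y := by
    filter_upwards [compl_mem_ae_iff.2 (measure_singleton (0 : ℝ))] with y hy0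
    simp only [Pi.mul_apply, gammaPDF]
    rw [← ENNReal.ofReal_mul (gammaPDFReal_nonneg hm0 hm0 _)]
    congr 1
    rw [gammaPDFReal, gammaPDFReal]
    split_ifs with hy
    · have hy' : 0 < y := lt_of_le_of_ne hy (Ne.symm hy0)
      rw [Real.Gamma_add_one hm0.ne', Real.rpow_add_one hm0.ne', add_sub_cancel_right,
        Real.rpow_sub_one hy'.ne']
      have := (Real.Gamma_pos_of_pos hm0).ne'
      field_simp
    · simp
  rw [lintegral_congr_ae h1, lintegral_gammaPDF_eq_one (by positivity) hm0]

lemma integrable_gammaPDFReal {a r : ℝ} (ha : 0 < a) (hr : 0 < r) :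
    Integrable (gammaPDFReal a r) := by
  refine ⟨(measurable_gammaPDFReal a r).aestronglyMeasurable, ?_⟩
  rw [hasFiniteIntegral_iff_ofReal (Eventually.of_forall fun _ => gammaPDFReal_nonneg ha hr _)]
  exact (lintegral_gammaPDF_eq_one ha hr).trans_lt ENNReal.one_lt_top

lemma cdf_gammaMeasure_eq_add {a r : ℝ} (ha : 0 < a) (hr : 0 < r) (x : ℝ) :
    cdf (gammaMeasure a r) x = ∫ t in (0 : ℝ)..x, gammaPDFReal a r t := by
  have := isProbabilityMeasure_gammaMeasure ha hr
  have h0 : ∫ t in Iic (0 : ℝ), gammaPDFReal a r t = 0 := by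
    rw [← cdf_gammaMeasure_eq_integral ha hr, cdf_eq_real, measureReal_def, gammaMeasure_Iic_zero,
      ENNReal.toReal_zero]
  rw [cdf_gammaMeasure_eq_integral ha hr, ← intervalIntegral.integral_Iic_sub_Iic
    (integrable_gammaPDFReal ha hr).integrableOn (integrable_gammaPDFReal ha hr).integrableOn, h0,
    sub_zero]

/-! ### Alzer's inequality for integer shape -/

/-- The sign pattern behind Alzer's inequality. -/
lemma exp_mul_sub_pos_of_lt {κ s t : ℝ} (hs : 0 < s) (hst : s < t)
    (h : s < Real.exp (κ * s) * (1 - Real.exp (-s))) :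
    t < Real.exp (κ * t) * (1 - Real.exp (-t)) := by
  -- The claim is that `w`, once positive, stays positive. Both `w` and `w'` vanish at zero, and
  -- `w''` is a positive exponential times an increasing function, so it keeps its positive sign
  -- from any point on.
  set w : ℝ → ℝ := fun u => Real.exp (κ * u) - Real.exp ((κ - 1) * u) - u with hw
  set w' : ℝ → ℝ := fun u => κ * Real.exp (κ * u) - (κ - 1) * Real.exp ((κ - 1) * u) - 1 with hw'
  set w'' : ℝ → ℝ := fun u =>
    κ ^ 2 * Real.exp (κ * u) - (κ - 1) ^ 2 * Real.exp ((κ - 1) * u) with hw''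
  have hexp : ∀ k u : ℝ, HasDerivAt (fun u => Real.exp (k * u)) (k * Real.exp (k * u)) u := by
    intro k u
    simpa [mul_comm] using ((hasDerivAt_id u).const_mul k).exp
  have hd : ∀ u, HasDerivAt w (w' u) u := fun u =>
    ((hexp κ u).sub (hexp (κ - 1) u)).sub (hasDerivAt_id u)
  have hd' : ∀ u, HasDerivAt w' (w'' u) u := fun u => by
    refine HasDerivAt.congr_deriv
      ((((hexp κ u).const_mul κ).sub ((hexp (κ - 1) u).const_mul (κ - 1))).sub_const 1) ?_
    simp only [hw'']
    ring
  have hwe : ∀ u, Real.exp (κ * u) * (1 - Real.exp (-u)) = w u + u := by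
    intro u
    have : Real.exp ((κ - 1) * u) = Real.exp (κ * u) * Real.exp (-u) := by
      rw [← Real.exp_add]; ring_nf
    simp only [hw, this]
    ring
  have hcw : Continuous w := continuous_iff_continuousAt.2 fun u => (hd u).continuousAt
  have hcw' : Continuous w' := continuous_iff_continuousAt.2 fun u => (hd' u).continuousAt
  rw [hwe] at h ⊢
  have hws : 0 < w s := by linarith
  have hw0 : w 0 = 0 := by simp [hw]
  have hw'0 : w' 0 = 0 := by simp [hw']
  -- Two applications of the mean value theorem carry positivity of `w` at `s` back to `w'` at `s₁`
  -- and to `w''` at `s₂`; integrating forward again gives the monotonicity of `w'` and of `w`.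
  obtain ⟨s₁, hs₁, e₁⟩ := exists_hasDerivAt_eq_slope w w' hs hcw.continuousOn fun u _ => hd u
  have hw's₁ : 0 < w' s₁ := by rw [e₁, hw0]; apply div_pos <;> linarith
  obtain ⟨s₂, hs₂, e₂⟩ := exists_hasDerivAt_eq_slope w' w'' hs₁.1 hcw'.continuousOn fun u _ => hd' u
  have hw''s₂ : 0 < w'' s₂ := by rw [e₂, hw'0]; apply div_pos <;> linarith [hs₁.1]
  have hfac : ∀ u, w'' u = Real.exp ((κ - 1) * u) * (κ ^ 2 * Real.exp u - (κ - 1) ^ 2) := by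
    intro u
    have : Real.exp (κ * u) = Real.exp ((κ - 1) * u) * Real.exp u := by
      rw [← Real.exp_add]; ring_nf
    simp only [hw'', this]
    ring
  have hpos : ∀ u, s₂ ≤ u → 0 ≤ w'' u := by
    intro u hu
    rw [hfac] at hw''s₂ ⊢
    have h1 := pos_of_mul_pos_right hw''s₂ (Real.exp_pos _).le
    have h2 : κ ^ 2 * Real.exp s₂ ≤ κ ^ 2 * Real.exp u :=
      mul_le_mul_of_nonneg_left (Real.exp_le_exp.2 hu) (sq_nonneg _)
    exact mul_nonneg (Real.exp_pos _).le (by linarith)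
  have hmono' : MonotoneOn w' (Ici s₂) := by
    refine monotoneOn_of_deriv_nonneg (convex_Ici _) hcw'.continuousOn
      (fun u _ => (hd' u).differentiableAt.differentiableWithinAt) fun u hu => ?_
    rw [(hd' u).deriv]
    rw [interior_Ici] at hu
    exact hpos u (le_of_lt hu)
  have hmono : MonotoneOn w (Ici s₁) := by
    refine monotoneOn_of_deriv_nonneg (convex_Ici _) hcw.continuousOn
      (fun u _ => (hd u).differentiableAt.differentiableWithinAt) fun u hu => ?_
    rw [(hd u).deriv]
    rw [interior_Ici] at hu
    have h1 : s₁ ≤ u := le_of_lt hu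
    exact hw's₁.le.trans (hmono' hs₂.2.le (hs₂.2.le.trans h1) h1)
  have := hmono hs₁.2.le (hs₁.2.le.trans hst.le) hst.le
  linarith

lemma alzerConst_pos (hm : 1 ≤ m) : 0 < alzerConst m := by
  have : (0 : ℝ) < m := by exact_mod_cast hm
  unfold alzerConst
  positivity

/-- This normalisation matches the leading coefficients of the two distribution functions at zero,
and lets the constants in the derivative of their difference cancel. -/
lemma alzerConst_pow (hm : 1 ≤ m) : alzerConst m ^ m * m.factorial = m ^ m := by
  have hm0 : (m : ℝ) ≠ 0 := by exact_mod_cast (by omega : m ≠ 0)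
  have hf : (0 : ℝ) < m.factorial := by positivity
  rw [alzerConst, mul_pow, ← Real.rpow_natCast ((m.factorial : ℝ) ^ _), ← Real.rpow_mul hf.le,
    neg_mul, one_div_mul_cancel hm0, Real.rpow_neg_one]
  field_simp

lemma gammaTail_one {x : ℝ} (hx : 0 ≤ x) : gammaTail 1 x = alzerTail 1 x := by
  have h := cdf_expMeasure_eq (r := 1) one_pos x
  rw [expMeasure, if_pos hx] at h
  rw [gammaTail_eq le_rfl, Nat.cast_one, h]
  simp [alzerTail, alzerConst]

/-- By `alzerConst_pow` the Gamma density is `m b (b x)^(m-1) e^(-m x)`, so it shares the factor `m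
b` with the derivative of Alzer's expression. -/
lemma hasDerivAt_alzerTail_sub (hm : 1 ≤ m) {x : ℝ} (hx : 0 < x) :
    HasDerivAt (fun x => alzerTail m x - gammaTail m x)
      (m * alzerConst m * ((alzerConst m * x) ^ (m - 1) * Real.exp (-(m * x)) -
        Real.exp (-(alzerConst m * x)) * (1 - Real.exp (-(alzerConst m * x))) ^ (m - 1))) x := by
  have hm0 : (0 : ℝ) < m := by exact_mod_cast hm
  have h1 : HasDerivAt (fun x => cdf (gammaMeasure m m) x) (gammaPDFReal m m x) x := by
    simp_rw [cdf_gammaMeasure_eq_add hm0 hm0]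
    refine intervalIntegral.integral_hasDerivAt_right
      (integrable_gammaPDFReal hm0 hm0).intervalIntegrable
      (measurable_gammaPDFReal _ _).stronglyMeasurable.stronglyMeasurableAtFilter ?_
    have hc : ContinuousAt (fun x : ℝ => (m : ℝ) ^ (m : ℝ) / Real.Gamma m * x ^ ((m : ℝ) - 1) *
        Real.exp (-(m * x))) x := by
      refine ContinuousAt.mul (ContinuousAt.mul continuousAt_const ?_) (by fun_prop)
      exact Real.continuousAt_rpow_const _ _ (Or.inl hx.ne')
    refine hc.congr ?_
    filter_upwards [eventually_gt_nhds hx] with y hy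
    rw [gammaPDFReal, if_pos hy.le]
  have h2 : HasDerivAt (fun x => Real.exp (-(alzerConst m * x)))
      (-(alzerConst m) * Real.exp (-(alzerConst m * x))) x := by
    have := ((hasDerivAt_id x).const_mul (alzerConst m)).neg.exp
    simpa [mul_comm] using this
  have h3 := ((h2.const_sub 1).pow m).const_sub 1
  have h4 := h3.sub (h1.const_sub 1)
  have h5 : (fun x => alzerTail m x - gammaTail m x) = fun x =>
      (1 - (1 - Real.exp (-(alzerConst m * x))) ^ m) - (1 - cdf (gammaMeasure m m) x) := by
    ext y
    rw [alzerTail, gammaTail_eq hm]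
  rw [h5]
  refine h4.congr_deriv ?_
  have h6 : gammaPDFReal m m x =
      m * alzerConst m * (alzerConst m * x) ^ (m - 1) * Real.exp (-(m * x)) := by
    rw [gammaPDFReal, if_pos hx.le, Real.rpow_natCast]
    obtain ⟨k, rfl⟩ : ∃ k, m = k + 1 := ⟨m - 1, by omega⟩
    have e1 := alzerConst_pow hm
    have e2 : (((k + 1 : ℕ) : ℝ) - 1) = k := by push_cast; ring
    rw [e2, Real.rpow_natCast, Nat.add_sub_cancel, mul_pow, ← e1, Nat.cast_succ,
      Real.Gamma_nat_eq_factorial, Nat.factorial_succ]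
    push_cast
    field_simp
    ring
  rw [h6]
  ring

/-- Alzer's inequality for the Gamma distribution with an integer shape parameter. -/
theorem gammaTail_le_alzerTail (hm : 1 ≤ m) {x : ℝ} (hx : 0 ≤ x) :
    gammaTail m x ≤ alzerTail m x := by
  -- Shape one gives two equal exponential tails; the argument for larger shapes divides by `m - 1`.
  rcases hm.eq_or_lt with rfl | hm2
  · exact (gammaTail_one hx).le
  have hm0 : (0 : ℝ) < m := by exact_mod_cast hm
  have hprob := isProbabilityMeasure_gamma hm
  set b := alzerConst m with hb
  have hb0 : 0 < b := alzerConst_pos hm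
  set D : ℝ → ℝ := fun x => alzerTail m x - gammaTail m x with hD
  set D' : ℝ → ℝ := fun x => m * b * ((b * x) ^ (m - 1) * Real.exp (-(m * x)) -
        Real.exp (-(b * x)) * (1 - Real.exp (-(b * x))) ^ (m - 1)) with hD'
  have hd : ∀ x, 0 < x → HasDerivAt D (D' x) x := fun x hx => hasDerivAt_alzerTail_sub hm hx
  have hcdf0 : cdf (gammaMeasure m m) 0 = 0 := by
    rw [cdf_gammaMeasure_eq_add hm0 hm0, intervalIntegral.integral_same]
  have hD0 : D 0 = 0 := by
    simp only [hD, gammaTail_eq hm, alzerTail, hcdf0]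
    simp [zero_pow (by omega : m ≠ 0)]
  have hDc : Continuous D := by
    have h1 : Continuous fun x => cdf (gammaMeasure m m) x := by
      simp_rw [cdf_gammaMeasure_eq_add hm0 hm0]
      exact intervalIntegral.continuous_primitive
        (fun a b => (integrable_gammaPDFReal hm0 hm0).intervalIntegrable) 0
    simp only [hD, gammaTail_eq hm]
    unfold alzerTail
    fun_prop
  have hDlim : Tendsto D atTop (𝓝 0) := by
    have h1 : Tendsto (fun x => Real.exp (-(b * x))) atTop (𝓝 0) :=
      Real.tendsto_exp_neg_atTop_nhds_zero.comp (tendsto_id.const_mul_atTop hb0)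
    have h2 := ((h1.const_sub 1).pow m).const_sub 1
    have h3 := (tendsto_cdf_atTop (gammaMeasure m m)).const_sub 1
    have h4 := h2.sub h3
    simp only [sub_zero, one_pow, sub_self] at h4
    refine h4.congr fun x => ?_
    simp only [hD, gammaTail_eq hm, alzerTail]
    rfl
  -- The exponent is chosen so that `e^(-b x) = e^(-m x) (e^(κ b x))^(m-1)`. Then `D'` is a positive
  -- factor times a difference of two `(m-1)`-th powers, and its sign is governed by
  -- `exp_mul_sub_pos_of_lt` at `b * x`.
  set κ : ℝ := (m - b) / (b * (m - 1)) with hκ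
  have hm1 : (0 : ℝ) < m - 1 := by
    have : (1 : ℝ) < m := by exact_mod_cast hm2
    linarith
  have hsign : ∀ x, 0 < x → D' x = m * b * Real.exp (-(m * x)) * ((b * x) ^ (m - 1) -
      (Real.exp (κ * (b * x)) * (1 - Real.exp (-(b * x)))) ^ (m - 1)) := by
    intro x hx
    have h1 : Real.exp (-(b * x)) = Real.exp (-(m * x)) * Real.exp (κ * (b * x)) ^ (m - 1) := by
      rw [← Real.exp_nat_mul, ← Real.exp_add, Nat.cast_sub hm, Nat.cast_one, hκ]
      congr 1
      field_simp
      ring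
    simp only [hD']
    rw [mul_pow (Real.exp (κ * (b * x)))]
    nth_rewrite 1 [h1]
    ring
  have hexp1 : ∀ x, 0 < x → 0 < 1 - Real.exp (-(b * x)) := fun x hx => by
    have : Real.exp (-(b * x)) < 1 := Real.exp_lt_one_iff.2 (by have := mul_pos hb0 hx; linarith)
    linarith
  have hneg : ∀ x, 0 < x → D' x < 0 → b * x < Real.exp (κ * (b * x)) * (1 - Real.exp (-(b * x))) := by
    intro x hx h
    rw [hsign x hx] at h
    by_contra hcon
    refine absurd h (not_lt.2 (mul_nonneg (by positivity) (sub_nonneg.2 ?_)))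
    exact pow_le_pow_left₀ (mul_nonneg (Real.exp_pos _).le (hexp1 x hx).le) (not_lt.1 hcon) _
  -- The difference `D` vanishes at zero and at infinity. A negative value at `x` would make `D'`
  -- negative somewhere before `x` and positive somewhere after it, against the sign pattern.
  by_contra hcon
  have hDx : D x < 0 := by simp only [hD]; linarith
  have hx0 : 0 < x := lt_of_le_of_ne hx fun h => by rw [← h, hD0] at hDx; exact lt_irrefl _ hDx
  obtain ⟨s, hs, es⟩ := exists_hasDerivAt_eq_slope D D' hx0 hDc.continuousOn fun u hu => hd u hu.1
  have hDs : D' s < 0 := by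
    rw [es, hD0]
    exact div_neg_of_neg_of_pos (by linarith) (by linarith)
  obtain ⟨y, hxy, hy⟩ : ∃ y, x < y ∧ D x < D y :=
    ((eventually_gt_atTop x).and (hDlim.eventually_const_lt hDx)).exists
  obtain ⟨t, ht, et⟩ := exists_hasDerivAt_eq_slope D D' hxy hDc.continuousOn
    fun u hu => hd u (hx0.trans hu.1)
  have hDt : 0 < D' t := by
    rw [et]
    apply div_pos <;> linarith
  have ht0 : 0 < t := hx0.trans ht.1
  have key := exp_mul_sub_pos_of_lt (mul_pos hb0 hs.1)
    (mul_lt_mul_of_pos_left (hs.2.trans ht.1) hb0) (hneg s hs.1 hDs)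
  rw [hsign t ht0] at hDt
  refine absurd hDt (not_lt.2 (mul_nonpos_of_nonneg_of_nonpos (by positivity) (sub_nonpos.2 ?_)))
  exact pow_le_pow_left₀ (mul_pos hb0 ht0).le key.le _

lemma alzerTail_nonneg (hm : 1 ≤ m) {x : ℝ} (hx : 0 ≤ x) : 0 ≤ alzerTail m x := by
  have h1 : Real.exp (-(alzerConst m * x)) ≤ 1 :=
    Real.exp_le_one_iff.2 (neg_nonpos.2 (mul_nonneg (alzerConst_pos hm).le hx))
  exact sub_nonneg.2 (pow_le_one₀ (by linarith) (by linarith [Real.exp_pos (-(alzerConst m * x))]))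

lemma alzerTail_le_one (hm : 1 ≤ m) {x : ℝ} (hx : 0 ≤ x) : alzerTail m x ≤ 1 := by
  have h1 : Real.exp (-(alzerConst m * x)) ≤ 1 :=
    Real.exp_le_one_iff.2 (neg_nonpos.2 (mul_nonneg (alzerConst_pos hm).le hx))
  exact sub_le_self _ (pow_nonneg (by linarith) _)

lemma alzerTail_anti (hm : 1 ≤ m) {x y : ℝ} (hx : 0 ≤ x) (hxy : x ≤ y) :
    alzerTail m y ≤ alzerTail m x := by
  have h0 := alzerConst_pos hm
  have h1 : Real.exp (-(alzerConst m * x)) ≤ 1 :=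
    Real.exp_le_one_iff.2 (neg_nonpos.2 (mul_nonneg h0.le hx))
  have h2 : Real.exp (-(alzerConst m * y)) ≤ Real.exp (-(alzerConst m * x)) :=
    Real.exp_le_exp.2 (neg_le_neg (mul_le_mul_of_nonneg_left hxy h0.le))
  exact sub_le_sub_left (pow_le_pow_left₀ (by linarith) (by linarith) _) _

/-- Binomial expansion, in which the term `k = 0` cancels the leading one. Each remaining term is an
exponential, whose mean is a Laplace transform. -/
lemma alzerTail_eq_sum (m : ℕ) (x : ℝ) : alzerTail m x =
    ∑ k ∈ Finset.Icc 1 m, (-1 : ℝ) ^ (k + 1) * (m.choose k : ℝ) *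
      Real.exp (-(k * alzerConst m * x)) := by
  have h1 : (1 - Real.exp (-(alzerConst m * x))) ^ m =
      ∑ k ∈ Finset.range (m + 1), (-1 : ℝ) ^ k * (m.choose k : ℝ) *
        Real.exp (-(k * alzerConst m * x)) := by
    rw [sub_eq_neg_add, add_pow]
    refine Finset.sum_congr rfl fun k _ => ?_
    rw [neg_pow, ← Real.exp_nat_mul]
    simp only [one_pow, mul_one]
    rw [show (k : ℝ) * -(alzerConst m * x) = -(k * alzerConst m * x) by ring]
    ring
  rw [alzerTail, h1, Finset.range_eq_Ico, Finset.sum_eq_sum_Ico_succ_bot (by omega)]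
  simp only [pow_zero, Nat.choose_zero_right, Nat.cast_one, Nat.cast_zero, zero_mul, neg_zero,
    Real.exp_zero, mul_one, zero_add, sub_add_cancel_left]
  rw [← Finset.sum_neg_distrib]
  refine Finset.sum_congr rfl fun k _ => ?_
  ring

end Gamma

/-! ### Independence -/

section Independence

variable {Ω α β γ : Type*} [MeasurableSpace Ω] [MeasurableSpace α] [MeasurableSpace β]
  [MeasurableSpace γ] {μ : Measure Ω} [IsProbabilityMeasure μ]

/-- Tonelli for the product law, with both variables kept on the original probability space. -/
lemma lintegral_eq_lintegral_lintegral_of_indepFun {X : Ω → α} {Y : Ω → β} (hX : Measurable X)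
    (hY : Measurable Y) (h : IndepFun X Y μ) {F : α × β → ℝ≥0∞} (hF : Measurable F) :
    ∫⁻ ω, F (X ω, Y ω) ∂μ = ∫⁻ ω, ∫⁻ ω', F (X ω, Y ω') ∂μ ∂μ := by
  have := Measure.isProbabilityMeasure_map hX.aemeasurable (μ := μ)
  have := Measure.isProbabilityMeasure_map hY.aemeasurable (μ := μ)
  have hlaw := (indepFun_iff_map_prod_eq_prod_map_map hX.aemeasurable hY.aemeasurable).1 h
  calc ∫⁻ ω, F (X ω, Y ω) ∂μ = ∫⁻ z, F z ∂(μ.map fun ω => (X ω, Y ω)) :=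
        (lintegral_map hF (hX.prodMk hY)).symm
    _ = ∫⁻ x, ∫⁻ y, F (x, y) ∂(μ.map Y) ∂(μ.map X) := by
        rw [hlaw, lintegral_prod _ hF.aemeasurable]
    _ = ∫⁻ ω, ∫⁻ y, F (X ω, y) ∂(μ.map Y) ∂μ := lintegral_map hF.lintegral_prod_right' hX
    _ = _ := lintegral_congr fun ω => lintegral_map (hF.comp measurable_prodMk_left) hY

/-- Integrate out a component `f ∘ X` of `X` that is independent of another component `g ∘ X` and
of a further variable `Y`. -/
lemma lintegral_eq_of_indepFun_comp {δ : Type*} [MeasurableSpace δ] {X : Ω → α} {Y : Ω → β}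
    {f : α → γ} {g : α → δ} (hX : Measurable X)
    (hY : Measurable Y) (hf : Measurable f) (hg : Measurable g) (h : IndepFun X Y μ)
    (h' : IndepFun (fun ω => f (X ω)) (fun ω => g (X ω)) μ) {F : γ × δ × β → ℝ≥0∞}
    (hF : Measurable F) :
    ∫⁻ ω, F (f (X ω), g (X ω), Y ω) ∂μ =
      ∫⁻ ω, ∫⁻ ω', F (f (X ω'), g (X ω), Y ω) ∂μ ∂μ := by
  have hfX := hf.comp hX
  have hgX := hg.comp hX
  rw [lintegral_eq_lintegral_lintegral_of_indepFun hY hX h.symm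
    (F := fun z => F (f z.2, g z.2, z.1)) (by fun_prop)]
  have h1 : ∀ ω, ∫⁻ ω', F (f (X ω'), g (X ω'), Y ω) ∂μ =
      ∫⁻ ω', ∫⁻ ω'', F (f (X ω''), g (X ω'), Y ω) ∂μ ∂μ := fun ω =>
    lintegral_eq_lintegral_lintegral_of_indepFun hgX hfX h'.symm
      (F := fun z => F (z.2, z.1, Y ω)) (by fun_prop)
  simp_rw [h1]
  have hm : Measurable fun z : β × α => ∫⁻ ω'', F (f (X ω''), g z.2, z.1) ∂μ := by
    have : Measurable fun z : (β × α) × Ω => F (f (X z.2), g z.1.2, z.1.1) := by fun_prop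
    exact this.lintegral_prod_right'
  rw [lintegral_eq_lintegral_lintegral_of_indepFun hY hX h.symm hm]

variable {κ : Type*} {X : κ → Ω → ℝ}

/-- The σ-algebra generated by a block of a family of random variables. -/
abbrev blockSigma (X : κ → Ω → ℝ) (S : Set κ) : MeasurableSpace Ω :=
  ⨆ k ∈ S, (inferInstance : MeasurableSpace ℝ).comap (X k)

omit [MeasurableSpace Ω] in
lemma measurable_blockSigma {S : Set κ} {k : κ} (hk : k ∈ S) :
    Measurable[blockSigma X S] (X k) :=
  (comap_measurable (X k)).mono (le_iSup₂_of_le k hk le_rfl) le_rfl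

omit [MeasurableSpace Ω] in
lemma blockSigma_mono {S T : Set κ} (h : S ⊆ T) : blockSigma X S ≤ blockSigma X T :=
  biSup_mono h

lemma blockSigma_le (hX : ∀ k, Measurable (X k)) (S : Set κ) :
    blockSigma X S ≤ (inferInstance : MeasurableSpace Ω) :=
  iSup₂_le fun k _ => (hX k).comap_le

omit [IsProbabilityMeasure μ] in
lemma indep_blockSigma (hX : ∀ k, Measurable (X k)) (h : iIndepFun X μ) {S T : Set κ}
    (hST : Disjoint S T) : Indep (blockSigma X S) (blockSigma X T) μ :=
  indep_iSup_of_disjoint (fun k => (hX k).comap_le) h.iIndep hST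

/-- Induction on the number of factors: the σ-algebra of a new block is independent of that of the
union of the earlier blocks. -/
lemma lintegral_prod_of_blocks (hX : ∀ k, Measurable (X k)) (h : iIndepFun X μ) {S : ℕ → Set κ}
    (hS : Pairwise (Function.onFun Disjoint S)) {Y : ℕ → Ω → ℝ≥0∞}
    (hY : ∀ j, Measurable[blockSigma X (S j)] (Y j)) (n : ℕ) :
    ∫⁻ ω, ∏ j ∈ Finset.range n, Y j ω ∂μ = ∏ j ∈ Finset.range n, ∫⁻ ω, Y j ω ∂μ := by
  induction n with
  | zero => simp
  | succ n ih =>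
    simp_rw [Finset.prod_range_succ]
    rw [← ih]
    have hd : Disjoint (⋃ j ∈ Finset.range n, S j) (S n) := by
      simp only [disjoint_iUnion_left]
      exact fun j hj => hS (Finset.mem_range.1 hj).ne
    refine lintegral_mul_eq_lintegral_mul_lintegral_of_independent_measurableSpace
      (f := fun ω => ∏ j ∈ Finset.range n, Y j ω)
      (blockSigma_le hX _) (blockSigma_le hX _) (indep_blockSigma hX h hd) ?_ (hY n)
    exact Finset.measurable_prod _ fun j hj =>
      (hY j).mono (blockSigma_mono (subset_biUnion_of_mem (u := S) hj)) le_rfl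

lemma lintegral_infProd_of_blocks (hX : ∀ k, Measurable (X k)) (h : iIndepFun X μ)
    {S : ℕ → Set κ} (hS : Pairwise (Function.onFun Disjoint S)) {Y : ℕ → Ω → ℝ≥0∞}
    (hY : ∀ j, Measurable[blockSigma X (S j)] (Y j)) (hY1 : ∀ j ω, Y j ω ≤ 1) :
    ∫⁻ ω, infProd (fun j => Y j ω) ∂μ = infProd fun j => ∫⁻ ω, Y j ω ∂μ := by
  have hm : ∀ j, Measurable (Y j) := fun j => (hY j).mono (blockSigma_le hX _) le_rfl
  unfold infProd
  rw [lintegral_iInf (fun n => Finset.measurable_prod _ fun j _ => hm j)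
    (fun a b hab ω => antitone_prod_range (fun j => hY1 j ω) hab) (by simp)]
  exact iInf_congr fun n => lintegral_prod_of_blocks hX h hS hY n

omit [IsProbabilityMeasure μ] in
open Classical in
/-- A member of an independent family is independent of the remaining members. -/
lemma indepFun_update (hX : ∀ k, Measurable (X k)) (h : iIndepFun X μ) (k : κ) :
    IndepFun (X k) (fun ω => Function.update (fun k => X k ω) k 0) μ := by
  rw [IndepFun_iff_Indep]
  refine indep_of_indep_of_le_left (indep_of_indep_of_le_right
    (indep_blockSigma hX h (S := {k}) (T := {k}ᶜ) disjoint_compl_right) ?_) ?_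
  -- Overwriting coordinate `k` by a constant leaves a vector that is measurable with respect to the
  -- complementary block.
  · refine Measurable.comap_le ?_
    refine @measurable_pi_lambda _ _ _ (_) _ _ fun k' => ?_
    by_cases hk : k' = k
    · subst hk
      simp
    · simpa [hk] using measurable_blockSigma (X := X) (S := {k}ᶜ) (by simpa using hk)
  · exact le_iSup₂_of_le k rfl le_rfl

end Independence

/-! ### Measurability of the functionals of the network -/

instance : MeasurableSpace Link := ⊤

instance : DiscreteMeasurableSpace Link := ⟨fun _ => trivial⟩

instance : Fintype Link := ⟨{.los, .nlos}, fun s => by cases s <;> simp⟩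

@[simp] lemma Link.other_ne (s : Link) : s.other ≠ s := by cases s <;> simp [Link.other]

lemma Link.eq_other_of_ne {s t : Link} (h : t ≠ s) : t = s.other := by
  cases s <;> cases t <;> simp_all [Link.other]

namespace Params

variable (p : Params)

@[fun_prop]
lemma measurable_losProb : Measurable p.losProb := by
  unfold losProb
  fun_prop

@[fun_prop]
lemma measurable_linkProb (s : Link) : Measurable (p.linkProb s) := by
  cases s
  · exact p.measurable_losProb
  · exact measurable_const.sub p.measurable_losProb

/-- The smallest possible distance of an ABS in state `t`, when the UE is associated with an ABS in
state `s` at distance `r`. -/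
def thr (s t : Link) (r : ℝ) : ℝ := if t = s then r else p.tau s r

@[fun_prop]
lemma measurable_tau (s : Link) : Measurable (p.tau s) := by
  unfold tau
  fun_prop

@[fun_prop]
lemma measurable_thr (s t : Link) : Measurable (p.thr s t) := by
  unfold thr
  split_ifs <;> fun_prop

end Params

namespace Network

variable {Ω : Type*} [MeasurableSpace Ω] (N : Network Ω) (p : Params)

/-- All components of the network are measurable. -/
structure IsMeasurable : Prop where
  tbs : ∀ i, Measurable (N.tbs i)
  abs : ∀ i, Measurable (N.abs i)
  marks : ∀ k, Measurable (N.marks k)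

lemma IsModel.isMeasurable {N : Network Ω} {p : Params} {μ : Measure Ω} (h : N.IsModel p μ) :
    N.IsMeasurable where
  tbs := h.tbs_poisson.measurable
  abs := h.abs_poisson.measurable
  marks := h.marks_measurable

/-- ABS `i` is in state `s`, and no other ABS prevents it from serving the UE. -/
def serves (s : Link) (i : ℕ) : Set Ω :=
  {ω | N.state p i ω = s ∧ ∀ j, j ≠ i → p.thr s (N.state p j ω) (N.dist p i ω) ≤ N.dist p j ω}

/-- The power received from ABS `i`. -/
def received (i : ℕ) (ω : Ω) : ℝ :=
  p.PA * p.C (N.state p i ω) * N.dist p i ω ^ (-p.alpha (N.state p i ω)) *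
    N.gain (N.state p i ω) i ω

/-- Interference from all ABSs but the `i`-th one. -/
def interferenceAt (i : ℕ) (ω : Ω) : ℝ := ∑' j : ℕ, if j = i then 0 else N.received p j ω

namespace IsMeasurable

variable {N} (h : N.IsMeasurable)
include h

lemma vis (i : ℕ) : Measurable (N.vis i) := h.marks (.vis i)

lemma gain (s : Link) (i : ℕ) : Measurable (N.gain s i) := h.marks (.gain s i)

lemma fixedGain (s : Link) : Measurable (N.fixedGain s) := h.marks (.fixedGain s)

lemma state (i : ℕ) : Measurable (N.state p i) := by
  unfold Network.state
  refine Measurable.ite ?_ measurable_const measurable_const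
  exact measurableSet_le (h.vis i) (p.measurable_losProb.comp (h.abs i).norm)

lemma dist (i : ℕ) : Measurable (N.dist p i) :=
  (((h.abs i).norm.pow_const 2).add_const _).sqrt

lemma thr (s : Link) (i j : ℕ) :
    Measurable fun ω => p.thr s (N.state p j ω) (N.dist p i ω) := by
  have : Measurable fun z : Link × ℝ => p.thr s z.1 z.2 :=
    measurable_from_prod_countable_right fun t => p.measurable_thr s t
  exact this.comp ((h.state p j).prodMk (h.dist p i))

lemma serves (s : Link) (i : ℕ) : MeasurableSet (N.serves p s i) := by
  have : N.serves p s i = {ω | N.state p i ω = s} ∩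
      ⋂ j, {ω | j ≠ i → p.thr s (N.state p j ω) (N.dist p i ω) ≤ N.dist p j ω} := by
    ext ω; simp [Network.serves]
  rw [this]
  refine (h.state p i (measurableSet_singleton s)).inter (MeasurableSet.iInter fun j => ?_)
  by_cases hj : j = i
  · simp [hj]
  · simpa [hj] using measurableSet_le (h.thr p s i j) (h.dist p j)

lemma received (i : ℕ) : Measurable (N.received p i) := by
  have h1 : ∀ f : Link → ℝ, Measurable fun ω => f (N.state p i ω) := fun f =>
    (Measurable.of_discrete (f := f)).comp (h.state p i)
  have h2 : Measurable fun ω => N.gain (N.state p i ω) i ω := by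
    have : Measurable fun z : Link × Ω => N.gain z.1 i z.2 :=
      measurable_from_prod_countable_right fun t => h.gain t i
    exact this.comp ((h.state p i).prodMk measurable_id)
  unfold Network.received
  exact (((h1 p.C).const_mul _).mul ((h.dist p i).pow (h1 fun s => -p.alpha s))).mul h2

lemma interferenceAt (i : ℕ) : Measurable (N.interferenceAt p i) := by
  refine Measurable.tsum fun j => ?_
  split_ifs
  · exact measurable_const
  · exact h.received p j

lemma nearest (s : Link) : Measurable (N.nearest p s) := by
  set S : ℕ → Set Ω := fun i =>
    {ω | N.state p i ω = s ∧ ∀ j, N.state p j ω = s → N.dist p i ω ≤ N.dist p j ω} with hS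
  have hSm : ∀ i, MeasurableSet (S i) := by
    intro i
    have : S i = {ω | N.state p i ω = s} ∩ ⋂ j, ({ω | N.state p j ω = s}ᶜ ∪
        {ω | N.dist p i ω ≤ N.dist p j ω}) := by
      ext ω; simp [hS, imp_iff_not_or]
    rw [this]
    exact (h.state p i (measurableSet_singleton s)).inter (MeasurableSet.iInter fun j =>
      (h.state p j (measurableSet_singleton s)).compl.union
        (measurableSet_le (h.dist p i) (h.dist p j)))
  refine measurable_to_countable' fun k => ?_
  -- The second set accounts for the default value `sInf ∅ = 0` when no index attains the minimum.
  have : N.nearest p s ⁻¹' {k} = (S k ∩ ⋂ j ∈ {j | j < k}, (S j)ᶜ) ∪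
      ((⋂ j, (S j)ᶜ) ∩ {_ω | k = 0}) := by
    ext ω
    have hn : N.nearest p s ω = sInf {i | ω ∈ S i} := rfl
    simp only [mem_preimage, mem_singleton_iff, hn, mem_union, mem_inter_iff, mem_iInter,
      mem_compl_iff, mem_ofPred_eq]
    by_cases hne : {i | ω ∈ S i}.Nonempty
    · have h1 : ω ∈ S (sInf {i | ω ∈ S i}) := Nat.sInf_mem hne
      have h2 : ∀ j, j < sInf {i | ω ∈ S i} → ω ∉ S j := fun j hj => Nat.notMem_of_lt_sInf hj
      constructor
      · rintro rfl
        exact Or.inl ⟨h1, h2⟩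
      · rintro (⟨hk, hk'⟩ | ⟨hk, -⟩)
        · exact le_antisymm (Nat.sInf_le hk) (not_lt.1 fun hlt => hk' _ hlt h1)
        · exact absurd h1 (hk _)
    · have h1 : ∀ j, ω ∉ S j := fun j hj => hne ⟨j, hj⟩
      rw [not_nonempty_iff_eq_empty.1 hne, Nat.sInf_empty]
      simp [h1, eq_comm]
  rw [this]
  exact ((hSm k).inter (MeasurableSet.biInter (to_countable _) fun j _ => (hSm j).compl)).union
    ((MeasurableSet.iInter fun j => (hSm j).compl).inter (MeasurableSet.const _))

/-- Evaluation at a random index is jointly measurable because the index set is countable. -/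
lemma apply_nearest {β : Type*} [MeasurableSpace β] {f : ℕ → Ω → β} (hf : ∀ i, Measurable (f i))
    (s : Link) : Measurable fun ω => f (N.nearest p s ω) ω := by
  have : Measurable fun z : ℕ × Ω => f z.1 z.2 := measurable_from_prod_countable_right hf
  exact this.comp ((h.nearest p s).prodMk measurable_id)

lemma R (s : Link) : Measurable (N.R p s) := h.apply_nearest p (h.dist p) s

lemma RT : Measurable N.RT := Measurable.iInf fun i => (h.tbs i).norm

lemma power (s : Link) : Measurable (N.power p s) :=
  ((h.R p s).pow_const _).const_mul _

lemma powerT : Measurable (N.powerT p) :=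
  Measurable.ite (measurableSet_le h.RT measurable_const) ((h.RT.pow_const _).const_mul _)
    measurable_const

lemma assoc (s : Link) : MeasurableSet (N.assoc p s) := by
  cases s
  · exact (measurableSet_lt (h.power p _) (h.power p _)).inter
      (measurableSet_lt (h.powerT p) (h.power p _))
  · exact (measurableSet_lt (h.power p _) (h.power p _)).inter
      (measurableSet_lt measurable_const h.RT)

lemma interference (s : Link) : Measurable (N.interference p s) :=
  h.apply_nearest p (h.interferenceAt p) s

lemma userDist (u : User) (s : Link) : Measurable (N.userDist p u s) := by
  cases u
  · exact h.R p s
  · exact measurable_const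

lemma userGain (u : User) (s : Link) : Measurable (N.userGain p u s) := by
  cases u
  · exact h.apply_nearest p (h.gain s) s
  · exact h.fixedGain s

lemma signal (u : User) (s : Link) : Measurable (N.signal p u s) :=
  (((h.userDist p u s).pow_const _).const_mul _).mul (h.userGain p u s)

lemma sinr (c : Position) (u : User) (s : Link) : Measurable (N.sinr p c u s) := by
  have h1 : ∀ u, Measurable (N.sinrSIC p u s) := fun u =>
    ((h.signal p u s).const_mul _).div
      (((h.interference p s).add_const _).add ((h.signal p u s).const_mul _))
  have h2 : ∀ u, Measurable (N.sinrDirect p u s) := fun u =>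
    ((h.signal p u s).const_mul _).div
      ((((h.signal p u s).const_mul _).add (h.interference p s)).add_const _)
  cases c <;> cases u
  exacts [h1 _, h2 _, h2 _, h1 _]

lemma caseEvent (c : Position) (s : Link) : MeasurableSet (N.caseEvent p c s) := by
  cases c
  · exact measurableSet_le (h.R p s) measurable_const
  · exact measurableSet_lt measurable_const (h.R p s)

lemma gainThreshold (c : Position) (u : User) (s : Link) (z : ℝ) :
    Measurable (N.gainThreshold p c u s z) :=
  ((((h.userDist p u s).pow_const _).const_mul _).mul
    ((h.interference p s).add_const _)).div_const _

end IsMeasurable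

end Network

/-! ### Polar coordinates in the plane -/

/-- The plane in which the base stations lie. -/
abbrev Plane := EuclideanSpace ℝ (Fin 2)

instance (a : ℝ) : SigmaFinite (ENNReal.ofReal a • (volume : Measure Plane)) :=
  inferInstanceAs (SigmaFinite (a.toNNReal • (volume : Measure Plane)))

lemma volume_closedBall_plane {r : ℝ} (hr : 0 ≤ r) :
    volume (Metric.closedBall (0 : Plane) r) = ENNReal.ofReal (Real.pi * r ^ 2) := by
  rw [EuclideanSpace.volume_closedBall_fin_two, ← ENNReal.ofReal_pow hr, mul_comm,
    ← ENNReal.ofReal_mul Real.pi_pos.le]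

lemma smul_volume_closedBall_lt_top (a r : ℝ) :
    (ENNReal.ofReal a • (volume : Measure Plane)) (Metric.closedBall 0 r) < ∞ :=
  ENNReal.mul_lt_top ENNReal.ofReal_lt_top (measure_closedBall_lt_top (μ := (volume : Measure Plane)))

/-- Integration of a radial function over the plane. -/
lemma lintegral_norm_plane {F : ℝ → ℝ≥0∞} (hF : Measurable F) :
    ∫⁻ y : Plane, F ‖y‖ = ∫⁻ x in Ioi (0 : ℝ), ENNReal.ofReal (2 * Real.pi * x) * F x := by
  have hdim : Module.finrank ℝ Plane = 2 := by simp
  have h1 : ∫⁻ y : Plane, F ‖y‖ = ∫⁻ x : ({0}ᶜ : Set Plane), F ‖(x : Plane)‖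
      ∂((volume : Measure Plane).comap Subtype.val) := by
    rw [lintegral_subtype_comap (measurableSet_singleton _).compl fun y : Plane => F ‖y‖,
      restrict_compl_singleton]
  have h2 := (volume : Measure Plane).measurePreserving_homeomorphUnitSphereProd.lintegral_comp
    (f := fun z => F z.2) (by fun_prop)
  have h3 : ∫⁻ x : ({0}ᶜ : Set Plane), F ‖(x : Plane)‖
      ∂((volume : Measure Plane).comap Subtype.val) =
      ∫⁻ z : Metric.sphere (0 : Plane) 1 × Ioi (0 : ℝ), F z.2 ∂((volume : Measure Plane).toSphere.prod
        (Measure.volumeIoiPow (Module.finrank ℝ Plane - 1))) := by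
    rw [← h2]
    simp
  have h4 : ∫⁻ x : Ioi (0 : ℝ), F x ∂(Measure.volumeIoiPow (Module.finrank ℝ Plane - 1)) =
      ∫⁻ x in Ioi (0 : ℝ), ENNReal.ofReal x * F x := by
    rw [Measure.volumeIoiPow, lintegral_withDensity_eq_lintegral_mul _ (by fun_prop) (by fun_prop),
      ← lintegral_subtype_comap measurableSet_Ioi]
    simp [hdim]
  rw [h1, h3, lintegral_prod _ (by fun_prop)]
  dsimp only
  rw [lintegral_const, Measure.toSphere_apply_univ, h4,
    EuclideanSpace.volume_ball_fin_two, mul_comm, ← lintegral_const_mul _ (by fun_prop)]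
  refine setLIntegral_congr_fun measurableSet_Ioi fun x hx => ?_
  have hx0 : (0 : ℝ) ≤ x := le_of_lt hx
  rw [ENNReal.ofReal_mul (by positivity), ENNReal.ofReal_mul (by positivity), hdim]
  simp [mul_assoc]

/-- Integration over the plane of a function of the distance to a point at height `h`. -/
lemma lintegral_slant {h : ℝ} (hh : 0 < h) {F : ℝ → ℝ≥0∞} (hF : Measurable F) :
    ∫⁻ y : Plane, F √(‖y‖ ^ 2 + h ^ 2) =
      ∫⁻ r in Ioi h, ENNReal.ofReal (2 * Real.pi * r) * F r := by
  rw [lintegral_norm_plane (F := fun x => F √(x ^ 2 + h ^ 2)) (by fun_prop)]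
  have himg : (fun x => √(x ^ 2 + h ^ 2)) '' Ioi 0 = Ioi h := by
    ext r
    constructor
    · rintro ⟨x, hx, rfl⟩
      exact Real.lt_sqrt_of_sq_lt (by have := pow_pos (mem_Ioi.1 hx) 2; linarith)
    · intro hr
      have hr' : h < r := hr
      have h0 : 0 < r ^ 2 - h ^ 2 := by nlinarith
      refine ⟨√(r ^ 2 - h ^ 2), Real.sqrt_pos.2 h0, ?_⟩
      dsimp only
      rw [Real.sq_sqrt h0.le, sub_add_cancel, Real.sqrt_sq (by linarith)]
  have hpos : ∀ x : ℝ, 0 < x ^ 2 + h ^ 2 := fun x => by positivity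
  -- The substitution `r = √(x² + h²)` satisfies `r dr = x dx`, so the polar weight keeps its form.
  rw [← himg, lintegral_image_eq_lintegral_abs_deriv_mul (f' := fun x => x / √(x ^ 2 + h ^ 2))
    measurableSet_Ioi]
  · refine setLIntegral_congr_fun measurableSet_Ioi fun x hx => ?_
    have hx0 : (0 : ℝ) < x := hx
    have hs := Real.sqrt_pos.2 (hpos x)
    rw [← mul_assoc, ← ENNReal.ofReal_mul (abs_nonneg _), abs_of_pos (by positivity)]
    congr 2
    field_simp
  · intro x _
    have h1 : HasDerivAt (fun x : ℝ => x ^ 2 + h ^ 2) (2 * x) x := by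
      simpa using (hasDerivAt_pow 2 x).add_const (h ^ 2)
    refine ((h1.sqrt (hpos x).ne').congr_deriv ?_).hasDerivWithinAt
    field_simp
  · intro x hx y hy hxy
    have e := (Real.sqrt_inj (hpos x).le (hpos y).le).1 hxy
    have hx0 : (0 : ℝ) < x := hx
    have hy0 : (0 : ℝ) < y := hy
    nlinarith

/-! ### Almost sure properties of the network -/

namespace Params

variable {p : Params}

/-- The distance between the typical UE and an ABS whose horizontal position is `y`. -/
def slant (p : Params) (y : Plane) : ℝ := √(‖y‖ ^ 2 + p.h ^ 2)

@[fun_prop]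
lemma measurable_slant (p : Params) : Measurable p.slant := by
  unfold slant
  fun_prop

lemma h_le_slant (y : Plane) : p.h ≤ p.slant y :=
  Real.le_sqrt_of_sq_le (by nlinarith [sq_nonneg ‖y‖])

lemma slant_pos (hp : p.Admissible) (y : Plane) : 0 < p.slant y :=
  hp.h_pos.trans_le (h_le_slant y)

lemma sqrt_slant (y : Plane) : √(p.slant y ^ 2 - p.h ^ 2) = ‖y‖ := by
  rw [slant, Real.sq_sqrt (by positivity), add_sub_cancel_right, Real.sqrt_sq (norm_nonneg _)]

lemma h_le_tau (s : Link) (r : ℝ) : p.h ≤ p.tau s r := le_max_left _ _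

lemma eta_pos (hp : p.Admissible) (s : Link) : 0 < p.eta s :=
  mul_pos (mul_pos hp.an_pos hp.PA_pos) (hp.C_pos s)

lemma etaT_pos (hp : p.Admissible) : 0 < p.etaT :=
  mul_pos (mul_pos hp.GM_pos hp.PT_pos) hp.CT_pos

lemma losProb_pos (hp : p.Admissible) (x : ℝ) : 0 < p.losProb x := by
  have := hp.sa_pos
  unfold losProb
  positivity

lemma losProb_lt_one (hp : p.Admissible) (x : ℝ) : p.losProb x < 1 := by
  have := mul_pos hp.sa_pos (Real.exp_pos
    (-p.sb * (180 / Real.pi * Real.arctan (p.h / x - p.sc) - p.sd)))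
  rw [losProb, div_lt_one (by linarith)]
  linarith

lemma linkProb_pos (hp : p.Admissible) (s : Link) (x : ℝ) : 0 < p.linkProb s x := by
  cases s
  · exact losProb_pos hp x
  · exact sub_pos.2 (losProb_lt_one hp x)

lemma linkProb_le_one (hp : p.Admissible) (s : Link) (x : ℝ) : p.linkProb s x ≤ 1 := by
  cases s
  · exact (losProb_lt_one hp x).le
  · exact sub_le_self _ (losProb_pos hp x).le

/-- The probability of each link state is bounded away from zero. -/
lemma exists_le_linkProb (hp : p.Admissible) (s : Link) :
    ∃ c, 0 < c ∧ c ≤ 1 ∧ ∀ x, c ≤ p.linkProb s x := by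
  have hpi := Real.pi_pos
  set e : ℝ → ℝ := fun x => p.sa * Real.exp (-p.sb *
    (180 / Real.pi * Real.arctan (p.h / x - p.sc) - p.sd)) with he
  -- An angle in the range of the arctangent is at most 90 degrees in absolute value, whatever the
  -- offset and the convention for `h / 0`. This bounds the S-curve on both sides uniformly in `x`.
  have hb : ∀ x, |(180 / Real.pi * Real.arctan (p.h / x - p.sc))| ≤ 90 := by
    intro x
    rw [abs_mul, abs_of_pos (by positivity)]
    calc 180 / Real.pi * |Real.arctan (p.h / x - p.sc)| ≤ 180 / Real.pi * (Real.pi / 2) := by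
          gcongr
          exact abs_le.2 ⟨(Real.neg_pi_div_two_lt_arctan _).le, (Real.arctan_lt_pi_div_two _).le⟩
      _ = 90 := by field_simp; norm_num
  have hlo : ∀ x, p.sa * Real.exp (-p.sb * (90 - p.sd)) ≤ e x := by
    intro x
    have := (abs_le.1 (hb x)).2
    have h1 : p.sb * (180 / Real.pi * Real.arctan (p.h / x - p.sc) - p.sd) ≤
        p.sb * (90 - p.sd) := mul_le_mul_of_nonneg_left (by linarith) hp.sb_pos.le
    exact mul_le_mul_of_nonneg_left (Real.exp_le_exp.2 (by linarith)) hp.sa_pos.le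
  have hhi : ∀ x, e x ≤ p.sa * Real.exp (-p.sb * (-90 - p.sd)) := by
    intro x
    have := (abs_le.1 (hb x)).1
    have h1 : p.sb * (-90 - p.sd) ≤
        p.sb * (180 / Real.pi * Real.arctan (p.h / x - p.sc) - p.sd) :=
      mul_le_mul_of_nonneg_left (by linarith) hp.sb_pos.le
    exact mul_le_mul_of_nonneg_left (Real.exp_le_exp.2 (by linarith)) hp.sa_pos.le
  have hlo0 : 0 < p.sa * Real.exp (-p.sb * (90 - p.sd)) := mul_pos hp.sa_pos (Real.exp_pos _)
  have hhi0 : 0 < p.sa * Real.exp (-p.sb * (-90 - p.sd)) := mul_pos hp.sa_pos (Real.exp_pos _)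
  have hlos : ∀ x, p.losProb x = 1 / (1 + e x) := fun x => rfl
  cases s
  · refine ⟨1 / (1 + p.sa * Real.exp (-p.sb * (-90 - p.sd))), by positivity, ?_, fun x => ?_⟩
    · rw [div_le_one (by positivity)]
      linarith
    · change _ ≤ p.losProb x
      rw [hlos]
      exact one_div_le_one_div_of_le (by linarith [hlo x]) (by linarith [hhi x])
  · refine ⟨1 - 1 / (1 + p.sa * Real.exp (-p.sb * (90 - p.sd))), ?_, ?_, fun x => ?_⟩
    · rw [sub_pos, div_lt_one (by positivity)]
      linarith
    · exact sub_le_self _ (by positivity)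
    · change _ ≤ 1 - p.losProb x
      rw [hlos]
      exact sub_le_sub_left (one_div_le_one_div_of_le (by linarith) (by linarith [hlo x])) _

end Params

namespace Network.IsModel

variable {Ω : Type*} [MeasurableSpace Ω] {N : Network Ω} {p : Params} {μ : Measure Ω}
  [IsProbabilityMeasure μ]

omit [IsProbabilityMeasure μ] in
lemma indepFun_abs_marks (hN : N.IsModel p μ) :
    IndepFun (fun ω i => N.abs i ω) (fun ω k => N.marks k ω) μ :=
  hN.points_marks_indep.comp measurable_snd measurable_id

lemma ae_finite_closedBall {X : ℕ → Ω → Plane} {a : ℝ}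
    (h : IsPoissonProcess X (ENNReal.ofReal a • volume) μ) :
    ∀ᵐ ω ∂μ, ∀ r : ℝ, {i | ‖X i ω‖ ≤ r}.Finite := by
  have h1 : ∀ n : ℕ, ∀ᵐ ω ∂μ, {i | ‖X i ω‖ ≤ n}.Finite := by
    intro n
    filter_upwards [h.ae_pointCount_eq (A := Metric.closedBall 0 n)
      Metric.isClosed_closedBall.measurableSet
      (smul_volume_closedBall_lt_top _ _)] with ω hω
    refine Set.encard_ne_top_iff.1 ?_
    have : {i | ‖X i ω‖ ≤ n} = {i | X i ω ∈ Metric.closedBall 0 (n : ℝ)} := by ext; simp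
    rw [this]
    rw [pointCount] at hω
    rw [hω]
    exact ENat.natCast_ne_top _
  filter_upwards [ae_all_iff.2 h1] with ω hω r
  obtain ⟨n, hn⟩ := exists_nat_ge r
  refine (hω n).subset fun i hi => ?_
  have hi' : ‖X i ω‖ ≤ r := hi
  exact hi'.trans hn

/-- The law of the distance to the nearest TBS. -/
lemma measure_lt_RT (hN : N.IsModel p μ) (hp : p.Admissible) {t : ℝ} (ht : 0 ≤ t) :
    μ {ω | t < N.RT ω} = ENNReal.ofReal (Real.exp (-(Real.pi * p.lamT * t ^ 2))) := by
  have hν : (ENNReal.ofReal p.lamT • (volume : Measure Plane)) (Metric.closedBall 0 t) =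
      ENNReal.ofReal (Real.pi * p.lamT * t ^ 2) := by
    rw [Measure.smul_apply, volume_closedBall_plane ht, smul_eq_mul,
      ← ENNReal.ofReal_mul hp.lamT_pos.le]
    congr 1; ring
  have h1 : μ {ω | pointCount N.tbs (Metric.closedBall 0 t) ω = 0} =
      ENNReal.ofReal (Real.exp (-(Real.pi * p.lamT * t ^ 2))) := by
    have := hN.tbs_poisson.counts 1 (fun _ => Metric.closedBall 0 t)
      (fun _ => Metric.isClosed_closedBall.measurableSet)
      (fun j k hjk => (hjk (Subsingleton.elim _ _)).elim)
      (fun _ => by rw [hν]; exact ENNReal.ofReal_lt_top) (fun _ => 0)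
    rw [hν] at this
    have hpos : 0 ≤ Real.pi * p.lamT * t ^ 2 :=
      mul_nonneg (mul_nonneg Real.pi_pos.le hp.lamT_pos.le) (sq_nonneg t)
    simpa [poissonMeasure_singleton, hpos, ENNReal.coe_toNNReal_eq_toReal] using this
  rw [← h1]
  refine measure_congr ?_
  filter_upwards [ae_finite_closedBall hN.tbs_poisson] with ω hω
  refine propext ?_
  change t < N.RT ω ↔ pointCount N.tbs (Metric.closedBall 0 t) ω = 0
  rw [pointCount, Set.encard_eq_zero, Set.eq_empty_iff_forall_notMem]
  simp only [mem_ofPred_eq, Metric.mem_closedBall, dist_zero_right, not_le]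
  have hbdd : BddBelow (range fun i => ‖N.tbs i ω‖) :=
    ⟨0, by rintro _ ⟨i, rfl⟩; exact norm_nonneg _⟩
  constructor
  · intro h i
    exact h.trans_le (ciInf_le hbdd i)
  · intro h
    -- Local finiteness gives a nearest point among those within `t + 1`, so the strict inequality
    -- survives the infimum; all other points leave a gap of one.
    by_cases hne : {i | ‖N.tbs i ω‖ ≤ t + 1}.Nonempty
    · obtain ⟨i₀, -, hi₀⟩ := Set.exists_min_image _ (fun i => ‖N.tbs i ω‖) (hω (t + 1)) hne
      refine (lt_min (lt_add_one t) (h i₀)).trans_le (le_ciInf fun i => ?_)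
      by_cases hi : ‖N.tbs i ω‖ ≤ t + 1
      · exact (min_le_right _ _).trans (hi₀ i hi)
      · exact (min_le_left _ _).trans (not_le.1 hi).le
    · refine (lt_add_one t).trans_le (le_ciInf fun i => ?_)
      by_contra hi
      exact hne ⟨i, (not_le.1 hi).le⟩

lemma ae_RT_pos (hN : N.IsModel p μ) (hp : p.Admissible) : ∀ᵐ ω ∂μ, 0 < N.RT ω := by
  have h := hN.measure_lt_RT hp le_rfl
  simp only [ne_eq, OfNat.ofNat_ne_zero, not_false_eq_true, zero_pow, mul_zero, neg_zero,
    Real.exp_zero, ENNReal.ofReal_one] at h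
  exact (prob_compl_eq_zero_iff (measurableSet_lt measurable_const hN.isMeasurable.RT)).2 h

omit [IsProbabilityMeasure μ] in
lemma ae_gain_pos (hN : N.IsModel p μ) : ∀ᵐ ω ∂μ, ∀ s i, 0 < N.gain s i ω := by
  refine ae_all_iff.2 fun s => ae_all_iff.2 fun i => ?_
  refine ae_of_ae_map (hN.isMeasurable.gain s i).aemeasurable (p := fun y => 0 < y) ?_
  rw [hN.gain_law]
  exact ae_gammaMeasure_pos

omit [IsProbabilityMeasure μ] in
lemma ae_fixedGain_pos (hN : N.IsModel p μ) : ∀ᵐ ω ∂μ, ∀ s, 0 < N.fixedGain s ω := by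
  refine ae_all_iff.2 fun s => ?_
  refine ae_of_ae_map (hN.isMeasurable.fixedGain s).aemeasurable (p := fun y => 0 < y) ?_
  rw [hN.fixedGain_law]
  exact ae_gammaMeasure_pos

/-- No two ABSs have the same distance, and no two ABSs provide the same average power. -/
lemma ae_thr_ne (hN : N.IsModel p μ) (hp : p.Admissible) :
    ∀ᵐ ω ∂μ, ∀ s t i j, j ≠ i → N.dist p j ω ≠ p.thr s t (N.dist p i ω) := by
  refine ae_all_iff.2 fun s => ae_all_iff.2 fun t => ?_
  refine hN.abs_poisson.ae_forall_ne (a := p.slant) (b := fun y => p.thr s t (p.slant y))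
    p.measurable_slant ((p.measurable_thr s t).comp p.measurable_slant)
    (fun y => Real.sqrt_nonneg _) (fun y => ?_) (fun r => ?_) (fun r => ?_)
  · unfold Params.thr
    split_ifs
    · exact Real.sqrt_nonneg _
    · exact hp.h_pos.le.trans (Params.h_le_tau _ _)
  · refine (measure_mono (t := Metric.closedBall 0 r) fun y hy => ?_).trans_lt
      (smul_volume_closedBall_lt_top _ _)
    have hy' : p.slant y ≤ r := hy
    rw [mem_closedBall_zero_iff]
    refine le_trans ?_ hy'
    exact Real.le_sqrt_of_sq_le (by nlinarith [sq_nonneg p.h])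
  · refine measure_mono_null (t := Metric.sphere 0 √(r ^ 2 - p.h ^ 2)) (fun y hy => ?_)
      (by simp [Measure.addHaar_sphere])
    have hy' : p.slant y = r := hy
    rw [mem_sphere_zero_iff_norm, ← hy', Params.sqrt_slant]

omit [IsProbabilityMeasure μ] in
lemma measure_vis_le (hN : N.IsModel p μ) (i : ℕ) {x : ℝ} (hx1 : x ≤ 1) :
    μ {ω | N.vis i ω ≤ x} = ENNReal.ofReal x := by
  have : {ω | N.vis i ω ≤ x} = N.vis i ⁻¹' Iic x := rfl
  rw [this, ← Measure.map_apply (hN.isMeasurable.vis i) measurableSet_Iic, hN.vis_law,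
    Measure.restrict_apply measurableSet_Iic]
  have : Iic x ∩ Icc 0 1 = Icc 0 x := by
    ext y
    simp only [mem_inter_iff, mem_Iic, mem_Icc]
    exact ⟨fun h => ⟨h.2.1, h.1⟩, fun h => ⟨h.2, h.1, h.2.trans hx1⟩⟩
  rw [this, Real.volume_Icc, sub_zero]

/-- The state of a link, as a function of the position of the ABS and of the uniform variable. -/
def _root_.Noma.Params.linkState (p : Params) (y : Plane) (u : ℝ) : Link := if u ≤ p.losProb ‖y‖ then .los else .nlos

omit [IsProbabilityMeasure μ] in
lemma _root_.Noma.Params.measurableSet_linkState (p : Params) (y : Plane) (s : Link) :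
    MeasurableSet {u | p.linkState y u = s} := by
  have : Measurable (p.linkState y) := Measurable.ite measurableSet_Iic measurable_const
    measurable_const
  exact this (measurableSet_singleton s)

lemma measure_linkState (hN : N.IsModel p μ) (hp : p.Admissible) (i : ℕ) (y : Plane) (s : Link) :
    μ {ω | p.linkState y (N.vis i ω) = s} = ENNReal.ofReal (p.linkProb s ‖y‖) := by
  have h1 := hN.measure_vis_le i (Params.losProb_lt_one hp ‖y‖).le
  cases s
  · rw [Params.linkProb, ← h1]
    congr 1
    ext ω
    simp [Params.linkState]
  · have h2 : {ω | p.linkState y (N.vis i ω) = .nlos} = {ω | N.vis i ω ≤ p.losProb ‖y‖}ᶜ := by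
      ext ω
      simp [Params.linkState]
    rw [h2, prob_compl_eq_one_sub (measurableSet_le (hN.isMeasurable.vis i) measurable_const), h1,
      Params.linkProb, ENNReal.ofReal_sub _ (Params.losProb_pos hp _).le, ENNReal.ofReal_one]

/-- There are ABSs in both link states. -/
lemma ae_exists_state (hN : N.IsModel p μ) (hp : p.Admissible) :
    ∀ᵐ ω ∂μ, ∀ s, ∃ i, N.state p i ω = s := by
  have hM := hN.isMeasurable
  refine ae_all_iff.2 fun s => ?_
  obtain ⟨c, hc0, hc1, hc⟩ := Params.exists_le_linkProb hp s
  set F : (ℕ → Plane) × (MarkIdx → ℝ) → ℝ≥0∞ := fun z =>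
    infProd fun j => {u | p.linkState (z.1 j) u ≠ s}.indicator 1 (z.2 (.vis j)) with hF
  have hst : ∀ j, Measurable fun z : (ℕ → Plane) × (MarkIdx → ℝ) =>
      p.linkState (z.1 j) (z.2 (.vis j)) := fun j =>
    Measurable.ite (measurableSet_le (by fun_prop) (by fun_prop)) measurable_const measurable_const
  have hFm : Measurable F := by
    refine Measurable.infProd fun j => ?_
    have : (fun z : (ℕ → Plane) × (MarkIdx → ℝ) =>
        {u | p.linkState (z.1 j) u ≠ s}.indicator (1 : ℝ → ℝ≥0∞) (z.2 (.vis j))) =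
        {z | p.linkState (z.1 j) (z.2 (.vis j)) = s}ᶜ.indicator 1 := by
      ext z
      simp [Set.indicator_apply]
    rw [this]
    exact measurable_one.indicator (hst j (measurableSet_singleton s)).compl
  have h0 : ∫⁻ ω, F (fun j => N.abs j ω, fun k => N.marks k ω) ∂μ = 0 := by
    rw [lintegral_eq_lintegral_lintegral_of_indepFun (measurable_pi_lambda _ hM.abs)
      (measurable_pi_lambda _ hM.marks) hN.indepFun_abs_marks hFm]
    refine (lintegral_congr fun ω => ?_).trans lintegral_zero
    rw [hF]
    dsimp only
    rw [lintegral_infProd_of_blocks hM.marks hN.marks_indep (S := fun j => {.vis j})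
      (fun i j hij => by simpa using hij)
      (Y := fun j ω' => {u | p.linkState (N.abs j ω) u ≠ s}.indicator 1 (N.marks (.vis j) ω'))
      (fun j => (measurable_one.indicator (p.measurableSet_linkState _ s).compl).comp
        (measurable_blockSigma (k := MarkIdx.vis j) rfl))
      (fun j ω' => Set.indicator_le_self' (fun _ _ => zero_le) _)]
    -- Given the positions, each ABS fails to be in state `s` with probability at most `1 - c`,
    -- independently. The probability that the first `n` all fail is at most `(1 - c)^n`.
    have hq : ENNReal.ofReal (1 - c) < 1 := by
      rw [ENNReal.ofReal_lt_one]; linarith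
    refine le_antisymm (ge_of_tendsto' (ENNReal.tendsto_pow_atTop_nhds_zero_of_lt_one hq)
      fun n => (iInf_le _ n).trans ?_) zero_le
    refine (Finset.prod_le_pow_card _ _ (ENNReal.ofReal (1 - c)) fun j _ => ?_).trans_eq
      (by rw [Finset.card_range])
    have h1 : (fun ω' => {u | p.linkState (N.abs j ω) u ≠ s}.indicator (1 : ℝ → ℝ≥0∞)
        (N.marks (.vis j) ω')) =
        {ω' | p.linkState (N.abs j ω) (N.vis j ω') = s}ᶜ.indicator 1 := by
      ext ω'
      simp [Set.indicator_apply, marks]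
    have h2 : MeasurableSet {ω' | p.linkState (N.abs j ω) (N.vis j ω') = s} :=
      hM.vis j (p.measurableSet_linkState _ s)
    dsimp only
    rw [h1, lintegral_indicator_one h2.compl, prob_compl_eq_one_sub h2,
      hN.measure_linkState hp, ← ENNReal.ofReal_one,
      ← ENNReal.ofReal_sub _ (Params.linkProb_pos hp s _).le]
    exact ENNReal.ofReal_le_ofReal (by linarith [hc ‖N.abs j ω‖])
  have hm : Measurable fun ω => F (fun j => N.abs j ω, fun k => N.marks k ω) :=
    hFm.comp ((measurable_pi_lambda _ hM.abs).prodMk (measurable_pi_lambda _ hM.marks))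
  filter_upwards [(lintegral_eq_zero_iff hm).1 h0] with ω hω
  by_contra! hne
  have h1 : F (fun j => N.abs j ω, fun k => N.marks k ω) = 1 := by
    have : (fun j => {u | p.linkState (N.abs j ω) u ≠ s}.indicator (1 : ℝ → ℝ≥0∞)
        (N.marks (.vis j) ω)) = fun _ => 1 := by
      funext j
      have h2 : p.linkState (N.abs j ω) (N.marks (.vis j) ω) ≠ s := hne j
      simp [h2]
    rw [hF]
    dsimp only
    rw [this]
    simp [infProd]
  rw [h1] at hω
  exact one_ne_zero hω

end Network.IsModel

/-! ### The serving ABS -/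

/-- Solving the comparison of two average powers for one of the distances. The thresholds `tau`,
`tauT` and `lLT` all arise in this way. -/
lemma mul_rpow_neg_lt_iff {a b α α' r x : ℝ} (ha : 0 < a) (hb : 0 < b) (hα : 0 < α) (hr : 0 < r)
    (hx : 0 < x) :
    a * x ^ (-α) < b * r ^ (-α') ↔ (a / b) ^ (1 / α) * r ^ (α' / α) < x := by
  have hr' : 0 < r ^ α' := Real.rpow_pos_of_pos hr _
  have hx' : 0 < x ^ α := Real.rpow_pos_of_pos hx _
  have h1 : (a / b) ^ (1 / α) * r ^ (α' / α) = (a / b * r ^ α') ^ α⁻¹ := by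
    rw [Real.mul_rpow (by positivity) hr'.le, ← Real.rpow_mul hr.le, one_div, div_eq_mul_inv α']
  rw [h1, Real.rpow_inv_lt_iff_of_pos (by positivity) hx.le hα, Real.rpow_neg hx.le,
    Real.rpow_neg hr.le, ← div_eq_mul_inv, ← div_eq_mul_inv, div_lt_div_iff₀ hx' hr',
    div_mul_eq_mul_div, div_lt_iff₀ hb, mul_comm b]

namespace Params

variable {p : Params}

@[simp] lemma thr_self (p : Params) (s : Link) (r : ℝ) : p.thr s s r = r := if_pos rfl

@[simp] lemma thr_other (p : Params) (s : Link) (r : ℝ) : p.thr s s.other r = p.tau s r :=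
  if_neg s.other_ne

/-- The nearest TBS, at distance `t`, admits association with an ABS in state `s` at distance
`r`. -/
def tbsAdmits (p : Params) : Link → ℝ → ℝ → Prop
  | .los, r, t => min p.RB (p.tauT r) < t
  | .nlos, _, t => p.RB < t

/-- The probability that the TBSs admit association with an ABS in state `s` at distance `r`. -/
def tbsProb (p : Params) : Link → ℝ → ℝ
  | .los, r => Real.exp (-(Real.pi * p.lamT * min p.RB (p.tauT r) ^ 2))
  | .nlos, _ => Real.exp (-(Real.pi * p.lamT * p.RB ^ 2))

@[fun_prop]
lemma measurable_tauT (p : Params) : Measurable p.tauT := by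
  unfold tauT
  fun_prop

@[fun_prop]
lemma measurable_tbsProb (p : Params) (s : Link) : Measurable (p.tbsProb s) := by
  cases s
  · unfold tbsProb
    fun_prop
  · exact measurable_const

lemma tbsProb_pos (s : Link) (r : ℝ) : 0 < p.tbsProb s r := by
  cases s <;> exact Real.exp_pos _

lemma tauT_nonneg (hp : p.Admissible) {r : ℝ} (hr : 0 ≤ r) : 0 ≤ p.tauT r :=
  mul_nonneg (Real.rpow_nonneg (div_nonneg (etaT_pos hp).le (eta_pos hp _).le) _)
    (Real.rpow_nonneg hr _)

lemma measurableSet_tbsAdmits (p : Params) (s : Link) :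
    MeasurableSet {z : ℝ × ℝ | p.tbsAdmits s z.1 z.2} := by
  cases s
  · exact measurableSet_lt (measurable_const.min (p.measurable_tauT.comp measurable_fst))
      measurable_snd
  · exact measurableSet_lt measurable_const measurable_snd

lemma alpha_pos (hp : p.Admissible) (s : Link) : 0 < p.alpha s := by
  linarith [hp.two_lt_alpha s]

/-- In polar coordinates the integrand is a multiple of `r^(1 - α)` on `(h, ∞)`: the height removes
the singularity, and `α > 2` gives convergence at infinity. -/
lemma lintegral_slant_rpow_lt_top (hp : p.Admissible) {α : ℝ} (hα : 2 < α) :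
    ∫⁻ y, ENNReal.ofReal (p.slant y ^ (-α)) < ∞ := by
  have h1 : ∫⁻ y, ENNReal.ofReal (p.slant y ^ (-α)) = _ :=
    lintegral_slant hp.h_pos (F := fun r => ENNReal.ofReal (r ^ (-α))) (by fun_prop)
  rw [h1]
  have h3 : IntegrableOn (fun r : ℝ => 2 * Real.pi * r ^ (1 - α)) (Ioi p.h) :=
    (integrableOn_Ioi_rpow_of_lt (by linarith) hp.h_pos).const_mul _
  refine lt_of_eq_of_lt (setLIntegral_congr_fun measurableSet_Ioi fun r hr => ?_)
    h3.lintegral_lt_top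
  have hr0 : 0 < r := hp.h_pos.trans hr
  rw [← ENNReal.ofReal_mul (by positivity), sub_eq_add_neg, Real.rpow_add hr0, Real.rpow_one]
  ring_nf

end Params

/-! ### Regular realisations and the serving ABS -/

namespace Network

variable {Ω : Type*} [MeasurableSpace Ω] {N : Network Ω} {p : Params}

omit [MeasurableSpace Ω] in
lemma dist_pos (hp : p.Admissible) (i : ℕ) (ω : Ω) : 0 < N.dist p i ω :=
  Params.slant_pos hp (N.abs i ω)

omit [MeasurableSpace Ω] in
lemma h_le_dist (i : ℕ) (ω : Ω) : p.h ≤ N.dist p i ω := Params.h_le_slant (N.abs i ω)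

/-- Properties that hold for almost all realisations of the network. -/
structure Regular (N : Network Ω) (p : Params) (ω : Ω) : Prop where
  finite : ∀ r : ℝ, {i | ‖N.abs i ω‖ ≤ r}.Finite
  exists_state : ∀ s, ∃ i, N.state p i ω = s
  thr_ne : ∀ s t i j, j ≠ i → N.dist p j ω ≠ p.thr s t (N.dist p i ω)
  RT_pos : 0 < N.RT ω
  gain_pos : ∀ s i, 0 < N.gain s i ω
  fixedGain_pos : ∀ s, 0 < N.fixedGain s ω
  summable : Summable fun j => N.received p j ω

omit [MeasurableSpace Ω] in
lemma received_nonneg (hp : p.Admissible) {ω : Ω} (hω : ∀ s i, 0 < N.gain s i ω) (i : ℕ) :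
    0 ≤ N.received p i ω := by
  have := N.dist_pos hp i ω
  have := hp.PA_pos
  have := hp.C_pos (N.state p i ω)
  have := hω (N.state p i ω) i
  unfold received
  positivity

namespace IsModel

variable {μ : Measure Ω} [IsProbabilityMeasure μ]

/-- By the Campbell formula and the unit mean of the gains, the sum of the powers that all ABSs
would deliver in a fixed state has finite mean. The received powers are dominated by the sum over
both states. -/
lemma ae_summable_received (hN : N.IsModel p μ) (hp : p.Admissible) :
    ∀ᵐ ω ∂μ, Summable fun j => N.received p j ω := by
  have hM := hN.isMeasurable
  have key : ∀ t, ∀ᵐ ω ∂μ, Summable fun j => N.dist p j ω ^ (-p.alpha t) * N.gain t j ω := by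
    intro t
    have hm : ∀ j, Measurable fun ω =>
        ENNReal.ofReal (N.dist p j ω ^ (-p.alpha t) * N.gain t j ω) := fun j =>
      (((hM.dist p j).pow_const _).mul (hM.gain t j)).ennreal_ofReal
    have h1 : ∀ j, ∫⁻ ω, ENNReal.ofReal (N.dist p j ω ^ (-p.alpha t) * N.gain t j ω) ∂μ =
        ∫⁻ ω, ENNReal.ofReal (p.slant (N.abs j ω) ^ (-p.alpha t)) ∂μ := by
      intro j
      have e : ∀ ω, ENNReal.ofReal (N.dist p j ω ^ (-p.alpha t) * N.gain t j ω) =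
          ENNReal.ofReal (p.slant (N.abs j ω) ^ (-p.alpha t)) *
            ENNReal.ofReal (N.marks (.gain t j) ω) := fun ω =>
        ENNReal.ofReal_mul (Real.rpow_nonneg (N.dist_pos hp j ω).le _)
      have hind : IndepFun (N.abs j) (N.marks (.gain t j)) μ :=
        hN.indepFun_abs_marks.comp (φ := fun x : ℕ → Plane => x j)
          (ψ := fun x : MarkIdx → ℝ => x (.gain t j)) (by fun_prop) (by fun_prop)
      simp_rw [e]
      rw [lintegral_eq_lintegral_lintegral_of_indepFun (hM.abs j) (hM.marks _) hind
        (F := fun z => ENNReal.ofReal (p.slant z.1 ^ (-p.alpha t)) * ENNReal.ofReal z.2)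
        (by fun_prop)]
      refine lintegral_congr fun ω => ?_
      dsimp only
      rw [lintegral_const_mul _ (hM.marks _).ennreal_ofReal]
      have h2 : ∫⁻ ω', ENNReal.ofReal (N.marks (.gain t j) ω') ∂μ = 1 := by
        rw [← lintegral_id_gammaMeasure (hp.m_pos t), ← hN.gain_law t j,
          lintegral_map (by fun_prop) (hM.gain t j)]
        rfl
      rw [h2, mul_one]
    have h3 : ∫⁻ ω, ∑' j, ENNReal.ofReal (N.dist p j ω ^ (-p.alpha t) * N.gain t j ω) ∂μ ≠ ∞ := by
      rw [lintegral_tsum fun j => (hm j).aemeasurable]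
      simp_rw [h1]
      rw [hN.abs_poisson.campbell (f := fun y => ENNReal.ofReal (p.slant y ^ (-p.alpha t)))
        (by fun_prop), lintegral_smul_measure]
      exact (ENNReal.mul_lt_top ENNReal.ofReal_lt_top
        (Params.lintegral_slant_rpow_lt_top hp (hp.two_lt_alpha t))).ne
    filter_upwards [ae_lt_top (Measurable.tsum hm) h3, hN.ae_gain_pos] with ω hω hg
    have h4 : ∀ j, 0 ≤ N.dist p j ω ^ (-p.alpha t) * N.gain t j ω := fun j =>
      mul_nonneg (Real.rpow_nonneg (N.dist_pos hp j ω).le _) (hg t j).le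
    refine (ENNReal.summable_toReal hω.ne).congr fun j => ?_
    exact ENNReal.toReal_ofReal (h4 j)
  filter_upwards [key .los, key .nlos, hN.ae_gain_pos] with ω h1 h2 hg
  refine Summable.of_nonneg_of_le (fun j => received_nonneg hp hg j) (fun j => ?_)
    ((h1.mul_left (p.PA * p.C .los)).add (h2.mul_left (p.PA * p.C .nlos)))
  have h3 : ∀ t, 0 ≤ p.PA * p.C t * (N.dist p j ω ^ (-p.alpha t) * N.gain t j ω) := fun t =>
    mul_nonneg (mul_nonneg hp.PA_pos.le (hp.C_pos t).le)
      (mul_nonneg (Real.rpow_nonneg (N.dist_pos hp j ω).le _) (hg t j).le)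
  unfold received
  rw [mul_assoc]
  cases N.state p j ω
  · exact le_add_of_nonneg_right (h3 _)
  · exact le_add_of_nonneg_left (h3 _)

lemma ae_regular (hN : N.IsModel p μ) (hp : p.Admissible) : ∀ᵐ ω ∂μ, N.Regular p ω := by
  filter_upwards [ae_finite_closedBall hN.abs_poisson, hN.ae_exists_state hp, hN.ae_thr_ne hp,
    hN.ae_RT_pos hp, hN.ae_gain_pos, hN.ae_fixedGain_pos, hN.ae_summable_received hp]
    with ω h1 h2 h3 h4 h5 h6 h7
  exact ⟨h1, h2, h3, h4, h5, h6, h7⟩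

/-- The law of the TBSs enters through the probability that they admit association. -/
lemma measure_tbsAdmits (hN : N.IsModel p μ) (hp : p.Admissible) (s : Link) {r : ℝ} (hr : 0 ≤ r) :
    μ {ω | p.tbsAdmits s r (N.RT ω)} = ENNReal.ofReal (p.tbsProb s r) := by
  cases s
  · exact hN.measure_lt_RT hp (le_min hp.RB_pos.le (Params.tauT_nonneg hp hr))
  · exact hN.measure_lt_RT hp hp.RB_pos.le

end IsModel

namespace Regular

omit [MeasurableSpace Ω]

variable {ω : Ω}

/-- Local finiteness and the existence of an ABS in state `s` guarantee a minimiser, so the infimum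
that defines `nearest` is over a nonempty set. -/
lemma nearest_mem (h : N.Regular p ω) (s : Link) : N.state p (N.nearest p s ω) ω = s ∧
    ∀ j, N.state p j ω = s → N.R p s ω ≤ N.dist p j ω := by
  suffices hne : {i | N.state p i ω = s ∧
      ∀ j, N.state p j ω = s → N.dist p i ω ≤ N.dist p j ω}.Nonempty from Nat.sInf_mem hne
  obtain ⟨i₀, hi₀⟩ := h.exists_state s
  have hfin : {i | N.state p i ω = s ∧ ‖N.abs i ω‖ ≤ ‖N.abs i₀ ω‖}.Finite :=
    (h.finite ‖N.abs i₀ ω‖).subset fun i hi => hi.2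
  obtain ⟨i, ⟨hi, hi'⟩, hmin⟩ :=
    Set.exists_min_image _ (fun i => ‖N.abs i ω‖) hfin ⟨i₀, hi₀, le_rfl⟩
  refine ⟨i, hi, fun j hj => ?_⟩
  refine Real.sqrt_le_sqrt (add_le_add_left (pow_le_pow_left₀ (norm_nonneg _) ?_ 2) _)
  by_cases hj' : ‖N.abs j ω‖ ≤ ‖N.abs i₀ ω‖
  · exact hmin j ⟨hj, hj'⟩
  · exact hi'.trans (not_le.1 hj').le

lemma state_nearest (h : N.Regular p ω) (s : Link) : N.state p (N.nearest p s ω) ω = s :=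
  (h.nearest_mem s).1

/-- Two candidates would be equally distant, which `thr_ne` excludes. So at most one term of the sum
over candidates is non-zero. -/
lemma eq_nearest (h : N.Regular p ω) {s : Link} {i : ℕ} (hi : ω ∈ N.serves p s i) :
    i = N.nearest p s ω := by
  by_contra hne
  have hi2 := hi.2 _ (Ne.symm hne)
  rw [h.state_nearest, Params.thr_self] at hi2
  have h1 := (h.nearest_mem s).2 i hi.1
  refine h.thr_ne s s i _ (Ne.symm hne) ?_
  rw [Params.thr_self]
  exact le_antisymm h1 hi2

/-- In state `s` the condition is minimality of the distance; in the other state it is the power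
comparison solved for distance. The maximum with `h` in `tau` changes nothing, as every ABS is at
distance at least `h`. -/
lemma mem_serves_nearest_iff (h : N.Regular p ω) (hp : p.Admissible) (s : Link) :
    ω ∈ N.serves p s (N.nearest p s ω) ↔ N.power p s.other ω < N.power p s ω := by
  have hpow : N.power p s.other ω < N.power p s ω ↔
      (p.eta s.other / p.eta s) ^ (1 / p.alpha s.other) *
        N.R p s ω ^ (p.alpha s / p.alpha s.other) < N.R p s.other ω :=
    mul_rpow_neg_lt_iff (Params.eta_pos hp _) (Params.eta_pos hp _) (Params.alpha_pos hp _)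
      (N.dist_pos hp _ ω) (N.dist_pos hp _ ω)
  have hne : N.nearest p s.other ω ≠ N.nearest p s ω := by
    intro e
    have := h.state_nearest s.other
    rw [e, h.state_nearest] at this
    exact s.other_ne this.symm
  rw [hpow]
  constructor
  · intro hs
    have h1 := hs.2 _ hne
    rw [h.state_nearest, Params.thr_other] at h1
    -- Equality has probability zero, so the non-strict bound can be sharpened to the strict one in
    -- the association rule.
    have h2 := h.thr_ne s s.other _ _ hne
    rw [Params.thr_other] at h2
    exact (le_max_right _ _).trans_lt (lt_of_le_of_ne h1 (Ne.symm h2))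
  · intro hlt
    refine ⟨h.state_nearest s, fun j hj => ?_⟩
    by_cases hjs : N.state p j ω = s
    · rw [hjs, Params.thr_self]
      exact (h.nearest_mem s).2 j hjs
    · have hjo := Link.eq_other_of_ne hjs
      rw [hjo, Params.thr_other]
      exact max_le (N.h_le_dist j ω) (hlt.le.trans ((h.nearest_mem s.other).2 j hjo))

lemma mem_assoc_iff (h : N.Regular p ω) (hp : p.Admissible) (s : Link) :
    ω ∈ N.assoc p s ↔ ω ∈ N.serves p s (N.nearest p s ω) ∧
      p.tbsAdmits s (N.R p s ω) (N.RT ω) := by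
  rw [h.mem_serves_nearest_iff hp]
  cases s
  · refine and_congr Iff.rfl ?_
    have hR : 0 < N.R p .los ω := N.dist_pos hp _ ω
    change (if N.RT ω ≤ p.RB then p.etaT * N.RT ω ^ (-p.alphaT) else 0) <
      p.eta .los * N.R p .los ω ^ (-p.alpha .los) ↔ min p.RB (p.tauT (N.R p .los ω)) < N.RT ω
    split_ifs with hRB
    · rw [mul_rpow_neg_lt_iff (Params.etaT_pos hp) (Params.eta_pos hp _) hp.alphaT_pos hR h.RT_pos,
        min_lt_iff]
      exact ⟨Or.inr, fun h => h.resolve_left hRB.not_gt⟩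
    -- A nearest TBS beyond `RB` delivers no power, and any positive power beats it; this is why the
    -- LoS threshold is a minimum with `RB`.
    · exact iff_of_true (mul_pos (Params.eta_pos hp _) (Real.rpow_pos_of_pos hR _))
        (min_lt_of_left_lt (not_le.1 hRB))
  · exact Iff.rfl

lemma interferenceAt_nonneg (h : N.Regular p ω) (hp : p.Admissible) (i : ℕ) :
    0 ≤ N.interferenceAt p i ω :=
  tsum_nonneg fun j => by
    split_ifs
    · exact le_rfl
    · exact received_nonneg hp h.gain_pos j

end Regular

omit [MeasurableSpace Ω] in
lemma disjoint_assoc (N : Network Ω) (p : Params) : Disjoint (N.assoc p .los) (N.assoc p .nlos) :=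
  Set.disjoint_left.2 fun _ h1 h2 => lt_asymm h1.1 h2.1

/-- Sum over all ABSs that might be the serving one. -/
lemma IsModel.setLIntegral_assoc {μ : Measure Ω} [IsProbabilityMeasure μ] (hN : N.IsModel p μ)
    (hp : p.Admissible) (s : Link) {Φ : ℕ → Ω → ℝ≥0∞} (hΦ : ∀ i, Measurable (Φ i)) :
    ∫⁻ ω in N.assoc p s, Φ (N.nearest p s ω) ω ∂μ =
      ∑' i, ∫⁻ ω, (N.serves p s i ∩ {ω | p.tbsAdmits s (N.dist p i ω) (N.RT ω)}).indicator
        (Φ i) ω ∂μ := by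
  classical
  have hM := hN.isMeasurable
  have hS : ∀ i, MeasurableSet
      (N.serves p s i ∩ {ω | p.tbsAdmits s (N.dist p i ω) (N.RT ω)}) := fun i =>
    (hM.serves p s i).inter
      (((hM.dist p i).prodMk hM.RT) (p.measurableSet_tbsAdmits s))
  rw [← lintegral_tsum fun i => ((hΦ i).indicator (hS i)).aemeasurable,
    ← lintegral_indicator (hM.assoc p s)]
  refine lintegral_congr_ae ?_
  filter_upwards [hN.ae_regular hp] with ω hω
  rw [tsum_eq_single (N.nearest p s ω)]
  · rw [Set.indicator_apply, Set.indicator_apply]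
    exact if_congr (hω.mem_assoc_iff hp s) rfl rfl
  · intro i hi
    exact Set.indicator_of_notMem (fun h => hi (hω.eq_nearest h.1)) _

end Network

/-! ### The SINR and the channel gain of the served UE -/

/-- Positions of the base stations together with all marks. -/
abbrev Conf := ((ℕ → Plane) × (ℕ → Plane)) × (MarkIdx → ℝ)

/-- The network on its space of configurations. -/
def confNetwork : Network Conf where
  tbs i c := c.1.1 i
  abs i c := c.1.2 i
  vis i c := c.2 (.vis i)
  gain s i c := c.2 (.gain s i)
  fixedGain s c := c.2 (.fixedGain s)

lemma isMeasurable_confNetwork : confNetwork.IsMeasurable where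
  tbs i := by unfold confNetwork; fun_prop
  abs i := by unfold confNetwork; fun_prop
  marks k := by cases k <;> (unfold confNetwork Network.marks; fun_prop)

namespace Network

variable {Ω : Type*} [MeasurableSpace Ω] {N : Network Ω} {p : Params} {μ : Measure Ω}

/-- The configuration of the network. -/
def conf (N : Network Ω) (ω : Ω) : Conf :=
  ((fun i => N.tbs i ω, fun i => N.abs i ω), fun k => N.marks k ω)

/-- The mark that determines the gain between a UE and ABS `i` in state `s`. -/
def gainIdx (s : Link) (i : ℕ) : User → MarkIdx
  | .typical => .gain s i
  | .fixed => .fixedGain s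

open Classical in
lemma state_update_gainIdx (x : (ℕ → Plane) × (ℕ → Plane)) (m : MarkIdx → ℝ) (s : Link) (i : ℕ)
    (u : User) (j : ℕ) : confNetwork.state p j (x, Function.update m (gainIdx s i u) 0) =
      confNetwork.state p j (x, m) := by
  have h : Function.update m (gainIdx s i u) 0 (.vis j) = m (.vis j) :=
    Function.update_of_ne (by cases u <;> simp [gainIdx]) _ _
  change (if Function.update m (gainIdx s i u) 0 (.vis j) ≤ _ then _ else _) = _
  rw [h]
  rfl

open Classical in
lemma serves_update_gainIdx (x : (ℕ → Plane) × (ℕ → Plane)) (m : MarkIdx → ℝ) (s : Link) (i : ℕ)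
    (u : User) : (x, Function.update m (gainIdx s i u) 0) ∈ confNetwork.serves p s i ↔
      (x, m) ∈ confNetwork.serves p s i := by
  change (confNetwork.state p i _ = s ∧ ∀ j, j ≠ i → p.thr s (confNetwork.state p j _) _ ≤ _) ↔
    (confNetwork.state p i _ = s ∧ ∀ j, j ≠ i → p.thr s (confNetwork.state p j _) _ ≤ _)
  simp only [state_update_gainIdx]
  rfl

-- Interference at ABS `i` omits the gain of that ABS and never involves the gain of the fixed UE.
-- Hence the gain threshold is a function of the marks other than the served gain.
open Classical in
lemma interferenceAt_update_gainIdx (x : (ℕ → Plane) × (ℕ → Plane)) (m : MarkIdx → ℝ) (s : Link)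
    (i : ℕ) (u : User) :
    confNetwork.interferenceAt p i (x, Function.update m (gainIdx s i u) 0) =
      confNetwork.interferenceAt p i (x, m) := by
  unfold interferenceAt
  refine tsum_congr fun j => ?_
  split_ifs with hj
  · rfl
  have hg : ∀ t, confNetwork.gain t j (x, Function.update m (gainIdx s i u) 0) =
      confNetwork.gain t j (x, m) := by
    intro t
    change Function.update m (gainIdx s i u) 0 (.gain t j) = m (.gain t j)
    refine Function.update_of_ne ?_ _ _
    cases u <;> simp [gainIdx, hj]
  unfold received
  rw [state_update_gainIdx, hg]
  rfl

/-- The channel gain that a UE would need if ABS `i` in state `s` served it. -/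
def gainThresholdAt (N : Network Ω) (p : Params) (c : Position) (u : User) (s : Link) (z : ℝ)
    (i : ℕ) (ω : Ω) : ℝ :=
  p.f c u z * p.distAt u (N.dist p i ω) ^ p.alpha s * (N.interferenceAt p i ω + p.sigma2) /
    (p.PA * p.C s)

/-- The serving distance `r` belongs to position `c`. -/
def _root_.Noma.Params.caseSet (p : Params) : Position → Set ℝ
  | .near => Iic p.Rf
  | .far => Ioi p.Rf

lemma _root_.Noma.Params.measurableSet_caseSet (p : Params) (c : Position) :
    MeasurableSet (p.caseSet c) := by
  cases c
  · exact measurableSet_Iic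
  · exact measurableSet_Ioi

lemma _root_.Noma.Params.measurable_distAt (p : Params) (u : User) : Measurable (p.distAt u) := by
  cases u
  · exact measurable_id
  · exact measurable_const

omit [MeasurableSpace Ω] in
lemma mem_caseEvent_iff (c : Position) (s : Link) (ω : Ω) :
    ω ∈ N.caseEvent p c s ↔ N.R p s ω ∈ p.caseSet c := by
  cases c <;> rfl

omit [MeasurableSpace Ω] in
lemma gainThreshold_eq (c : Position) (u : User) (s : Link) (z : ℝ) (ω : Ω) :
    N.gainThreshold p c u s z ω = N.gainThresholdAt p c u s z (N.nearest p s ω) ω := by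
  cases u <;> rfl

lemma IsMeasurable.gainThresholdAt (h : N.IsMeasurable) (c : Position) (u : User) (s : Link)
    (z : ℝ) (i : ℕ) : Measurable (N.gainThresholdAt p c u s z i) :=
  (((((p.measurable_distAt u).comp (h.dist p i)).pow_const _).const_mul _).mul
    ((h.interferenceAt p i).add_const _)).div_const _

omit [MeasurableSpace Ω] in
lemma userGain_eq (u : User) (s : Link) (ω : Ω) :
    N.userGain p u s ω = N.marks (gainIdx s (N.nearest p s ω) u) ω := by
  cases u <;> rfl

open Classical in
/-- The gain of the served UE is independent of the configuration of its interferers. -/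
lemma IsModel.lintegral_gain [IsProbabilityMeasure μ] (hN : N.IsModel p μ)
    (hp : p.Admissible) (c : Position)
    (u : User) (s : Link) (z : ℝ) (i : ℕ) :
    ∫⁻ ω, (N.serves p s i ∩ {ω | p.tbsAdmits s (N.dist p i ω) (N.RT ω)}).indicator
        (fun ω => (p.caseSet c).indicator 1 (N.dist p i ω) *
          (Ioi (N.gainThresholdAt p c u s z i ω)).indicator 1 (N.marks (gainIdx s i u) ω)) ω ∂μ =
      ∫⁻ ω, (N.serves p s i ∩ {ω | p.tbsAdmits s (N.dist p i ω) (N.RT ω)}).indicator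
        (fun ω => (p.caseSet c).indicator 1 (N.dist p i ω) *
          ENNReal.ofReal (gammaTail (p.m s) (N.gainThresholdAt p c u s z i ω))) ω ∂μ := by
  have hM := hN.isMeasurable
  have hC := isMeasurable_confNetwork
  set k := gainIdx s i u with hk
  set B : Set Conf := confNetwork.serves p s i ∩
    {ω | p.tbsAdmits s (confNetwork.dist p i ω) (confNetwork.RT ω)} with hB
  have hBm : MeasurableSet B := (hC.serves p s i).inter
    (((hC.dist p i).prodMk hC.RT) (p.measurableSet_tbsAdmits s))
  set W : Conf → ℝ≥0∞ := B.indicator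
    fun ω => (p.caseSet c).indicator 1 (confNetwork.dist p i ω) with hW
  have hWm : Measurable W :=
    ((measurable_one.indicator (p.measurableSet_caseSet c)).comp (hC.dist p i)).indicator hBm
  set T : Conf → ℝ := confNetwork.gainThresholdAt p c u s z i with hT
  have hTm : Measurable T := hC.gainThresholdAt c u s z i
  have hWu : ∀ x m, W (x, Function.update m k 0) = W (x, m) := by
    intro x m
    have h1 : (x, Function.update m k 0) ∈ B ↔ (x, m) ∈ B :=
      and_congr (serves_update_gainIdx x m s i u) Iff.rfl
    by_cases h : (x, m) ∈ B
    · rw [hW, Set.indicator_of_mem h, Set.indicator_of_mem (h1.2 h)]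
      rfl
    · rw [hW, Set.indicator_of_notMem h, Set.indicator_of_notMem fun h' => h (h1.1 h')]
  have hTu : ∀ x m, T (x, Function.update m k 0) = T (x, m) := by
    intro x m
    rw [hT, gainThresholdAt, gainThresholdAt, interferenceAt_update_gainIdx]
    rfl
  set F : ℝ × (MarkIdx → ℝ) × ((ℕ → Plane) × (ℕ → Plane)) → ℝ≥0∞ := fun a =>
    W (a.2.2, a.2.1) * {a : ℝ × Conf | T a.2 < a.1}.indicator 1 (a.1, (a.2.2, a.2.1)) with hF
  have hswap : Measurable fun a : ℝ × (MarkIdx → ℝ) × ((ℕ → Plane) × (ℕ → Plane)) =>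
      (a.2.2, a.2.1) := by fun_prop
  have hFm : Measurable F := by
    refine (hWm.comp hswap).mul ((measurable_one.indicator
      (measurableSet_lt (hTm.comp measurable_snd) measurable_fst)).comp
      (measurable_fst.prodMk hswap))
  have hup : Measurable fun m : MarkIdx → ℝ => Function.update m k 0 := by
    refine measurable_pi_lambda _ fun k' => ?_
    by_cases h : k' = k
    · subst h; simp
    · simpa [h] using measurable_pi_apply k'
  have hgain : μ.map (N.marks k) = gammaMeasure (p.m s) (p.m s) := by
    rw [hk]
    cases u
    · exact hN.gain_law s i
    · exact hN.fixedGain_law s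
  -- The served gain is integrated out against the marks with that coordinate set to zero, of which
  -- it is independent. The weight `W` and the threshold `T` are not affected by the overwriting.
  have key := lintegral_eq_of_indepFun_comp (μ := μ) (X := fun ω k => N.marks k ω)
    (Y := fun ω => ((fun i => N.tbs i ω, fun i => N.abs i ω) : (ℕ → Plane) × (ℕ → Plane)))
    (f := fun m => m k) (g := fun m => Function.update m k 0)
    (measurable_pi_lambda _ hM.marks)
    ((measurable_pi_lambda _ hM.tbs).prodMk (measurable_pi_lambda _ hM.abs))
    (measurable_pi_apply k) hup hN.points_marks_indep.symm
    (indepFun_update hM.marks hN.marks_indep k) hFm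
  have hL : ∀ y ω, F (y, Function.update (fun k => N.marks k ω) k 0,
      (fun i => N.tbs i ω, fun i => N.abs i ω)) =
      W (N.conf ω) * (Ioi (T (N.conf ω))).indicator 1 y := by
    intro y ω
    rw [hF]
    dsimp only
    rw [hWu, Set.indicator_apply, Set.indicator_apply]
    refine congrArg₂ _ rfl (if_congr ?_ rfl rfl)
    change T (_, _) < y ↔ T _ < y
    rw [hTu]
    rfl
  simp only [hL] at key
  have hR : ∀ ω, ∫⁻ ω', W (N.conf ω) * (Ioi (T (N.conf ω))).indicator 1 (N.marks k ω') ∂μ =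
      W (N.conf ω) * ENNReal.ofReal (gammaTail (p.m s) (T (N.conf ω))) := by
    intro ω
    rw [lintegral_const_mul _ (f := fun ω' => (Ioi (T (N.conf ω))).indicator 1 (N.marks k ω'))
      ((measurable_one.indicator measurableSet_Ioi).comp (hM.marks k))]
    congr 1
    have h1 := lintegral_map (μ := μ) (f := (Ioi (T (N.conf ω))).indicator (1 : ℝ → ℝ≥0∞))
      (measurable_one.indicator measurableSet_Ioi) (hM.marks k)
    rw [← h1, hgain, lintegral_indicator_one measurableSet_Ioi, gammaTail]
    have := isProbabilityMeasure_gamma (hp.m_pos s)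
    rw [ofReal_measureReal]
  simp only [hR] at key
  refine Eq.trans (lintegral_congr fun ω => ?_) (key.trans (lintegral_congr fun ω => ?_))
  · by_cases h : N.conf ω ∈ B
    · rw [hW, Set.indicator_of_mem h, Set.indicator_of_mem (show ω ∈ _ from h)]
      rfl
    · rw [hW, Set.indicator_of_notMem h, Set.indicator_of_notMem (show ω ∉ _ from h), zero_mul]
  · by_cases h : N.conf ω ∈ B
    · rw [hW, Set.indicator_of_mem h, Set.indicator_of_mem (show ω ∈ _ from h)]
      rfl
    · rw [hW, Set.indicator_of_notMem h, Set.indicator_of_notMem (show ω ∉ _ from h), zero_mul]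

end Network

/-! ### The CCDF of the SINR -/

/-- After clearing denominators the inequality is linear in `S`, and `z < a / b` makes the
coefficient `a - b z` positive. -/
lemma lt_mul_div_add_mul_iff {a b S J z : ℝ} (hb : 0 < b) (hS : 0 < S) (hJ : 0 ≤ J)
    (hz : z < a / b) : z < a * S / (J + b * S) ↔ z / (a - b * z) * J < S := by
  have h1 : 0 < a - b * z := by
    rw [lt_div_iff₀ hb] at hz
    linarith
  have h2 : 0 < J + b * S := by positivity
  rw [lt_div_iff₀ h2, div_mul_eq_mul_div, div_lt_iff₀ h1]
  constructor <;> intro h <;> linarith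

/-- Dropping `J` from the denominator can only increase the quotient; residual or intra-pair
interference caps the SINR at `a / b`. -/
lemma mul_div_add_mul_le {a b S J : ℝ} (ha : 0 < a) (hb : 0 < b) (hS : 0 < S) (hJ : 0 ≤ J) :
    a * S / (J + b * S) ≤ a / b := by
  have h2 : 0 < J + b * S := by positivity
  rw [div_le_div_iff₀ h2 hb]
  nlinarith [mul_nonneg ha.le hJ]

lemma antitone_gammaTail {m : ℕ} (hm : 1 ≤ m) : Antitone (gammaTail m) := fun _ _ h => by
  have := isProbabilityMeasure_gamma hm
  exact measureReal_mono (Ioi_subset_Ioi h)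

lemma gammaTail_nonneg (m : ℕ) (x : ℝ) : 0 ≤ gammaTail m x := measureReal_nonneg

lemma gammaTail_le_one {m : ℕ} (hm : 1 ≤ m) (x : ℝ) : gammaTail m x ≤ 1 := by
  have := isProbabilityMeasure_gamma hm
  exact measureReal_le_one

namespace Params

variable {p : Params}

/-- The coefficient of the own message of UE `u` in position `c`. -/
def ownCoeff (p : Params) : Position → User → ℝ
  | .near, .typical => p.an
  | .near, .fixed => p.am
  | .far, .fixed => p.an
  | .far, .typical => p.am

/-- The coefficient of the message that disturbs UE `u` in position `c`. -/
def otherCoeff (p : Params) : Position → User → ℝ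
  | .near, .typical => p.beta * p.am
  | .near, .fixed => p.an
  | .far, .fixed => p.beta * p.am
  | .far, .typical => p.an

lemma am_pos (hp : p.Admissible) : 0 < p.am := hp.an_pos.trans hp.an_lt_am

lemma ownCoeff_pos (hp : p.Admissible) (c : Position) (u : User) : 0 < p.ownCoeff c u := by
  cases c <;> cases u
  exacts [hp.an_pos, am_pos hp, am_pos hp, hp.an_pos]

lemma otherCoeff_pos (hp : p.Admissible) (c : Position) (u : User) : 0 < p.otherCoeff c u := by
  have h := mul_pos hp.beta_pos (am_pos hp)
  cases c <;> cases u
  exacts [h, hp.an_pos, hp.an_pos, h]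

lemma zMax_eq (c : Position) (u : User) : p.zMax c u = p.ownCoeff c u / p.otherCoeff c u := by
  cases c <;> cases u <;> rfl

lemma zMax_pos (hp : p.Admissible) (c : Position) (u : User) : 0 < p.zMax c u := by
  rw [zMax_eq]
  exact div_pos (ownCoeff_pos hp c u) (otherCoeff_pos hp c u)

lemma f_eq (c : Position) (u : User) (z : ℝ) :
    p.f c u z = z / (p.ownCoeff c u - p.otherCoeff c u * z) := by
  cases c <;> cases u <;> rfl

lemma ownCoeff_sub_pos (hp : p.Admissible) {c : Position} {u : User} {z : ℝ} (hz : z < p.zMax c u) :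
    0 < p.ownCoeff c u - p.otherCoeff c u * z := by
  rw [zMax_eq, lt_div_iff₀ (otherCoeff_pos hp c u)] at hz
  linarith

lemma f_nonneg (hp : p.Admissible) {c : Position} {u : User} {z : ℝ} (hz0 : 0 ≤ z)
    (hz : z < p.zMax c u) : 0 ≤ p.f c u z := by
  rw [f_eq]
  exact div_nonneg hz0 (ownCoeff_sub_pos hp hz).le

lemma f_mono (hp : p.Admissible) {c : Position} {u : User} {z z' : ℝ} (hz0 : 0 ≤ z)
    (hzz' : z ≤ z') (hz' : z' < p.zMax c u) : p.f c u z ≤ p.f c u z' := by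
  rw [f_eq, f_eq]
  have h1 := ownCoeff_sub_pos hp hz'
  have h2 := mul_le_mul_of_nonneg_left hzz' (otherCoeff_pos hp c u).le
  exact div_le_div₀ (hz0.trans hzz') hzz' h1 (by linarith)

end Params

namespace Network

variable {Ω : Type*} [MeasurableSpace Ω] {N : Network Ω} {p : Params} {μ : Measure Ω}

-- With `ownCoeff` and `otherCoeff` the four SINRs take one common form, so no later argument
-- distinguishes the cases.
omit [MeasurableSpace Ω] in
lemma sinr_eq (c : Position) (u : User) (s : Link) (ω : Ω) :
    N.sinr p c u s ω = p.ownCoeff c u * N.signal p u s ω /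
      (N.interference p s ω + p.sigma2 + p.otherCoeff c u * N.signal p u s ω) := by
  cases c <;> cases u
  · rfl
  · change _ / (_ + _ + _) = _
    rw [add_assoc, add_comm]
    rfl
  · change _ / (_ + _ + _) = _
    rw [add_assoc, add_comm]
    rfl
  · rfl

namespace Regular

omit [MeasurableSpace Ω]

variable {ω : Ω}

lemma userDist_pos (hp : p.Admissible) (u : User) (s : Link) (ω : Ω) :
    0 < N.userDist p u s ω := by
  cases u
  · exact N.dist_pos hp _ ω
  · exact hp.h_pos.trans_le hp.h_le_Rf

lemma userGain_pos (h : N.Regular p ω) (u : User) (s : Link) : 0 < N.userGain p u s ω := by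
  cases u
  · exact h.gain_pos _ _
  · exact h.fixedGain_pos _

lemma signal_pos (h : N.Regular p ω) (hp : p.Admissible) (u : User) (s : Link) :
    0 < N.signal p u s ω :=
  mul_pos (mul_pos (mul_pos hp.PA_pos (hp.C_pos s))
    (Real.rpow_pos_of_pos (userDist_pos hp u s ω) _)) (h.userGain_pos u s)

lemma noise_nonneg (h : N.Regular p ω) (hp : p.Admissible) (s : Link) :
    0 ≤ N.interference p s ω + p.sigma2 :=
  add_nonneg (h.interferenceAt_nonneg hp _) hp.sigma2_nonneg

lemma sinr_nonneg (h : N.Regular p ω) (hp : p.Admissible) (c : Position) (u : User) (s : Link) :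
    0 ≤ N.sinr p c u s ω := by
  rw [sinr_eq]
  exact div_nonneg (mul_pos (Params.ownCoeff_pos hp c u) (h.signal_pos hp u s)).le
    (add_nonneg (h.noise_nonneg hp s)
      (mul_pos (Params.otherCoeff_pos hp c u) (h.signal_pos hp u s)).le)

lemma sinr_le_zMax (h : N.Regular p ω) (hp : p.Admissible) (c : Position) (u : User) (s : Link) :
    N.sinr p c u s ω ≤ p.zMax c u := by
  rw [sinr_eq, Params.zMax_eq]
  exact mul_div_add_mul_le (Params.ownCoeff_pos hp c u) (Params.otherCoeff_pos hp c u)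
    (h.signal_pos hp u s) (h.noise_nonneg hp s)

lemma lt_sinr_iff (h : N.Regular p ω) (hp : p.Admissible) {c : Position} {u : User} (s : Link)
    {z : ℝ} (hz : z < p.zMax c u) :
    z < N.sinr p c u s ω ↔ N.gainThreshold p c u s z ω < N.userGain p u s ω := by
  have hD := userDist_pos (N := N) hp u s ω
  have hD' := Real.rpow_pos_of_pos hD (p.alpha s)
  have hPC := mul_pos hp.PA_pos (hp.C_pos s)
  rw [sinr_eq, lt_mul_div_add_mul_iff (Params.otherCoeff_pos hp c u) (h.signal_pos hp u s)
    (h.noise_nonneg hp s) (by rwa [← Params.zMax_eq]), ← Params.f_eq, gainThreshold, signal,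
    div_lt_iff₀ hPC, Real.rpow_neg hD.le]
  have e : p.PA * p.C s * (N.userDist p u s ω ^ p.alpha s)⁻¹ * N.userGain p u s ω =
      N.userGain p u s ω * (p.PA * p.C s) / N.userDist p u s ω ^ p.alpha s := by
    field_simp
  rw [e, lt_div_iff₀ hD']
  ring_nf

lemma gainThreshold_nonneg (h : N.Regular p ω) (hp : p.Admissible) {c : Position} {u : User}
    (s : Link) {z : ℝ} (hz0 : 0 ≤ z) (hz : z < p.zMax c u) :
    0 ≤ N.gainThreshold p c u s z ω :=
  div_nonneg (mul_nonneg (mul_nonneg (Params.f_nonneg hp hz0 hz)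
    (Real.rpow_nonneg (userDist_pos hp u s ω).le _)) (h.noise_nonneg hp s))
    (mul_pos hp.PA_pos (hp.C_pos s)).le

lemma gainThreshold_mono (h : N.Regular p ω) (hp : p.Admissible) {c : Position} {u : User}
    (s : Link) {z z' : ℝ} (hz0 : 0 ≤ z) (hzz' : z ≤ z') (hz' : z' < p.zMax c u) :
    N.gainThreshold p c u s z ω ≤ N.gainThreshold p c u s z' ω :=
  div_le_div_of_nonneg_right (mul_le_mul_of_nonneg_right (mul_le_mul_of_nonneg_right
    (Params.f_mono hp hz0 hzz' hz') (Real.rpow_nonneg (userDist_pos hp u s ω).le _))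
    (h.noise_nonneg hp s)) (mul_pos hp.PA_pos (hp.C_pos s)).le

end Regular

namespace IsModel

variable [IsProbabilityMeasure μ]

/-- Below `zMax` the SINR event is a gain event. Summing over the possible serving ABSs fixes the
index, so that `lintegral_gain` can replace the event by the Gamma tail. -/
lemma setLIntegral_sinr (hN : N.IsModel p μ) (hp : p.Admissible) {c : Position} {u : User}
    (s : Link) {z : ℝ} (hz : z < p.zMax c u) :
    ∫⁻ ω in N.assoc p s, (N.caseEvent p c s ∩ {ω | z < N.sinr p c u s ω}).indicator 1 ω ∂μ =
      ∫⁻ ω in N.assoc p s, ENNReal.ofReal ((N.caseEvent p c s).indicator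
        (fun ω => gammaTail (p.m s) (N.gainThreshold p c u s z ω)) ω) ∂μ := by
  have hM := hN.isMeasurable
  have hone : ∀ i, Measurable fun ω => (p.caseSet c).indicator (1 : ℝ → ℝ≥0∞) (N.dist p i ω) :=
    fun i => (measurable_one.indicator (p.measurableSet_caseSet c)).comp (hM.dist p i)
  set Φ : ℕ → Ω → ℝ≥0∞ := fun i ω => (p.caseSet c).indicator 1 (N.dist p i ω) *
    (Ioi (N.gainThresholdAt p c u s z i ω)).indicator 1 (N.marks (gainIdx s i u) ω) with hΦ
  set Ψ : ℕ → Ω → ℝ≥0∞ := fun i ω => (p.caseSet c).indicator 1 (N.dist p i ω) *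
    ENNReal.ofReal (gammaTail (p.m s) (N.gainThresholdAt p c u s z i ω)) with hΨ
  have hΦm : ∀ i, Measurable (Φ i) := by
    intro i
    have h1 : Measurable fun ω => (Ioi (N.gainThresholdAt p c u s z i ω)).indicator
        (1 : ℝ → ℝ≥0∞) (N.marks (gainIdx s i u) ω) := by
      have : (fun ω => (Ioi (N.gainThresholdAt p c u s z i ω)).indicator
        (1 : ℝ → ℝ≥0∞) (N.marks (gainIdx s i u) ω)) =
        {ω | N.gainThresholdAt p c u s z i ω < N.marks (gainIdx s i u) ω}.indicator 1 := by
        funext ω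
        simp [Set.indicator_apply]
      rw [this]
      exact measurable_one.indicator
        (measurableSet_lt (hM.gainThresholdAt c u s z i) (hM.marks _))
    exact (hone i).mul h1
  have hΨm : ∀ i, Measurable (Ψ i) := fun i => (hone i).mul
    ((antitone_gammaTail (hp.m_pos s)).measurable.comp
      (hM.gainThresholdAt c u s z i)).ennreal_ofReal
  have h1 : ∫⁻ ω in N.assoc p s, Φ (N.nearest p s ω) ω ∂μ =
      ∫⁻ ω in N.assoc p s, Ψ (N.nearest p s ω) ω ∂μ := by
    rw [hN.setLIntegral_assoc hp s hΦm, hN.setLIntegral_assoc hp s hΨm]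
    exact tsum_congr fun i => hN.lintegral_gain hp c u s z i
  refine Eq.trans ?_ (h1.trans ?_)
  · refine lintegral_congr_ae (ae_restrict_of_ae ?_)
    filter_upwards [hN.ae_regular hp] with ω hω
    rw [hΦ]
    dsimp only
    rw [← gainThreshold_eq, ← userGain_eq]
    by_cases hc : ω ∈ N.caseEvent p c s
    · rw [Set.indicator_of_mem (show N.dist p _ ω ∈ p.caseSet c from
        (mem_caseEvent_iff c s ω).1 hc), Pi.one_apply, one_mul]
      by_cases hlt : z < N.sinr p c u s ω
      · rw [Set.indicator_of_mem (show ω ∈ _ ∩ _ from ⟨hc, hlt⟩), Set.indicator_of_mem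
          (show _ ∈ Ioi _ from (hω.lt_sinr_iff hp s hz).1 hlt)]
        rfl
      · rw [Set.indicator_of_notMem (fun h => hlt h.2), Set.indicator_of_notMem
          (show N.userGain p u s ω ∉ Ioi _ from fun h => hlt ((hω.lt_sinr_iff hp s hz).2 h))]
    · rw [Set.indicator_of_notMem (fun h => hc h.1), Set.indicator_of_notMem
        (show N.dist p _ ω ∉ _ from fun h => hc ((mem_caseEvent_iff c s ω).2 h)), zero_mul]
  · refine lintegral_congr fun ω => ?_
    rw [hΨ]
    dsimp only
    rw [← gainThreshold_eq]
    by_cases hc : ω ∈ N.caseEvent p c s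
    · rw [Set.indicator_of_mem (show N.dist p _ ω ∈ p.caseSet c from
        (mem_caseEvent_iff c s ω).1 hc), Pi.one_apply, one_mul, Set.indicator_of_mem hc]
    · rw [Set.indicator_of_notMem hc, Set.indicator_of_notMem
        (show N.dist p _ ω ∉ _ from fun h => hc ((mem_caseEvent_iff c s ω).2 h)), zero_mul, ENNReal.ofReal_zero]

omit [IsProbabilityMeasure μ] in
lemma lintegral_cond (A : Set Ω) (f : Ω → ℝ≥0∞) :
    ∫⁻ ω, f ω ∂(cond μ A) = (μ A)⁻¹ * ∫⁻ ω in A, f ω ∂μ := by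
  rw [ProbabilityTheory.cond, lintegral_smul_measure, smul_eq_mul]

lemma ae_regular_cond (hN : N.IsModel p μ) (hp : p.Admissible) (A : Set Ω) :
    ∀ᵐ ω ∂(cond μ A), N.Regular p ω :=
  cond_absolutelyContinuous.ae_le (hN.ae_regular hp)

lemma integrable_cond_of_bounded (hN : N.IsModel p μ) (hp : p.Admissible) {A : Set Ω} {f : Ω → ℝ}
    {C : ℝ} (hf : Measurable f) (h : ∀ ω, N.Regular p ω → |f ω| ≤ C) : Integrable f (cond μ A) :=
  Integrable.of_bound hf.aestronglyMeasurable C <| by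
    filter_upwards [hN.ae_regular_cond hp A] with ω hω
    exact h ω hω

/-- The CCDF of the SINR is an expectation of the CCDF of the channel gain. -/
lemma ccdf_eq_integral (hN : N.IsModel p μ) (hp : p.Admissible) {c : Position} {u : User}
    (s : Link) {z : ℝ} (hz : z < p.zMax c u) :
    N.ccdf p μ c u s z = ∫ ω, (N.caseEvent p c s).indicator
      (fun ω => gammaTail (p.m s) (N.gainThreshold p c u s z ω)) ω ∂(cond μ (N.assoc p s)) := by
  have hM := hN.isMeasurable
  have hE : MeasurableSet (N.caseEvent p c s ∩ {ω | z < N.sinr p c u s ω}) :=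
    (hM.caseEvent p c s).inter (measurableSet_lt measurable_const (hM.sinr p c u s))
  rw [integral_eq_lintegral_of_nonneg_ae
    (Eventually.of_forall fun ω => Set.indicator_nonneg (fun _ _ => gammaTail_nonneg _ _) ω)
    (((antitone_gammaTail (hp.m_pos s)).measurable.comp
      (hM.gainThreshold p c u s z)).indicator (hM.caseEvent p c s)).aestronglyMeasurable,
    lintegral_cond, ← hN.setLIntegral_sinr hp s hz, ← lintegral_cond,
    lintegral_indicator_one hE]
  rfl

lemma ccdf_eq_zero (hN : N.IsModel p μ) (hp : p.Admissible) {c : Position} {u : User}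
    (s : Link) {z : ℝ} (hz : p.zMax c u ≤ z) : N.ccdf p μ c u s z = 0 := by
  have h : cond μ (N.assoc p s) (N.caseEvent p c s ∩ {ω | z < N.sinr p c u s ω}) = 0 := by
    refine measure_mono_null (t := {ω | ¬ N.Regular p ω}) (fun ω hω hr => ?_)
      (hN.ae_regular_cond hp _)
    exact (hω.2.trans_le ((hr.sinr_le_zMax hp c u s).trans hz)).false
  rw [ccdf, measureReal_def, h, ENNReal.toReal_zero]

end IsModel

end Network

/-! ### The probability that an ABS does not interfere with the association -/

lemma Link.sum_univ {M : Type*} [AddCommMonoid M] (f : Link → M) :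
    ∑ t, f t = f .los + f .nlos := by
  have : (Finset.univ : Finset Link) = {.los, .nlos} := rfl
  rw [this, Finset.sum_pair (by simp)]

lemma Link.sum_eq_add_other {M : Type*} [AddCommMonoid M] (f : Link → M) (s : Link) :
    ∑ t, f t = f s + f s.other := by
  rw [Link.sum_univ]
  cases s
  · rfl
  · exact add_comm _ _

namespace Params

variable {p : Params}

lemma sum_linkProb (p : Params) (x : ℝ) : ∑ t, p.linkProb t x = 1 := by
  rw [Link.sum_univ]
  exact add_sub_cancel _ _

/-- The Laplace transform at `v` of the power received from an ABS in state `t` at horizontal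
distance `x`. -/
def atten (p : Params) (t : Link) (v x : ℝ) : ℝ :=
  ((1 + v * p.PA * p.C t / (p.m t * (x ^ 2 + p.h ^ 2) ^ (p.alpha t / 2))) ^ p.m t)⁻¹

@[fun_prop]
lemma measurable_atten (p : Params) (t : Link) (v : ℝ) : Measurable (p.atten t v) := by
  unfold atten
  fun_prop

lemma slant_sq_pos (hp : p.Admissible) (x : ℝ) : 0 < x ^ 2 + p.h ^ 2 := by
  have := hp.h_pos
  positivity

lemma atten_arg_nonneg (hp : p.Admissible) (t : Link) {v : ℝ} (hv : 0 ≤ v) (x : ℝ) :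
    0 ≤ v * p.PA * p.C t / (p.m t * (x ^ 2 + p.h ^ 2) ^ (p.alpha t / 2)) := by
  have := hp.PA_pos
  have := hp.C_pos t
  have := slant_sq_pos hp x
  positivity

lemma atten_pos (hp : p.Admissible) (t : Link) {v : ℝ} (hv : 0 ≤ v) (x : ℝ) :
    0 < p.atten t v x := by
  have := atten_arg_nonneg hp t hv x
  unfold atten
  positivity

lemma atten_le_one (hp : p.Admissible) (t : Link) {v : ℝ} (hv : 0 ≤ v) (x : ℝ) :
    p.atten t v x ≤ 1 :=
  inv_le_one_of_one_le₀ (one_le_pow₀ (by linarith [atten_arg_nonneg hp t hv x]))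

lemma atten_anti (hp : p.Admissible) (t : Link) {v v' : ℝ} (hv : 0 ≤ v) (hvv' : v ≤ v') (x : ℝ) :
    p.atten t v' x ≤ p.atten t v x := by
  have h1 := atten_arg_nonneg hp t hv x
  have h2 : v * p.PA * p.C t / (p.m t * (x ^ 2 + p.h ^ 2) ^ (p.alpha t / 2)) ≤
      v' * p.PA * p.C t / (p.m t * (x ^ 2 + p.h ^ 2) ^ (p.alpha t / 2)) := by
    have := hp.PA_pos
    have := hp.C_pos t
    have := slant_sq_pos hp x
    gcongr
  unfold atten
  refine inv_anti₀ (by positivity) (pow_le_pow_left₀ (by linarith) (by linarith) _)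

/-- Bernoulli's inequality for `(1 + u)⁻¹ = 1 - u / (1 + u)` gives `1 - (1 + u)^(-m) ≤ m u`, and `m
u` is `v` times the mean received power. -/
lemma one_sub_atten_le (hp : p.Admissible) (t : Link) {v : ℝ} (hv : 0 ≤ v) (x : ℝ) :
    1 - p.atten t v x ≤ v * p.PA * p.C t * √(x ^ 2 + p.h ^ 2) ^ (-p.alpha t) := by
  have hu := atten_arg_nonneg hp t hv x
  set u := v * p.PA * p.C t / (p.m t * (x ^ 2 + p.h ^ 2) ^ (p.alpha t / 2)) with hudef
  have hm : (0 : ℝ) < p.m t := by exact_mod_cast hp.m_pos t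
  have hs := slant_sq_pos hp x
  have h1 : v * p.PA * p.C t * √(x ^ 2 + p.h ^ 2) ^ (-p.alpha t) = p.m t * u := by
    rw [hudef, Real.sqrt_eq_rpow, ← Real.rpow_mul hs.le,
      show 1 / 2 * -p.alpha t = -(p.alpha t / 2) by ring, Real.rpow_neg hs.le]
    field_simp
  have h2 : 1 + -u / (1 + u) = (1 + u)⁻¹ := by field_simp; ring
  have h3 : 1 + p.m t * (-u / (1 + u)) ≤ p.atten t v x := by
    rw [atten, ← hudef, ← inv_pow, ← h2]
    refine one_add_mul_le_pow ?_ _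
    rw [le_div_iff₀ (by positivity)]
    linarith
  have h4 : u / (1 + u) ≤ u := div_le_self hu (by linarith)
  have h5 := mul_le_mul_of_nonneg_left h4 hm.le
  rw [h1]
  rw [neg_div] at h3
  linarith

/-- Probability that an ABS at `y` is in state `t` and is not preferred to the serving ABS, weighted
by the Laplace transform of its power. -/
def avoidTerm (p : Params) (s t : Link) (r v : ℝ) (y : Plane) : ℝ :=
  if p.thr s t r ≤ p.slant y then p.linkProb t ‖y‖ * p.atten t v ‖y‖ else 0

/-- Sum of `avoidTerm` over the two link states. -/
def avoid (p : Params) (s : Link) (r v : ℝ) (y : Plane) : ℝ := ∑ t, p.avoidTerm s t r v y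

lemma measurable_avoidTerm (p : Params) (s t : Link) (r v : ℝ) :
    Measurable (p.avoidTerm s t r v) :=
  Measurable.ite (measurableSet_le measurable_const p.measurable_slant) (by fun_prop)
    measurable_const

lemma measurable_avoid (p : Params) (s : Link) (r v : ℝ) : Measurable (p.avoid s r v) :=
  Finset.measurable_sum _ fun t _ => p.measurable_avoidTerm s t r v

lemma avoidTerm_nonneg (hp : p.Admissible) (s t : Link) (r : ℝ) {v : ℝ} (hv : 0 ≤ v) (y : Plane) :
    0 ≤ p.avoidTerm s t r v y := by
  unfold avoidTerm
  split_ifs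
  · exact mul_nonneg (linkProb_pos hp _ _).le (atten_pos hp _ hv _).le
  · exact le_rfl

lemma avoidTerm_le (hp : p.Admissible) (s t : Link) (r : ℝ) {v : ℝ} (hv : 0 ≤ v) (y : Plane) :
    p.avoidTerm s t r v y ≤ p.linkProb t ‖y‖ := by
  unfold avoidTerm
  split_ifs
  · exact mul_le_of_le_one_right (linkProb_pos hp _ _).le (atten_le_one hp _ hv _)
  · exact (linkProb_pos hp _ _).le

lemma avoid_nonneg (hp : p.Admissible) (s : Link) (r : ℝ) {v : ℝ} (hv : 0 ≤ v) (y : Plane) :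
    0 ≤ p.avoid s r v y := Finset.sum_nonneg fun t _ => avoidTerm_nonneg hp s t r hv y

lemma avoid_le_one (hp : p.Admissible) (s : Link) (r : ℝ) {v : ℝ} (hv : 0 ≤ v) (y : Plane) :
    p.avoid s r v y ≤ 1 := by
  rw [← p.sum_linkProb ‖y‖]
  exact Finset.sum_le_sum fun t _ => avoidTerm_le hp s t r hv y

lemma tau_mono (hp : p.Admissible) (s : Link) {r r' : ℝ} (hr : 0 ≤ r) (h : r ≤ r') :
    p.tau s r ≤ p.tau s r' := by
  have := eta_pos hp s
  have := eta_pos hp s.other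
  have := alpha_pos hp s
  have := alpha_pos hp s.other
  unfold tau
  gcongr

lemma thr_mono (hp : p.Admissible) (s t : Link) {r r' : ℝ} (hr : 0 ≤ r) (h : r ≤ r') :
    p.thr s t r ≤ p.thr s t r' := by
  unfold thr
  split_ifs
  · exact h
  · exact tau_mono hp s hr h

lemma continuous_thr (hp : p.Admissible) (s t : Link) : Continuous (p.thr s t) := by
  have h : Continuous (p.tau s) := by
    unfold tau
    exact continuous_const.max (continuous_const.mul (Real.continuous_rpow_const
      (div_pos (alpha_pos hp s) (alpha_pos hp s.other)).le))
  unfold thr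
  split_ifs
  · exact continuous_id
  · exact h

/-- A larger serving distance excludes more positions, and a larger Laplace argument attenuates
more. This is the monotonicity that `mecke_antitone` needs. -/
lemma avoid_anti (hp : p.Admissible) (s : Link) {r r' v v' : ℝ} (hr : 0 ≤ r) (h : r ≤ r')
    (hv : 0 ≤ v) (hvv' : v ≤ v') (y : Plane) : p.avoid s r' v' y ≤ p.avoid s r v y := by
  refine Finset.sum_le_sum fun t _ => ?_
  by_cases h1 : p.thr s t r' ≤ p.slant y
  · rw [avoidTerm, avoidTerm, if_pos h1, if_pos ((thr_mono hp s t hr h).trans h1)]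
    exact mul_le_mul_of_nonneg_left (atten_anti hp t hv hvv' _) (linkProb_pos hp _ _).le
  · rw [avoidTerm, if_neg h1]
    exact avoidTerm_nonneg hp s t r hv y

/-- Left-continuity rests on the non-strict inequality in `avoidTerm`: if it holds at `r`, it holds
at all smaller values; if it fails, it fails nearby, since `thr` is continuous. -/
lemma continuousWithinAt_avoid (hp : p.Admissible) (s : Link) {v : ℝ → ℝ} (hv : Continuous v)
    (hv0 : ∀ r, 0 ≤ r → 0 ≤ v r) (y : Plane) (r : ℝ≥0) :
    ContinuousWithinAt (fun r : ℝ≥0 => p.avoid s r (v r) y) (Iic r) r := by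
  refine tendsto_finsetSum _ fun t _ => ?_
  by_cases h1 : p.thr s t r ≤ p.slant y
  · have hc : ContinuousWithinAt (fun r : ℝ≥0 => p.linkProb t ‖y‖ * p.atten t (v r) ‖y‖)
        (Iic r) r := by
      refine (ContinuousAt.mul continuousAt_const ?_).continuousWithinAt
      unfold atten
      refine ContinuousAt.inv₀ (by fun_prop) ?_
      have := atten_arg_nonneg hp t (hv0 r r.2) ‖y‖
      positivity
    refine hc.congr (fun r' hr' => ?_) (if_pos h1)
    exact if_pos ((thr_mono hp s t r'.2 (by exact_mod_cast hr')).trans h1)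
  · have h2 : ∀ᶠ r' : ℝ≥0 in 𝓝 r, p.slant y < p.thr s t r' :=
      ((continuous_thr hp s t).comp NNReal.continuous_coe).continuousAt.eventually_const_lt
        (not_le.1 h1)
    have hc : ContinuousWithinAt (fun _ : ℝ≥0 => (0 : ℝ)) (Iic r) r := continuousWithinAt_const
    refine hc.congr_of_eventuallyEq ?_ (if_neg h1)
    filter_upwards [mem_nhdsWithin_of_mem_nhds h2] with r' hr'
    exact if_neg (not_le.2 hr')

/-! ### Laplace transform of the interference -/

/-- Squaring turns a bound on the slant distance into one on the horizontal distance. Square roots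
of negative numbers are zero, so thresholds below `h` need no separate treatment. -/
lemma thr_le_slant_iff {s t : Link} {r : ℝ} (hr : 0 ≤ p.thr s t r) (y : Plane) :
    p.thr s t r ≤ p.slant y ↔ p.wLow s t r ≤ ‖y‖ := by
  have hw : p.wLow s t r = √(p.thr s t r ^ 2 - p.h ^ 2) := by
    unfold wLow thr
    split_ifs <;> rfl
  rw [hw, slant, Real.le_sqrt hr (by positivity), Real.sqrt_le_left (norm_nonneg _),
    sub_le_iff_le_add]

lemma wLow_nonneg (s t : Link) (r : ℝ) : 0 ≤ p.wLow s t r := by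
  unfold wLow
  split_ifs <;> exact Real.sqrt_nonneg _

/-- The bound `one_sub_atten_le` dominates the integrand by a multiple of the planar integrand of
`slant^(-α)`, which is integrable because `α > 2`. -/
lemma integrableOn_tail (hp : p.Admissible) (t : Link) {v w : ℝ} (hv : 0 ≤ v) (hw : 0 ≤ w) :
    IntegrableOn (fun x => (1 - p.atten t v x) * p.linkProb t x * x) (Ioi w) := by
  have h1 : IntegrableOn (fun x : ℝ => 2 * Real.pi * x * √(x ^ 2 + p.h ^ 2) ^ (-p.alpha t))
      (Ioi 0) := by
    have h2 : ∫⁻ y : Plane, ENNReal.ofReal (√(‖y‖ ^ 2 + p.h ^ 2) ^ (-p.alpha t)) < ∞ :=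
      lintegral_slant_rpow_lt_top hp (hp.two_lt_alpha t)
    rw [lintegral_norm_plane
      (F := fun x => ENNReal.ofReal (√(x ^ 2 + p.h ^ 2) ^ (-p.alpha t))) (by fun_prop)] at h2
    refine ⟨by fun_prop, ?_⟩
    rw [hasFiniteIntegral_iff_norm]
    refine lt_of_eq_of_lt (setLIntegral_congr_fun measurableSet_Ioi fun x hx => ?_) h2
    have hx0 : (0 : ℝ) < x := hx
    rw [← ENNReal.ofReal_mul (by positivity), Real.norm_of_nonneg (by positivity)]
  have h4 := (h1.mono_set (Ioi_subset_Ioi hw)).const_mul (v * p.PA * p.C t)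
  refine Integrable.mono' h4 (by fun_prop) ?_
  filter_upwards [ae_restrict_mem measurableSet_Ioi] with x hx
  have hx0 : 0 < x := lt_of_le_of_lt hw hx
  have e1 := sub_nonneg.2 (atten_le_one hp t hv x)
  have e2 := linkProb_pos hp t x
  rw [Real.norm_of_nonneg (by positivity)]
  have e3 := one_sub_atten_le hp t hv x
  have e4 : (1 - p.atten t v x) * p.linkProb t x ≤ (1 - p.atten t v x) * 1 :=
    mul_le_mul_of_nonneg_left (linkProb_le_one hp t x) e1
  have e5 : 1 ≤ 2 * Real.pi := by linarith [Real.pi_gt_three]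
  have e6 : 0 ≤ v * p.PA * p.C t * √(x ^ 2 + p.h ^ 2) ^ (-p.alpha t) := e1.trans e3
  calc (1 - p.atten t v x) * p.linkProb t x * x
      ≤ v * p.PA * p.C t * √(x ^ 2 + p.h ^ 2) ^ (-p.alpha t) * x :=
        mul_le_mul_of_nonneg_right (by linarith) hx0.le
    _ ≤ (2 * Real.pi) * (v * p.PA * p.C t * √(x ^ 2 + p.h ^ 2) ^ (-p.alpha t) * x) :=
        le_mul_of_one_le_left (by positivity) e5
    _ = _ := by ring

lemma integrableOn_head (hp : p.Admissible) (t : Link) (w : ℝ) :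
    IntegrableOn (fun x => x * p.linkProb t x) (Ioc 0 w) := by
  refine Measure.integrableOn_of_bounded (M := w) (by simp) (by fun_prop) ?_
  filter_upwards [ae_restrict_mem measurableSet_Ioc] with x hx
  rw [Real.norm_of_nonneg (mul_nonneg hx.1.le (linkProb_pos hp t x).le)]
  exact (mul_le_of_le_one_right hx.1.le (linkProb_le_one hp t x)).trans hx.2

lemma voidProb_eq (p : Params) (s t : Link) (r : ℝ) : p.voidProb t (p.thr s t r) =
    Real.exp (-(2 * Real.pi * p.lamA * ∫ x in Ioc 0 (p.wLow s t r), x * p.linkProb t x)) := by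
  have hw : p.wLow s t r = √(p.thr s t r ^ 2 - p.h ^ 2) := by
    unfold wLow thr
    split_ifs <;> rfl
  rw [hw, voidProb, intervalIntegral.integral_of_le (Real.sqrt_nonneg _)]

/-- Inside the radius `wLow`, an ABS in state `t` is forbidden and the integrand is the full state
probability, which gives the void probability. Outside, only the attenuation remains, which gives
the Laplace factor. -/
lemma negExp_lintegral_term (hp : p.Admissible) (s t : Link) {r v : ℝ} (hr : 0 ≤ p.thr s t r)
    (hv : 0 ≤ v) :
    negExp (∫⁻ y, ENNReal.ofReal (p.linkProb t ‖y‖ - p.avoidTerm s t r v y)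
      ∂(ENNReal.ofReal p.lamA • (volume : Measure Plane))) =
      ENNReal.ofReal (p.voidProb t (p.thr s t r) * p.laplacePart s t r v) := by
  set w := p.wLow s t r with hw
  have hw0 : 0 ≤ w := p.wLow_nonneg s t r
  set g : ℝ → ℝ := fun x => p.linkProb t x - if w ≤ x then p.linkProb t x * p.atten t v x else 0
    with hg
  have hgm : Measurable g :=
    (p.measurable_linkProb t).sub (Measurable.ite measurableSet_Ici (by fun_prop) measurable_const)
  have h1 : ∫⁻ y : Plane, ENNReal.ofReal (p.linkProb t ‖y‖ - p.avoidTerm s t r v y) =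
      ∫⁻ x in Ioi (0 : ℝ), ENNReal.ofReal (2 * Real.pi * x) * ENNReal.ofReal (g x) := by
    rw [← lintegral_norm_plane (F := fun x => ENNReal.ofReal (g x)) hgm.ennreal_ofReal]
    refine lintegral_congr fun y => ?_
    rw [hg, avoidTerm]
    simp only [thr_le_slant_iff hr]
    rfl
  have hpi := Real.pi_pos
  have hlam := hp.lamA_pos
  have hhead := (integrableOn_head hp t w).const_mul (2 * Real.pi)
  have htail := (integrableOn_tail hp t hv hw0).const_mul (2 * Real.pi)
  have h2 : ∫⁻ x in Ioc 0 w, ENNReal.ofReal (2 * Real.pi * x) * ENNReal.ofReal (g x) =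
      ENNReal.ofReal (2 * Real.pi * ∫ x in Ioc 0 w, x * p.linkProb t x) := by
    rw [← integral_const_mul, ofReal_integral_eq_lintegral_ofReal hhead, ← setLIntegral_congr
      Ioo_ae_eq_Ioc, ← setLIntegral_congr Ioo_ae_eq_Ioc]
    · refine setLIntegral_congr_fun measurableSet_Ioo fun x hx => ?_
      have hx0 : 0 < x := hx.1
      have hgx : g x = p.linkProb t x := by
        rw [hg]
        simp [hx.2]
      rw [hgx, ← ENNReal.ofReal_mul (by positivity), mul_assoc]
    · filter_upwards [ae_restrict_mem measurableSet_Ioc] with x hx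
      exact mul_nonneg (by positivity) (mul_nonneg hx.1.le (linkProb_pos hp t x).le)
  have h3 : ∫⁻ x in Ioi w, ENNReal.ofReal (2 * Real.pi * x) * ENNReal.ofReal (g x) =
      ENNReal.ofReal (2 * Real.pi *
        ∫ x in Ioi w, (1 - p.atten t v x) * p.linkProb t x * x) := by
    rw [← integral_const_mul, ofReal_integral_eq_lintegral_ofReal htail]
    · refine setLIntegral_congr_fun measurableSet_Ioi fun x hx => ?_
      have hx0 : 0 < x := lt_of_le_of_lt hw0 hx
      have hgx : g x = p.linkProb t x - p.linkProb t x * p.atten t v x := by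
        rw [hg]
        simp [(mem_Ioi.1 hx).le]
      rw [hgx, ← ENNReal.ofReal_mul (by positivity)]
      ring_nf
    · filter_upwards [ae_restrict_mem measurableSet_Ioi] with x hx
      exact mul_nonneg (by positivity) (mul_nonneg (mul_nonneg
        (sub_nonneg.2 (atten_le_one hp t hv x)) (linkProb_pos hp t x).le) (hw0.trans hx.le))
  have hI1 : 0 ≤ ∫ x in Ioc 0 w, x * p.linkProb t x :=
    setIntegral_nonneg measurableSet_Ioc fun x hx => mul_nonneg hx.1.le (linkProb_pos hp t x).le
  have hI2 : 0 ≤ ∫ x in Ioi w, (1 - p.atten t v x) * p.linkProb t x * x :=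
    setIntegral_nonneg measurableSet_Ioi fun x hx => mul_nonneg (mul_nonneg
      (sub_nonneg.2 (atten_le_one hp t hv x)) (linkProb_pos hp t x).le) (hw0.trans (le_of_lt hx))
  rw [lintegral_smul_measure, h1, ← Ioc_union_Ioi_eq_Ioi hw0,
    lintegral_union measurableSet_Ioi (Ioc_disjoint_Ioi le_rfl), h2, h3, smul_eq_mul, mul_add,
    ← ENNReal.ofReal_mul hlam.le, ← ENNReal.ofReal_mul hlam.le, negExp_add,
    negExp_ofReal (by positivity), negExp_ofReal (by positivity),
    ← ENNReal.ofReal_mul (Real.exp_pos _).le, voidProb_eq, laplacePart]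
  congr 2
  · ring_nf
    rfl
  · congr 2
    rw [mul_comm p.lamA, mul_assoc, mul_comm _ p.lamA, ← mul_assoc]
    rfl

/-- The state probabilities sum to one, so `1 - avoid` splits into one non-negative term per state.
The exponential of the sum is the product: LoS and NLoS ABSs behave as independent thinned
processes. -/
lemma negExp_lintegral_avoid (hp : p.Admissible) (s : Link) {r v : ℝ} (hr : p.h ≤ r)
    (hv : 0 ≤ v) :
    negExp (∫⁻ y, (1 - ENNReal.ofReal (p.avoid s r v y))
      ∂(ENNReal.ofReal p.lamA • (volume : Measure Plane))) =
      ENNReal.ofReal (p.voidProb s r * p.voidProb s.other (p.tau s r) * p.laplaceIA s r v) := by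
  have hthr : ∀ t, 0 ≤ p.thr s t r := fun t => by
    unfold thr
    split_ifs
    · exact hp.h_pos.le.trans hr
    · exact hp.h_pos.le.trans (h_le_tau _ _)
  have h1 : ∀ y : Plane, 1 - ENNReal.ofReal (p.avoid s r v y) =
      ENNReal.ofReal (p.linkProb s ‖y‖ - p.avoidTerm s s r v y) +
        ENNReal.ofReal (p.linkProb s.other ‖y‖ - p.avoidTerm s s.other r v y) := by
    intro y
    rw [← ENNReal.ofReal_one, ← ENNReal.ofReal_sub _ (avoid_nonneg hp s r hv y),
      ← p.sum_linkProb ‖y‖, avoid, Link.sum_eq_add_other _ s, Link.sum_eq_add_other _ s,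
      ← ENNReal.ofReal_add (sub_nonneg.2 (avoidTerm_le hp _ _ _ hv _))
        (sub_nonneg.2 (avoidTerm_le hp _ _ _ hv _))]
    congr 1
    ring
  have hm : ∀ t, Measurable fun y : Plane =>
      ENNReal.ofReal (p.linkProb t ‖y‖ - p.avoidTerm s t r v y) := fun t =>
    (((p.measurable_linkProb t).comp measurable_norm).sub
      (p.measurable_avoidTerm s t r v)).ennreal_ofReal
  have hpos : ∀ t r, 0 ≤ p.voidProb t r := fun t r => (Real.exp_pos _).le
  have hpos' : ∀ t, 0 ≤ p.laplacePart s t r v := fun t => (Real.exp_pos _).le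
  simp_rw [h1]
  rw [lintegral_add_left (hm s), negExp_add, negExp_lintegral_term hp s s (hthr _) hv,
    negExp_lintegral_term hp s s.other (hthr _) hv,
    ← ENNReal.ofReal_mul (mul_nonneg (hpos _ _) (hpos' _)), thr_self, thr_other]
  congr 1
  have : p.laplaceIA s r v = p.laplacePart s s r v * p.laplacePart s s.other r v := by
    cases s
    · rfl
    · exact mul_comm _ _
  rw [this]
  ring

end Params

/-! ### The joint law of the serving distance and of the interference -/

lemma infProd_eq_zero {w : ℕ → ℝ≥0∞} {j : ℕ} (hj : w j = 0) : infProd w = 0 :=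
  le_antisymm ((iInf_le _ (j + 1)).trans
    (Finset.prod_eq_zero (Finset.self_mem_range_succ j) hj).le) zero_le

lemma infProd_ite_eq_mul {a : ℝ≥0∞} {w : ℕ → ℝ≥0∞} (ha : a ≤ 1) (hw : ∀ j, w j ≤ 1) (i : ℕ) :
    infProd (fun j => if j = i then a else w j) =
      a * infProd fun j => if j = i then 1 else w j := by
  have h1 := tendsto_infProd (w := fun j => if j = i then a else w j) fun j => by
    split_ifs
    exacts [ha, hw j]
  have h2 := tendsto_infProd (w := fun j => if j = i then 1 else w j) fun j => by
    split_ifs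
    exacts [le_rfl, hw j]
  have h3 := ENNReal.Tendsto.const_mul h2 (Or.inr (ha.trans_lt ENNReal.one_lt_top).ne)
  refine tendsto_nhds_unique h1 (h3.congr' ?_)
  filter_upwards [eventually_gt_atTop i] with n hn
  have hi := Finset.mem_range.2 hn
  rw [← Finset.mul_prod_erase _ _ hi, ← Finset.mul_prod_erase _ _ hi, if_pos rfl, if_pos rfl,
    one_mul]
  congr 1
  refine Finset.prod_congr rfl fun j hj => ?_
  rw [if_neg (Finset.ne_of_mem_erase hj), if_neg (Finset.ne_of_mem_erase hj)]

namespace Params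

variable {p : Params}

/-- Contribution of an ABS with position `y` and marks `u`, `g` in state `t`. -/
def markTerm (p : Params) (s t : Link) (r v : ℝ) (y : Plane) (u g : ℝ) : ℝ≥0∞ :=
  (if p.linkState y u = t then 1 else 0) * ENNReal.ofReal (if p.thr s t r ≤ p.slant y then
    Real.exp (-(v * (p.PA * p.C t * p.slant y ^ (-p.alpha t) * max g 0))) else 0)

/-- Contribution of ABS `j`, with position `y`, to the product over all interferers. -/
def blockFactor (p : Params) (s : Link) (r v : ℝ) (y : Plane) (m : MarkIdx → ℝ) (j : ℕ) : ℝ≥0∞ :=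
  ∑ t, p.markTerm s t r v y (m (.vis j)) (m (.gain t j))

lemma measurable_markTerm (p : Params) (s t : Link) :
    Measurable fun z : (ℝ × ℝ) × Plane × ℝ × ℝ =>
      p.markTerm s t z.1.1 z.1.2 z.2.1 z.2.2.1 z.2.2.2 := by
  have h1 : Measurable fun z : (ℝ × ℝ) × Plane × ℝ × ℝ => p.linkState z.2.1 z.2.2.1 := by
    unfold linkState
    exact Measurable.ite (measurableSet_le (by fun_prop) (by fun_prop)) measurable_const
      measurable_const
  have h2 : MeasurableSet {z : (ℝ × ℝ) × Plane × ℝ × ℝ | p.thr s t z.1.1 ≤ p.slant z.2.1} :=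
    measurableSet_le (by fun_prop) (by fun_prop)
  unfold markTerm
  refine Measurable.mul (Measurable.ite (h1 (measurableSet_singleton t)) measurable_const
    measurable_const) (Measurable.ennreal_ofReal (Measurable.ite h2 ?_ measurable_const))
  fun_prop

lemma measurable_blockFactor (p : Params) (s : Link) (j : ℕ) :
    Measurable fun z : (ℝ × ℝ) × Plane × (MarkIdx → ℝ) =>
      p.blockFactor s z.1.1 z.1.2 z.2.1 z.2.2 j := by
  refine Finset.measurable_sum _ fun t _ => ?_
  have h : Measurable fun z : (ℝ × ℝ) × Plane × (MarkIdx → ℝ) =>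
      ((z.1, z.2.1, z.2.2 (.vis j), z.2.2 (.gain t j)) : (ℝ × ℝ) × Plane × ℝ × ℝ) := by fun_prop
  exact (p.measurable_markTerm s t).comp h

lemma blockFactor_eq (s : Link) (r v : ℝ) (y : Plane) (m : MarkIdx → ℝ) (j : ℕ) :
    p.blockFactor s r v y m j = ENNReal.ofReal
      (if p.thr s (p.linkState y (m (.vis j))) r ≤ p.slant y then
        Real.exp (-(v * (p.PA * p.C (p.linkState y (m (.vis j))) *
          p.slant y ^ (-p.alpha (p.linkState y (m (.vis j)))) *
            max (m (.gain (p.linkState y (m (.vis j))) j)) 0))) else 0) := by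
  rw [blockFactor, Finset.sum_eq_single (p.linkState y (m (.vis j)))]
  · rw [markTerm, if_pos rfl, one_mul]
  · intro t _ ht
    rw [markTerm, if_neg (Ne.symm ht), zero_mul]
  · exact fun h => (h (Finset.mem_univ _)).elim

lemma blockFactor_le_one (hp : p.Admissible) (s : Link) (r : ℝ) {v : ℝ} (hv : 0 ≤ v) (y : Plane)
    (m : MarkIdx → ℝ) (j : ℕ) : p.blockFactor s r v y m j ≤ 1 := by
  rw [blockFactor_eq]
  refine ENNReal.ofReal_le_one.2 ?_
  split_ifs
  · have := hp.PA_pos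
    have := hp.C_pos (p.linkState y (m (.vis j)))
    have := slant_pos hp y
    exact Real.exp_le_one_iff.2 (neg_nonpos.2 (by positivity))
  · exact zero_le_one

lemma measurable_avoid_comp (p : Params) (s : Link) {v : ℝ → ℝ} (hv : Measurable v) :
    Measurable fun z : ℝ × Plane => p.avoid s z.1 (v z.1) z.2 := by
  refine Finset.measurable_sum _ fun t _ => ?_
  unfold avoidTerm
  refine Measurable.ite (measurableSet_le (by fun_prop) (by fun_prop)) ?_ measurable_const
  unfold atten
  fun_prop

end Params

namespace Network

variable {Ω : Type*} [MeasurableSpace Ω] {N : Network Ω} {p : Params} {μ : Measure Ω}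

omit [MeasurableSpace Ω] in
lemma state_eq (j : ℕ) (ω : Ω) :
    N.state p j ω = p.linkState (N.abs j ω) (N.marks (.vis j) ω) := rfl

omit [MeasurableSpace Ω] in
lemma Regular.blockFactor_eq {ω : Ω} (h : N.Regular p ω) (s : Link) (r v : ℝ) (j : ℕ) :
    p.blockFactor s r v (N.abs j ω) (fun k => N.marks k ω) j = ENNReal.ofReal
      (if p.thr s (N.state p j ω) r ≤ N.dist p j ω then
        Real.exp (-(v * N.received p j ω)) else 0) := by
  -- The truncation at zero in `markTerm` only serves to keep every factor in `[0, 1]`; the actual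
  -- gains are positive.
  have hg : max (N.marks (.gain (N.state p j ω) j) ω) 0 = N.gain (N.state p j ω) j ω :=
    max_eq_left (h.gain_pos _ j).le
  rw [Params.blockFactor_eq, received, ← state_eq]
  rw [hg]
  rfl

omit [MeasurableSpace Ω] in
/-- Product formula for the Laplace functional of the interference on the event that a given ABS
may serve. -/
lemma Regular.indicator_serves_eq {ω : Ω} (h : N.Regular p ω) (hp : p.Admissible) (s : Link)
    (i : ℕ) {v : ℝ} (hv : 0 ≤ v) :
    (N.serves p s i).indicator
        (fun ω => ENNReal.ofReal (Real.exp (-(v * N.interferenceAt p i ω)))) ω =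
      infProd fun j => if j = i then (if p.linkState (N.abs i ω) (N.marks (.vis i) ω) = s then 1
        else 0) else p.blockFactor s (N.dist p i ω) v (N.abs j ω) (fun k => N.marks k ω) j := by
  by_cases hs : ω ∈ N.serves p s i
  · rw [Set.indicator_of_mem hs]
    have hle : ∀ j, (if j = i then (if p.linkState (N.abs i ω) (N.marks (.vis i) ω) = s then 1
        else 0) else p.blockFactor s (N.dist p i ω) v (N.abs j ω) (fun k => N.marks k ω) j) ≤
        (1 : ℝ≥0∞) := by
      intro j
      split_ifs
      exacts [le_rfl, zero_le, Params.blockFactor_le_one hp s _ hv _ _ _]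
    have hterm : ∀ j, (if j = i then (if p.linkState (N.abs i ω) (N.marks (.vis i) ω) = s then 1
        else 0) else p.blockFactor s (N.dist p i ω) v (N.abs j ω) (fun k => N.marks k ω) j) =
        ENNReal.ofReal (Real.exp (-(v * if j = i then 0 else N.received p j ω))) := by
      intro j
      split_ifs with h1 h2
      · simp
      · exact absurd hs.1 h2
      · rw [h.blockFactor_eq, if_pos (hs.2 j h1)]
    have hsum : HasSum (fun j => if j = i then 0 else N.received p j ω)
        (N.interferenceAt p i ω) := by
      refine Summable.hasSum (Summable.of_nonneg_of_le (fun j => ?_) (fun j => ?_) h.summable)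
      · split_ifs
        exacts [le_rfl, received_nonneg hp h.gain_pos j]
      · split_ifs
        exacts [received_nonneg hp h.gain_pos j, le_rfl]
    refine tendsto_nhds_unique ?_ (tendsto_infProd hle)
    have hlim : Tendsto (fun n => ENNReal.ofReal (Real.exp (-(v * ∑ j ∈ Finset.range n,
        if j = i then 0 else N.received p j ω)))) atTop
        (𝓝 (ENNReal.ofReal (Real.exp (-(v * N.interferenceAt p i ω))))) :=
      (ENNReal.continuous_ofReal.tendsto _).comp ((Real.continuous_exp.tendsto _).comp
        ((hsum.tendsto_sum_nat.const_mul v).neg))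
    refine hlim.congr fun n => ?_
    rw [Finset.prod_congr rfl fun j _ => hterm j,
      ← ENNReal.ofReal_prod_of_nonneg fun j _ => (Real.exp_pos _).le, ← Real.exp_sum,
      Finset.sum_neg_distrib, Finset.mul_sum]
  · rw [Set.indicator_of_notMem hs]
    -- Off the event some factor is zero: either another ABS violates its threshold, or ABS `i`
    -- itself is in the wrong state.
    by_cases h1 : N.state p i ω = s
    · have h2 : ∃ j, j ≠ i ∧ ¬ p.thr s (N.state p j ω) (N.dist p i ω) ≤ N.dist p j ω := by
        by_contra! hcon
        exact hs ⟨h1, hcon⟩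
      obtain ⟨j, hj, hlt⟩ := h2
      refine (infProd_eq_zero (j := j) ?_).symm
      rw [if_neg hj, h.blockFactor_eq, if_neg hlt, ENNReal.ofReal_zero]
    · refine (infProd_eq_zero (j := i) ?_).symm
      rw [if_pos rfl]
      exact if_neg h1

namespace IsModel

variable [IsProbabilityMeasure μ]

/-- For a fixed position the visibility and the gain are independent. The former gives the state
probability, the latter the Laplace transform of the Gamma law. -/
lemma lintegral_blockFactor (hN : N.IsModel p μ) (hp : p.Admissible) (s : Link) (r : ℝ) {v : ℝ}
    (hv : 0 ≤ v) (y : Plane) (j : ℕ) :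
    ∫⁻ ω, p.blockFactor s r v y (fun k => N.marks k ω) j ∂μ = ENNReal.ofReal (p.avoid s r v y) := by
  have hM := hN.isMeasurable
  have hmark : ∀ t, Measurable fun a : ℝ × ℝ => p.markTerm s t r v y a.1 a.2 := fun t => by
    have h : Measurable fun a : ℝ × ℝ => (((r, v), y, a) : (ℝ × ℝ) × Plane × ℝ × ℝ) := by fun_prop
    exact (p.measurable_markTerm s t).comp h
  have hterm : ∀ t, ∫⁻ ω, p.markTerm s t r v y (N.marks (.vis j) ω) (N.marks (.gain t j) ω) ∂μ =
      ENNReal.ofReal (p.avoidTerm s t r v y) := by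
    intro t
    have hind : IndepFun (N.marks (.vis j)) (N.marks (.gain t j)) μ :=
      hN.marks_indep.indepFun (by simp)
    rw [lintegral_eq_lintegral_lintegral_of_indepFun (hM.marks _) (hM.marks _) hind (hmark t)]
    set c := v * (p.PA * p.C t * p.slant y ^ (-p.alpha t)) with hc
    have hc0 : 0 ≤ c := mul_nonneg hv (mul_nonneg (mul_nonneg hp.PA_pos.le (hp.C_pos t).le)
      (Real.rpow_nonneg (Params.slant_pos hp y).le _))
    have hgain : ∫⁻ ω, ENNReal.ofReal (Real.exp (-(v * (p.PA * p.C t * p.slant y ^ (-p.alpha t) *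
        max (N.marks (.gain t j) ω) 0)))) ∂μ = ENNReal.ofReal (p.atten t v ‖y‖) := by
      have e1 : ∫⁻ ω, ENNReal.ofReal (Real.exp (-(v * (p.PA * p.C t * p.slant y ^ (-p.alpha t) *
          max (N.marks (.gain t j) ω) 0)))) ∂μ =
          ∫⁻ ω, ENNReal.ofReal (Real.exp (-(c * N.marks (.gain t j) ω))) ∂μ := by
        refine lintegral_congr_ae ?_
        filter_upwards [hN.ae_gain_pos] with ω hω
        have : 0 < N.marks (.gain t j) ω := hω t j
        rw [max_eq_left this.le, hc, mul_assoc v]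
      rw [e1, ← lintegral_map (f := fun y => ENNReal.ofReal (Real.exp (-(c * y)))) (by fun_prop)
        (hM.marks _)]
      have hlaw : μ.map (N.marks (.gain t j)) = gammaMeasure (p.m t) (p.m t) := hN.gain_law t j
      rw [hlaw, lintegral_exp_gammaMeasure (hp.m_pos t) hc0, Params.atten]
      have hs := Params.slant_sq_pos hp ‖y‖
      have hm : (0 : ℝ) < p.m t := by exact_mod_cast hp.m_pos t
      have e2 : c / p.m t =
          v * p.PA * p.C t / (p.m t * (‖y‖ ^ 2 + p.h ^ 2) ^ (p.alpha t / 2)) := by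
        rw [hc, Params.slant, Real.sqrt_eq_rpow, ← Real.rpow_mul hs.le,
          show 1 / 2 * -p.alpha t = -(p.alpha t / 2) by ring, Real.rpow_neg hs.le]
        field_simp
      rw [e2]
    have hind : ∀ ω, (if p.linkState y (N.marks (.vis j) ω) = t then (1 : ℝ≥0∞) else 0) =
        {ω | p.linkState y (N.vis j ω) = t}.indicator 1 ω := fun ω => by
      rw [Set.indicator_apply]
      rfl
    have hset : MeasurableSet {ω | p.linkState y (N.vis j ω) = t} :=
      hM.vis j (p.measurableSet_linkState y t)
    by_cases hthr : p.thr s t r ≤ p.slant y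
    · have h1 : ∀ ω, ∫⁻ ω', p.markTerm s t r v y (N.marks (.vis j) ω) (N.marks (.gain t j) ω') ∂μ =
          {ω | p.linkState y (N.vis j ω) = t}.indicator 1 ω *
            ENNReal.ofReal (p.atten t v ‖y‖) := by
        intro ω
        unfold Params.markTerm
        simp only [if_pos hthr]
        rw [lintegral_const_mul _ (f := fun ω' => ENNReal.ofReal (Real.exp (-(v * (p.PA * p.C t *
          p.slant y ^ (-p.alpha t) * max (N.marks (.gain t j) ω') 0))))), hgain, hind]
        exact ((((((hM.marks _).max measurable_const).const_mul _).const_mul _).neg).exp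
          ).ennreal_ofReal
      simp only [h1]
      rw [lintegral_mul_const _ (measurable_one.indicator hset), lintegral_indicator_one hset,
        hN.measure_linkState hp, ← ENNReal.ofReal_mul (Params.linkProb_pos hp _ _).le,
        Params.avoidTerm, if_pos hthr]
    · have h1 : ∀ u g, p.markTerm s t r v y u g = 0 := fun u g => by
        rw [Params.markTerm, if_neg hthr, ENNReal.ofReal_zero, mul_zero]
      simp [h1, Params.avoidTerm, hthr]
  unfold Params.blockFactor
  rw [lintegral_finsetSum, Params.avoid, ENNReal.ofReal_sum_of_nonneg
    fun t _ => Params.avoidTerm_nonneg hp s t r hv y]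
  · exact Finset.sum_congr rfl fun t _ => hterm t
  · intro t _
    exact (hmark t).comp ((hM.marks (.vis j)).prodMk (hM.marks (.gain t j)))

/-- Integration over the marks for fixed positions. -/
lemma lintegral_infProd_marks (hN : N.IsModel p μ) (hp : p.Admissible) (s : Link) (r : ℝ) {v : ℝ}
    (hv : 0 ≤ v) (x : ℕ → Plane) (i : ℕ) :
    ∫⁻ ω, infProd (fun j => if j = i then
        (if p.linkState (x i) (N.marks (.vis i) ω) = s then 1 else 0)
        else p.blockFactor s r v (x j) (fun k => N.marks k ω) j) ∂μ =
      ENNReal.ofReal (p.linkProb s ‖x i‖) *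
        othersProd (fun y => ENNReal.ofReal (p.avoid s r v y)) x i := by
  have hM := hN.isMeasurable
  -- One block per ABS: its visibility variable and its gains in both states. The blocks are
  -- disjoint, so the expectation of the infinite product factors.
  set S : ℕ → Set MarkIdx := fun j => {k | k = .vis j ∨ ∃ t, k = .gain t j} with hS
  have hdisj : Pairwise (Function.onFun Disjoint S) := by
    intro a b hab
    refine Set.disjoint_left.2 fun k hka hkb => ?_
    rcases hka with rfl | ⟨t, rfl⟩ <;> rcases hkb with h | ⟨t', h⟩ <;> simp_all
  have hvis : ∀ j, Measurable[blockSigma N.marks (S j)] (N.marks (.vis j)) := fun j =>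
    measurable_blockSigma (k := MarkIdx.vis j) (Or.inl rfl)
  have hgain : ∀ j t, Measurable[blockSigma N.marks (S j)] (N.marks (.gain t j)) := fun j t =>
    measurable_blockSigma (k := MarkIdx.gain t j) (Or.inr ⟨t, rfl⟩)
  rw [lintegral_infProd_of_blocks hM.marks hN.marks_indep hdisj
    (Y := fun j ω => if j = i then
        (if p.linkState (x i) (N.marks (.vis i) ω) = s then 1 else 0)
        else p.blockFactor s r v (x j) (fun k => N.marks k ω) j)]
  · rw [othersProd, ← infProd_ite_eq_mul
      (ENNReal.ofReal_le_one.2 (Params.linkProb_le_one hp s _))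
      fun j => ENNReal.ofReal_le_one.2 (Params.avoid_le_one hp s r hv (x j))]
    congr 1
    funext j
    by_cases hj : j = i
    · simp only [if_pos hj]
      have hset : MeasurableSet {ω | p.linkState (x i) (N.vis i ω) = s} :=
        hM.vis i (p.measurableSet_linkState _ s)
      rw [← hN.measure_linkState hp i (x i) s, ← lintegral_indicator_one hset]
      refine lintegral_congr fun ω => ?_
      rw [Set.indicator_apply]
      rfl
    · simp only [if_neg hj]
      exact hN.lintegral_blockFactor hp s r hv (x j) j
  · intro j
    by_cases hj : j = i
    · subst hj
      simp only [if_true]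
      have : Measurable fun u => if p.linkState (x j) u = s then (1 : ℝ≥0∞) else 0 :=
        Measurable.ite (p.measurableSet_linkState _ s) measurable_const measurable_const
      exact this.comp (hvis j)
    · simp only [if_neg hj]
      unfold Params.blockFactor
      refine Finset.measurable_sum _ fun t _ => ?_
      have h : Measurable fun a : ℝ × ℝ => p.markTerm s t r v (x j) a.1 a.2 := by
        have h : Measurable fun a : ℝ × ℝ => (((r, v), x j, a) : (ℝ × ℝ) × Plane × ℝ × ℝ) := by
          fun_prop
        exact (p.measurable_markTerm s t).comp h
      exact h.comp ((hvis j).prodMk (hgain j t))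
  · intro j ω
    split_ifs
    exacts [le_rfl, zero_le, Params.blockFactor_le_one hp s _ hv _ _ _]

end IsModel

end Network

/-! ### From the Mecke formula to the density of the serving distance -/

namespace Params

variable {p : Params}

/-- Density of the serving distance on the event of association with an ABS in state `s`. -/
def servingDensity (p : Params) (s : Link) (r : ℝ) : ℝ :=
  p.nearestPdf s r * p.voidProb s.other (p.tau s r) * p.tbsProb s r

lemma nearestPdf_pos (hp : p.Admissible) (s : Link) {r : ℝ} (hr : 0 < r) :
    0 < p.nearestPdf s r := by
  have := hp.lamA_pos
  have := Real.pi_pos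
  have := linkProb_pos hp s √(r ^ 2 - p.h ^ 2)
  have : 0 < p.voidProb s r := Real.exp_pos _
  unfold nearestPdf
  positivity

lemma laplaceIA_pos (p : Params) (s : Link) (r v : ℝ) : 0 < p.laplaceIA s r v :=
  mul_pos (Real.exp_pos _) (Real.exp_pos _)

lemma servingDensity_pos (hp : p.Admissible) (s : Link) {r : ℝ} (hr : 0 < r) :
    0 < p.servingDensity s r :=
  mul_pos (mul_pos (nearestPdf_pos hp s hr) (Real.exp_pos _)) (tbsProb_pos s r)

end Params

namespace Network

variable {Ω : Type*} [MeasurableSpace Ω] {N : Network Ω} {p : Params} {μ : Measure Ω}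
  [IsProbabilityMeasure μ]

namespace IsModel

/-- Integration over the marks and over the TBSs. -/
lemma lintegral_serves (hN : N.IsModel p μ) (hp : p.Admissible) (s : Link) {w : ℝ → ℝ≥0∞}
    (hw : Measurable w) {v : ℝ → ℝ} (hv : Measurable v) (hv0 : ∀ r, 0 ≤ r → 0 ≤ v r) (i : ℕ) :
    ∫⁻ ω, (N.serves p s i ∩ {ω | p.tbsAdmits s (N.dist p i ω) (N.RT ω)}).indicator
        (fun ω => w (N.dist p i ω) * ENNReal.ofReal
          (Real.exp (-(v (N.dist p i ω) * N.interferenceAt p i ω)))) ω ∂μ =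
      ∫⁻ ω, w (p.slant (N.abs i ω)) * ENNReal.ofReal (p.tbsProb s (p.slant (N.abs i ω))) *
          ENNReal.ofReal (p.linkProb s ‖N.abs i ω‖) *
        othersProd (fun y => ENNReal.ofReal
          (p.avoid s (p.slant (N.abs i ω)) (v (p.slant (N.abs i ω))) y))
          (fun j => N.abs j ω) i ∂μ := by
  have hM := hN.isMeasurable
  have hslant : Measurable fun x : ℕ → Plane => p.slant (x i) := by fun_prop
  set T : Set ((ℕ → Plane) × (ℕ → Plane)) :=
    {a | p.tbsAdmits s (p.slant (a.2 i)) (⨅ j, ‖a.1 j‖)} with hT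
  have hTm : MeasurableSet T := by
    have h : Measurable fun a : (ℕ → Plane) × (ℕ → Plane) =>
        (p.slant (a.2 i), ⨅ j, ‖a.1 j‖) :=
      (hslant.comp measurable_snd).prodMk (Measurable.iInf fun j => by fun_prop)
    exact h (p.measurableSet_tbsAdmits s)
  set K : Conf → ℝ≥0∞ := fun c => infProd fun j => if j = i then
    (if p.linkState (c.1.2 i) (c.2 (.vis i)) = s then 1 else 0)
    else p.blockFactor s (p.slant (c.1.2 i)) (v (p.slant (c.1.2 i))) (c.1.2 j) c.2 j with hK
  have hKm : Measurable K := by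
    refine Measurable.infProd fun j => ?_
    by_cases hj : j = i
    · simp only [if_pos hj]
      have h : Measurable fun c : Conf => p.linkState (c.1.2 i) (c.2 (.vis i)) := by
        unfold Params.linkState
        exact Measurable.ite (measurableSet_le (by fun_prop) (by fun_prop)) measurable_const
          measurable_const
      exact Measurable.ite (h (measurableSet_singleton s)) measurable_const measurable_const
    · simp only [if_neg hj]
      have h : Measurable fun c : Conf => (((p.slant (c.1.2 i), v (p.slant (c.1.2 i))),
          c.1.2 j, c.2) : (ℝ × ℝ) × Plane × (MarkIdx → ℝ)) := by fun_prop
      exact (p.measurable_blockFactor s j).comp h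
  have hwm : Measurable fun a : (ℕ → Plane) × (ℕ → Plane) => w (p.slant (a.2 i)) :=
    hw.comp (hslant.comp measurable_snd)
  have hpts : Measurable fun ω =>
      ((fun i => N.tbs i ω, fun i => N.abs i ω) : (ℕ → Plane) × (ℕ → Plane)) :=
    (measurable_pi_lambda _ hM.tbs).prodMk (measurable_pi_lambda _ hM.abs)
  have h1 : ∫⁻ ω, (N.serves p s i ∩ {ω | p.tbsAdmits s (N.dist p i ω) (N.RT ω)}).indicator
        (fun ω => w (N.dist p i ω) * ENNReal.ofReal
          (Real.exp (-(v (N.dist p i ω) * N.interferenceAt p i ω)))) ω ∂μ =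
      ∫⁻ ω, w (p.slant (N.abs i ω)) * T.indicator 1 (N.conf ω).1 * K (N.conf ω) ∂μ := by
    refine lintegral_congr_ae ?_
    filter_upwards [hN.ae_regular hp] with ω hω
    have hKω : K (N.conf ω) = (N.serves p s i).indicator (fun ω' => ENNReal.ofReal
        (Real.exp (-(v (N.dist p i ω) * N.interferenceAt p i ω')))) ω :=
      (hω.indicator_serves_eq hp s i (hv0 _ (N.dist_pos hp i ω).le)).symm
    rw [hKω]
    by_cases hs : ω ∈ N.serves p s i
    · rw [Set.indicator_of_mem hs]
      by_cases ht : p.tbsAdmits s (N.dist p i ω) (N.RT ω)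
      · rw [Set.indicator_of_mem (show ω ∈ _ ∩ _ from ⟨hs, ht⟩),
          Set.indicator_of_mem (show (N.conf ω).1 ∈ T from ht), Pi.one_apply, mul_one]
        rfl
      · rw [Set.indicator_of_notMem (fun h => ht h.2),
          Set.indicator_of_notMem (show (N.conf ω).1 ∉ T from ht), mul_zero, zero_mul]
    · rw [Set.indicator_of_notMem hs, mul_zero, Set.indicator_of_notMem (fun h => hs h.1)]
  rw [h1]
  -- The marks are integrated out first, with all positions fixed.
  have h2 := lintegral_eq_lintegral_lintegral_of_indepFun hpts (measurable_pi_lambda _ hM.marks)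
    hN.points_marks_indep (F := fun c : Conf => w (p.slant (c.1.2 i)) * T.indicator 1 c.1 * K c)
    (((hwm.comp measurable_fst).mul ((measurable_one.indicator hTm).comp measurable_fst)).mul hKm)
  refine h2.trans ?_
  set H : (ℕ → Plane) → ℝ≥0∞ := fun x => ENNReal.ofReal (p.linkProb s ‖x i‖) *
    othersProd (fun y => ENNReal.ofReal (p.avoid s (p.slant (x i)) (v (p.slant (x i))) y)) x i
    with hH
  have hHm : Measurable H := by
    refine Measurable.mul (by fun_prop) (Measurable.othersProd (α := ℕ → Plane)
      (g := fun x y => ENNReal.ofReal (p.avoid s (p.slant (x i)) (v (p.slant (x i))) y))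
      (X := fun j x => x j) ?_ (fun j => measurable_pi_apply j) i)
    have h : Measurable fun a : (ℕ → Plane) × Plane => (p.slant (a.1 i), a.2) := by fun_prop
    exact ((p.measurable_avoid_comp s hv).comp h).ennreal_ofReal
  have h3 : ∀ ω, ∫⁻ ω', w (p.slant (N.abs i ω)) *
      T.indicator 1 (fun i => N.tbs i ω, fun i => N.abs i ω) *
      K ((fun i => N.tbs i ω, fun i => N.abs i ω), fun k => N.marks k ω') ∂μ =
      w (p.slant (N.abs i ω)) * H (fun j => N.abs j ω) *
        T.indicator 1 (fun i => N.tbs i ω, fun i => N.abs i ω) := by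
    intro ω
    have hKω : Measurable fun ω' =>
        K ((fun i => N.tbs i ω, fun i => N.abs i ω), fun k => N.marks k ω') :=
      hKm.comp (measurable_const.prodMk (measurable_pi_lambda _ hM.marks))
    rw [lintegral_const_mul _ hKω, hK]
    dsimp only
    rw [hN.lintegral_infProd_marks hp s (p.slant (N.abs i ω))
      (hv0 _ (Params.slant_pos hp _).le) (fun j => N.abs j ω) i]
    exact mul_right_comm _ _ _
  refine (lintegral_congr h3).trans ?_
  -- The TBSs now enter only through the nearest distance, and are integrated out with the ABS
  -- positions fixed.
  have h4 := lintegral_eq_lintegral_lintegral_of_indepFun (measurable_pi_lambda _ hM.abs)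
    (measurable_pi_lambda _ hM.tbs) hN.tbs_abs_indep.symm
    (F := fun a : (ℕ → Plane) × (ℕ → Plane) => w (p.slant (a.1 i)) * H a.1 *
      T.indicator 1 (a.2, a.1))
    (((hw.comp (hslant.comp measurable_fst)).mul (hHm.comp measurable_fst)).mul
      ((measurable_one.indicator hTm).comp (measurable_snd.prodMk measurable_fst)))
  refine h4.trans (lintegral_congr fun ω => ?_)
  have hset : MeasurableSet {ω' | p.tbsAdmits s (p.slant (N.abs i ω)) (N.RT ω')} :=
    (measurable_const.prodMk hM.RT) (p.measurableSet_tbsAdmits s)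
  have h5 : ∀ ω', T.indicator (1 : (ℕ → Plane) × (ℕ → Plane) → ℝ≥0∞)
      (fun j => N.tbs j ω', fun j => N.abs j ω) =
      {ω' | p.tbsAdmits s (p.slant (N.abs i ω)) (N.RT ω')}.indicator 1 ω' := fun ω' => rfl
  simp only [h5]
  rw [lintegral_const_mul _ (measurable_one.indicator hset), lintegral_indicator_one hset,
    hN.measure_tbsAdmits hp s (Params.slant_pos hp _).le, hH]
  dsimp only
  ring

/-- The joint law of the serving distance and of the interference, on the event of association
with an ABS in state `s`. -/
theorem setLIntegral_laplace (hN : N.IsModel p μ) (hp : p.Admissible) (s : Link) {w : ℝ → ℝ≥0∞}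
    (hw : Measurable w) {v : ℝ → ℝ} (hv : Continuous v) (hv0 : ∀ r, 0 ≤ r → 0 ≤ v r)
    (hvm : ∀ r r', 0 ≤ r → r ≤ r' → v r ≤ v r') :
    ∫⁻ ω in N.assoc p s, w (N.R p s ω) * ENNReal.ofReal
        (Real.exp (-(v (N.R p s ω) * N.interference p s ω))) ∂μ =
      ∫⁻ r in Ioi p.h, w r * ENNReal.ofReal (p.servingDensity s r * p.laplaceIA s r (v r)) := by
  have hM := hN.isMeasurable
  set ν : Measure Plane := ENNReal.ofReal p.lamA • volume with hν
  set M : ℝ → ℝ≥0∞ := fun r => negExp (∫⁻ y, (1 - ENNReal.ofReal (p.avoid s r (v r) y)) ∂ν) with hMdef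
  have hMm : Measurable M := by
    refine continuous_negExp.measurable.comp (Measurable.lintegral_prod_right' (ν := ν)
      (f := fun z : ℝ × Plane => 1 - ENNReal.ofReal (p.avoid s z.1 (v z.1) z.2)) ?_)
    exact measurable_const.sub (p.measurable_avoid_comp s hv.measurable).ennreal_ofReal
  set f : Plane → ℝ≥0∞ := fun y => w (p.slant y) * ENNReal.ofReal (p.tbsProb s (p.slant y)) *
    ENNReal.ofReal (p.linkProb s ‖y‖) with hf
  have hfm : Measurable f := by fun_prop
  have hq : ∀ y, (((p.slant y).toNNReal : ℝ≥0) : ℝ) = p.slant y := fun y =>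
    Real.coe_toNNReal _ (Params.slant_pos hp y).le
  -- The numerical parameter of the distinguished ABS is its slant distance. The Laplace argument
  -- varies with it, and its monotonicity `hvm` keeps the functional decreasing.
  have hmecke := hN.abs_poisson.mecke_antitone hfm (q := fun y => (p.slant y).toNNReal)
    (by fun_prop) (G := fun r y => ENNReal.ofReal (p.avoid s r (v r) y))
    (fun r => (p.measurable_avoid s r (v r)).ennreal_ofReal)
    (fun r y => ENNReal.ofReal_le_one.2 (Params.avoid_le_one hp s r (hv0 r r.2) y))
    (fun y r r' h => ENNReal.ofReal_le_ofReal (Params.avoid_anti hp s r.2 (by exact_mod_cast h)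
      (hv0 r r.2) (hvm r r' r.2 (by exact_mod_cast h)) y))
    (fun y r => ENNReal.continuous_ofReal.continuousAt.comp_continuousWithinAt
      (Params.continuousWithinAt_avoid hp s hv hv0 y r))
  simp only [hq] at hmecke
  rw [← hν] at hmecke
  have h1 := hN.setLIntegral_assoc hp s (Φ := fun i ω => w (N.dist p i ω) * ENNReal.ofReal
    (Real.exp (-(v (N.dist p i ω) * N.interferenceAt p i ω)))) fun i =>
      (hw.comp (hM.dist p i)).mul (((hv.measurable.comp (hM.dist p i)).mul
        (hM.interferenceAt p i)).neg.exp).ennreal_ofReal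
  refine h1.trans ((tsum_congr fun i =>
    hN.lintegral_serves hp s hw hv.measurable hv0 i).trans (hmecke.trans ?_))
  set F : ℝ → ℝ≥0∞ := fun r => w r * ENNReal.ofReal (p.tbsProb s r) *
    ENNReal.ofReal (p.linkProb s √(r ^ 2 - p.h ^ 2)) * M r with hF
  have hFm : Measurable F := by fun_prop
  have h2 : ∀ y, f y * negExp (∫⁻ y', (1 - ENNReal.ofReal
      (p.avoid s (p.slant y) (v (p.slant y)) y')) ∂ν) = F √(‖y‖ ^ 2 + p.h ^ 2) := by
    intro y
    change _ = F (p.slant y)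
    rw [hF]
    dsimp only
    rw [Params.sqrt_slant]
  simp only [h2]
  rw [hν, lintegral_smul_measure, lintegral_slant hp.h_pos hFm, smul_eq_mul,
    ← lintegral_const_mul _ (by fun_prop)]
  refine setLIntegral_congr_fun measurableSet_Ioi fun r hr => ?_
  have hr' : p.h < r := hr
  have hr0 : 0 < r := hp.h_pos.trans hr'
  have hMr : M r = ENNReal.ofReal (p.voidProb s r * p.voidProb s.other (p.tau s r) *
      p.laplaceIA s r (v r)) := Params.negExp_lintegral_avoid hp s hr'.le (hv0 r hr0.le)
  have e1 := p.tbsProb_pos (s := s) (r := r)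
  have e2 := Params.linkProb_pos hp s √(r ^ 2 - p.h ^ 2)
  have e3 : 0 < p.voidProb s r := Real.exp_pos _
  have e4 : 0 < p.voidProb s.other (p.tau s r) := Real.exp_pos _
  have e5 := p.laplaceIA_pos s r (v r)
  have e6 := hp.lamA_pos
  have e7 := Real.pi_pos
  have e8 : p.servingDensity s r * p.laplaceIA s r (v r) = p.lamA * ((2 * Real.pi * r) *
      (p.tbsProb s r * p.linkProb s √(r ^ 2 - p.h ^ 2) * (p.voidProb s r *
        p.voidProb s.other (p.tau s r) * p.laplaceIA s r (v r)))) := by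
    rw [Params.servingDensity, Params.nearestPdf]
    ring
  rw [hF]
  dsimp only
  rw [hMr, e8, ENNReal.ofReal_mul e6.le, ENNReal.ofReal_mul (p := 2 * Real.pi * r) (by positivity),
    ENNReal.ofReal_mul (p := p.tbsProb s r * p.linkProb s √(r ^ 2 - p.h ^ 2)) (by positivity),
    ENNReal.ofReal_mul e1.le]
  ring

end IsModel

end Network

/-! ### The analytic form of Alzer's approximation -/

lemma mul_rpow_neg_le_iff {a b α α' r x : ℝ} (ha : 0 < a) (hb : 0 < b) (hα : 0 < α) (hr : 0 < r)
    (hx : 0 < x) :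
    a * x ^ (-α) ≤ b * r ^ (-α') ↔ (a / b) ^ (1 / α) * r ^ (α' / α) ≤ x := by
  have hr' : 0 < r ^ α' := Real.rpow_pos_of_pos hr _
  have hx' : 0 < x ^ α := Real.rpow_pos_of_pos hx _
  have h1 : (a / b) ^ (1 / α) * r ^ (α' / α) = (a / b * r ^ α') ^ α⁻¹ := by
    rw [Real.mul_rpow (by positivity) hr'.le, ← Real.rpow_mul hr.le, one_div, div_eq_mul_inv α']
  rw [h1, Real.rpow_inv_le_iff_of_pos (by positivity) hx.le hα, Real.rpow_neg hx.le,
    Real.rpow_neg hr.le, ← div_eq_mul_inv, ← div_eq_mul_inv, div_le_div_iff₀ hx' hr',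
    div_mul_eq_mul_div, div_le_iff₀ hb, mul_comm b]

namespace Params

variable {p : Params}

/-- Both conditions compare the power of a LoS ABS at distance `r` with that of a TBS at distance
`RB`, solved once for the ABS distance and once for the TBS distance. -/
lemma le_lLT_iff (hp : p.Admissible) {r : ℝ} (hr : 0 < r) : r ≤ p.lLT ↔ p.tauT r ≤ p.RB := by
  rw [lLT, tauT, ← not_lt, ← mul_rpow_neg_lt_iff (eta_pos hp _) (etaT_pos hp) (alpha_pos hp _)
    hp.RB_pos hr, ← mul_rpow_neg_le_iff (etaT_pos hp) (eta_pos hp _) hp.alphaT_pos hr hp.RB_pos,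
    not_lt]

lemma continuous_voidProb (hp : p.Admissible) (s : Link) : Continuous (p.voidProb s) := by
  have h : Continuous fun b => ∫ x in (0 : ℝ)..b, x * p.linkProb s x := by
    refine intervalIntegral.continuous_primitive (fun a b => ?_) 0
    refine intervalIntegrable_iff.2 ?_
    refine Measure.integrableOn_of_bounded (M := max |a| |b|) (by simp) (by fun_prop) ?_
    filter_upwards [ae_restrict_mem measurableSet_uIoc] with x hx
    have h1 : |x| ≤ max |a| |b| := by
      have := Set.uIoc_subset_uIcc hx
      rw [Set.mem_uIcc] at this
      rcases this with h | h
      · exact abs_le_max_abs_abs h.1 h.2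
      · exact (abs_le_max_abs_abs h.1 h.2).trans_eq (max_comm _ _)
    rw [Real.norm_eq_abs, abs_mul, abs_of_pos (linkProb_pos hp s x)]
    exact (mul_le_of_le_one_right (abs_nonneg _) (linkProb_le_one hp s x)).trans h1
  unfold voidProb
  fun_prop

lemma voidProb_pos (s : Link) (r : ℝ) : 0 < p.voidProb s r := Real.exp_pos _

lemma measurable_nearestPdf (hp : p.Admissible) (s : Link) : Measurable (p.nearestPdf s) := by
  have := (continuous_voidProb hp s).measurable
  unfold nearestPdf
  fun_prop

lemma measurable_servingDensity (hp : p.Admissible) (s : Link) :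
    Measurable (p.servingDensity s) :=
  ((measurable_nearestPdf hp s).mul ((continuous_voidProb hp s.other).measurable.comp
    (p.measurable_tau s))).mul (p.measurable_tbsProb s)

lemma measurable_servingPdf (hp : p.Admissible) (A : ℝ) (s : Link) (i : Fin 2) :
    Measurable (p.servingPdf A s i) := by
  have h1 := measurable_nearestPdf hp
  have h2 : ∀ s, Measurable fun r => p.voidProb s.other (p.tau s r) := fun s =>
    (continuous_voidProb hp s.other).measurable.comp (p.measurable_tau s)
  have h3 := p.measurable_tauT
  fin_cases i
  · exact (((h1 s).div_const A).mul (h2 s)).mul_const _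
  · cases s
    · exact Measurable.ite measurableSet_Iic ((((h1 _).div_const A).mul
        (((h3.pow_const 2).const_mul _).neg.exp.sub_const _)).mul (h2 _)) measurable_const
    · exact measurable_const

/-- While `tauT r ≤ RB`, the factor `1 - QT` cancels between the two parts and leaves the
probability of no TBS within `tauT r`. Beyond `lLT` the minimum in `tbsProb` is `RB`, and only the
first part survives. -/
lemma servingPdf_add (hp : p.Admissible) (A : ℝ) (s : Link) {r : ℝ} (hr : 0 < r) :
    p.servingPdf A s 0 r + p.servingPdf A s 1 r = p.servingDensity s r / A := by
  have hQ : 1 - p.QT = Real.exp (-(Real.pi * p.lamT * p.RB ^ 2)) := sub_sub_cancel _ _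
  cases s
  · change _ + (if r ≤ p.lLT then _ else _) = _
    rw [servingPdf, servingDensity, tbsProb]
    split_ifs with h
    · rw [min_eq_right ((le_lLT_iff hp hr).1 h)]
      change _ + _ * p.voidProb Link.los.other (p.tau .los r) = _
      ring
    · rw [min_eq_left (not_le.1 (mt (le_lLT_iff hp hr).2 h)).le, hQ]
      ring
  · change _ + 0 = _
    rw [servingPdf, servingDensity, tbsProb, hQ]
    ring

lemma servingPdf_nonneg (hp : p.Admissible) {A : ℝ} (hA : 0 ≤ A) (s : Link) (i : Fin 2) {r : ℝ}
    (hr : 0 < r) : 0 ≤ p.servingPdf A s i r := by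
  have h1 : ∀ s, 0 ≤ p.nearestPdf s r / A := fun s => div_nonneg (nearestPdf_pos hp s hr).le hA
  have hQ : 1 - p.QT = Real.exp (-(Real.pi * p.lamT * p.RB ^ 2)) := sub_sub_cancel _ _
  fin_cases i
  · change 0 ≤ _ * _ * (1 - p.QT)
    rw [hQ]
    exact mul_nonneg (mul_nonneg (h1 s) (voidProb_pos _ _).le) (Real.exp_pos _).le
  · cases s
    · change 0 ≤ if r ≤ p.lLT then _ else _
      split_ifs with h
      · refine mul_nonneg (mul_nonneg (h1 _) ?_) (voidProb_pos _ _).le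
        rw [hQ, sub_nonneg]
        have h2 := (le_lLT_iff hp hr).1 h
        have h3 := tauT_nonneg hp hr.le
        have h4 := hp.lamT_pos
        have h5 := Real.pi_pos
        gcongr
      · exact le_rfl
    · exact le_rfl

lemma measurable_laplaceIA (p : Params) (s : Link) {v : ℝ → ℝ} (hv : Measurable v) :
    Measurable fun r => p.laplaceIA s r (v r) := by
  have h1 : ∀ t, Measurable (p.wLow s t) := fun t => by
    unfold wLow
    split_ifs <;> fun_prop
  have h2 : ∀ t, Measurable fun r => p.laplacePart s t r (v r) := by
    intro t
    -- The variable domain of integration is moved into an indicator, so that measurability of a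
    -- parametric integral over a product applies.
    have h3 : StronglyMeasurable fun r => ∫ x, (Ioi (p.wLow s t r)).indicator
        (fun x => (1 - p.atten t (v r) x) * p.linkProb t x * x) x := by
      refine StronglyMeasurable.integral_prod_right' (f := fun z : ℝ × ℝ =>
        (Ioi (p.wLow s t z.1)).indicator
          (fun x => (1 - p.atten t (v z.1) x) * p.linkProb t x * x) z.2) ?_
      refine Measurable.stronglyMeasurable ?_
      have e : (fun z : ℝ × ℝ => (Ioi (p.wLow s t z.1)).indicator
          (fun x => (1 - p.atten t (v z.1) x) * p.linkProb t x * x) z.2) =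
          {z : ℝ × ℝ | p.wLow s t z.1 < z.2}.indicator
            (fun z => (1 - p.atten t (v z.1) z.2) * p.linkProb t z.2 * z.2) := rfl
      rw [e]
      refine Measurable.indicator ?_ (measurableSet_lt ((h1 t).comp measurable_fst) measurable_snd)
      unfold atten
      fun_prop
    have h4 : Measurable fun r => Real.exp (-(2 * Real.pi * p.lamA *
        ∫ x, (Ioi (p.wLow s t r)).indicator
          (fun x => (1 - p.atten t (v r) x) * p.linkProb t x * x) x)) :=
      ((h3.measurable.const_mul _).neg).exp
    simp only [integral_indicator measurableSet_Ioi] at h4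
    exact h4
  exact (h2 .los).mul (h2 .nlos)

lemma laplaceIA_le_one (hp : p.Admissible) (s : Link) (r : ℝ) {v : ℝ} (hv : 0 ≤ v) :
    p.laplaceIA s r v ≤ 1 := by
  have h : ∀ t, p.laplacePart s t r v ≤ 1 := by
    intro t
    refine Real.exp_le_one_iff.2 (neg_nonpos.2 (mul_nonneg (mul_nonneg
      (mul_nonneg zero_le_two Real.pi_pos.le) hp.lamA_pos.le)
      (setIntegral_nonneg measurableSet_Ioi fun x hx => ?_)))
    exact mul_nonneg (mul_nonneg (sub_nonneg.2 (atten_le_one hp t hv x)) (linkProb_pos hp t x).le)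
      ((wLow_nonneg s t r).trans (le_of_lt hx))
  exact mul_le_one₀ (h _) (Real.exp_pos _).le (h _)

lemma laplaceIA_zero (p : Params) (s : Link) (r : ℝ) : p.laplaceIA s r 0 = 1 := by
  simp [laplaceIA, laplacePart]

lemma caseRange_eq (hp : p.Admissible) (c : Position) :
    p.caseRange c = Ioi p.h ∩ p.caseSet c := by
  cases c
  · rfl
  · exact (Set.inter_eq_right.2 (Ioi_subset_Ioi hp.h_le_Rf)).symm

lemma measurableSet_caseRange (hp : p.Admissible) (c : Position) :
    MeasurableSet (p.caseRange c) := by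
  rw [caseRange_eq hp]
  exact measurableSet_Ioi.inter (p.measurableSet_caseSet c)

lemma pos_of_mem_caseRange (hp : p.Admissible) {c : Position} {r : ℝ} (hr : r ∈ p.caseRange c) :
    0 < r := by
  rw [caseRange_eq hp] at hr
  exact hp.h_pos.trans hr.1

lemma distAt_nonneg (hp : p.Admissible) (u : User) {r : ℝ} (hr : 0 ≤ r) : 0 ≤ p.distAt u r := by
  cases u
  · exact hr
  · exact hp.h_pos.le.trans hp.h_le_Rf

lemma distAt_mono (u : User) {r r' : ℝ} (h : r ≤ r') : p.distAt u r ≤ p.distAt u r' := by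
  cases u
  · exact h
  · exact le_rfl

lemma continuous_distAt (p : Params) (u : User) : Continuous (p.distAt u) := by
  cases u
  · exact continuous_id
  · exact continuous_const

/-- One summand of `bracket`, without its combinatorial coefficient. -/
def laplaceTerm (p : Params) (u : User) (s : Link) (κ r : ℝ) : ℝ :=
  Real.exp (-(κ * p.distAt u r ^ p.alpha s * p.sigma2)) *
    p.laplaceIA s r (κ * p.distAt u r ^ p.alpha s)

lemma laplaceTerm_nonneg (u : User) (s : Link) (κ r : ℝ) : 0 ≤ p.laplaceTerm u s κ r :=
  (mul_pos (Real.exp_pos _) (p.laplaceIA_pos _ _ _)).le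

lemma laplaceTerm_le_one (hp : p.Admissible) (u : User) (s : Link) {κ r : ℝ} (hκ : 0 ≤ κ)
    (hr : 0 ≤ r) : p.laplaceTerm u s κ r ≤ 1 := by
  have h : 0 ≤ κ * p.distAt u r ^ p.alpha s :=
    mul_nonneg hκ (Real.rpow_nonneg (distAt_nonneg hp u hr) _)
  exact mul_le_one₀ (Real.exp_le_one_iff.2 (neg_nonpos.2 (mul_nonneg h hp.sigma2_nonneg)))
    (p.laplaceIA_pos _ _ _).le (laplaceIA_le_one hp s r h)

lemma measurable_laplaceTerm (p : Params) (u : User) (s : Link) (κ : ℝ) :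
    Measurable (p.laplaceTerm u s κ) := by
  have h := p.measurable_distAt u
  unfold laplaceTerm
  exact (by fun_prop : Measurable fun r => Real.exp (-(κ * p.distAt u r ^ p.alpha s * p.sigma2))).mul
    (p.measurable_laplaceIA s (by fun_prop))

/-- The coefficient of the threshold in the `k`-th summand of `bracket`. -/
def bracketCoeff (p : Params) (s : Link) (y : ℝ) (k : ℕ) : ℝ :=
  y * (k * alzerConst (p.m s)) / (p.PA * p.C s)

lemma bracketCoeff_nonneg (hp : p.Admissible) (s : Link) {y : ℝ} (hy : 0 ≤ y) (k : ℕ) :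
    0 ≤ p.bracketCoeff s y k :=
  div_nonneg (mul_nonneg hy (mul_nonneg k.cast_nonneg (alzerConst_pos (hp.m_pos s)).le))
    (mul_pos hp.PA_pos (hp.C_pos s)).le

lemma bracket_eq (u : User) (s : Link) (y r : ℝ) :
    p.bracket s y (p.distAt u r) r = ∑ k ∈ Finset.Icc 1 (p.m s),
      (-1 : ℝ) ^ (k + 1) * ((p.m s).choose k : ℝ) * p.laplaceTerm u s (p.bracketCoeff s y k) r := by
  refine Finset.sum_congr rfl fun k _ => ?_
  have e1 : y * (k * alzerConst (p.m s) * p.distAt u r ^ p.alpha s * p.sigma2 / (p.PA * p.C s)) =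
      p.bracketCoeff s y k * p.distAt u r ^ p.alpha s * p.sigma2 := by
    rw [bracketCoeff]
    ring
  have e2 : y * (k * alzerConst (p.m s) * p.distAt u r ^ p.alpha s / (p.PA * p.C s)) =
      p.bracketCoeff s y k * p.distAt u r ^ p.alpha s := by
    rw [bracketCoeff]
    ring
  rw [e1, e2, laplaceTerm, mul_assoc]

end Params

namespace Network

variable {Ω : Type*} [MeasurableSpace Ω] {N : Network Ω} {p : Params} {μ : Measure Ω}
  [IsProbabilityMeasure μ]

omit [MeasurableSpace Ω] in
lemma userDist_eq (u : User) (s : Link) (ω : Ω) :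
    N.userDist p u s ω = p.distAt u (N.R p s ω) := by
  cases u <;> rfl

namespace IsModel

/-- The joint law with trivial weight and Laplace argument zero. -/
lemma lintegral_servingDensity (hN : N.IsModel p μ) (hp : p.Admissible) (s : Link) :
    ∫⁻ r in Ioi p.h, ENNReal.ofReal (p.servingDensity s r) = μ (N.assoc p s) := by
  have h := hN.setLIntegral_laplace hp s (w := fun _ => 1) measurable_const (v := fun _ => 0)
    continuous_const (fun _ _ => le_rfl) (fun _ _ _ _ => le_rfl)
  simpa [Params.laplaceIA_zero] using h.symm

/-- The density of the serving distance is strictly positive on all of `(h, ∞)`. -/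
lemma measure_assoc_pos (hN : N.IsModel p μ) (hp : p.Admissible) (s : Link) :
    0 < μ (N.assoc p s) := by
  rw [← hN.lintegral_servingDensity hp s, setLIntegral_pos_iff
    (Params.measurable_servingDensity hp s).ennreal_ofReal]
  have h : Ioi p.h ⊆ Function.support fun r => ENNReal.ofReal (p.servingDensity s r) := by
    intro r hr
    exact (ENNReal.ofReal_pos.2 (Params.servingDensity_pos hp s (hp.h_pos.trans hr))).ne'
  rw [Set.inter_eq_right.2 h]
  simp

lemma A_pos (hN : N.IsModel p μ) (hp : p.Admissible) (s : Link) : 0 < N.A p μ s :=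
  ENNReal.toReal_pos (hN.measure_assoc_pos hp s).ne' (measure_ne_top _ _)

lemma integrableOn_servingDensity (hN : N.IsModel p μ) (hp : p.Admissible) (s : Link) :
    IntegrableOn (p.servingDensity s) (Ioi p.h) := by
  refine ⟨(Params.measurable_servingDensity hp s).aestronglyMeasurable, ?_⟩
  rw [hasFiniteIntegral_iff_ofReal]
  · rw [hN.lintegral_servingDensity hp s]
    exact measure_lt_top _ _
  · filter_upwards [ae_restrict_mem measurableSet_Ioi] with r hr
    exact (Params.servingDensity_pos hp s (hp.h_pos.trans hr)).le

lemma integrableOn_servingPdf (hN : N.IsModel p μ) (hp : p.Admissible) {A : ℝ} (hA : 0 ≤ A)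
    (s : Link) (i : Fin 2) : IntegrableOn (p.servingPdf A s i) (Ioi p.h) := by
  refine Integrable.mono' ((hN.integrableOn_servingDensity hp s).div_const A)
    (Params.measurable_servingPdf hp A s i).aestronglyMeasurable ?_
  filter_upwards [ae_restrict_mem measurableSet_Ioi] with r hr
  have hr0 : 0 < r := hp.h_pos.trans hr
  have h := fun i => Params.servingPdf_nonneg hp hA s i hr0
  rw [Real.norm_of_nonneg (h i), ← Params.servingPdf_add hp A s hr0]
  fin_cases i
  · exact le_add_of_nonneg_right (h 1)
  · exact le_add_of_nonneg_left (h 0)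

/-- Laplace transform of noise and interference at a multiple of the path loss of UE `u`. -/
lemma setIntegral_exp (hN : N.IsModel p μ) (hp : p.Admissible) (c : Position) (u : User)
    (s : Link) {κ : ℝ} (hκ : 0 ≤ κ) :
    ∫ ω in N.assoc p s, (N.caseEvent p c s).indicator (fun ω => Real.exp
        (-(κ * N.userDist p u s ω ^ p.alpha s * (N.interference p s ω + p.sigma2)))) ω ∂μ =
      ∫ r in p.caseRange c, p.laplaceTerm u s κ r * p.servingDensity s r := by
  have hM := hN.isMeasurable
  have hα := (Params.alpha_pos hp s).le
  set v : ℝ → ℝ := fun r => κ * p.distAt u r ^ p.alpha s with hv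
  have hvc : Continuous v :=
    continuous_const.mul ((p.continuous_distAt u).rpow_const fun _ => Or.inr hα)
  have hv0 : ∀ r, 0 ≤ r → 0 ≤ v r := fun r hr =>
    mul_nonneg hκ (Real.rpow_nonneg (Params.distAt_nonneg hp u hr) _)
  have hvm : ∀ r r', 0 ≤ r → r ≤ r' → v r ≤ v r' := fun r r' hr h =>
    mul_le_mul_of_nonneg_left (Real.rpow_le_rpow (Params.distAt_nonneg hp u hr)
      (Params.distAt_mono u h) hα) hκ
  -- Noise and case depend on the serving distance alone and go into the weight; the interference is
  -- handled by the Laplace argument `v`.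
  have hw : Measurable ((p.caseSet c).indicator
      fun r => ENNReal.ofReal (Real.exp (-(v r * p.sigma2)))) :=
    Measurable.indicator (by fun_prop) (p.measurableSet_caseSet c)
  have key := hN.setLIntegral_laplace hp s hw hvc hv0 hvm
  have hm : Measurable ((N.caseEvent p c s).indicator (fun ω => Real.exp
      (-(κ * N.userDist p u s ω ^ p.alpha s * (N.interference p s ω + p.sigma2))))) :=
    (((((hM.userDist p u s).pow_const _).const_mul _).mul
      ((hM.interference p s).add_const _)).neg.exp).indicator (hM.caseEvent p c s)
  have hmT : Measurable fun r => p.laplaceTerm u s κ r * p.servingDensity s r :=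
    (p.measurable_laplaceTerm u s κ).mul (Params.measurable_servingDensity hp s)
  rw [integral_eq_lintegral_of_nonneg_ae
    (Eventually.of_forall fun ω => Set.indicator_nonneg (fun _ _ => (Real.exp_pos _).le) ω)
    hm.aestronglyMeasurable, integral_eq_lintegral_of_nonneg_ae _ hmT.aestronglyMeasurable]
  · congr 1
    refine Eq.trans (lintegral_congr fun ω => ?_) (key.trans ?_)
    · by_cases hc : ω ∈ N.caseEvent p c s
      · rw [Set.indicator_of_mem hc, Set.indicator_of_mem ((mem_caseEvent_iff c s ω).1 hc),
          ← ENNReal.ofReal_mul (Real.exp_pos _).le, ← Real.exp_add, userDist_eq, hv]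
        ring_nf
      · rw [Set.indicator_of_notMem hc,
          Set.indicator_of_notMem (fun h => hc ((mem_caseEvent_iff c s ω).2 h)), zero_mul,
          ENNReal.ofReal_zero]
    · rw [Params.caseRange_eq hp, Set.inter_comm, ← setLIntegral_indicator
        (p.measurableSet_caseSet c)]
      refine setLIntegral_congr_fun measurableSet_Ioi fun r hr => ?_
      by_cases hc : r ∈ p.caseSet c
      · rw [Set.indicator_of_mem hc, Set.indicator_of_mem hc,
          ← ENNReal.ofReal_mul (Real.exp_pos _).le, Params.laplaceTerm, hv]
        ring_nf
      · rw [Set.indicator_of_notMem hc, Set.indicator_of_notMem hc, zero_mul]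
  · filter_upwards [ae_restrict_mem (Params.measurableSet_caseRange hp c)] with r hr
    exact mul_nonneg (Params.laplaceTerm_nonneg _ _ _ _)
      (Params.servingDensity_pos hp s (Params.pos_of_mem_caseRange hp hr)).le

omit [IsProbabilityMeasure μ] in
lemma integral_cond (A : Set Ω) (f : Ω → ℝ) :
    ∫ ω, f ω ∂(ProbabilityTheory.cond μ A) = (μ.real A)⁻¹ * ∫ ω in A, f ω ∂μ := by
  rw [ProbabilityTheory.cond, integral_smul_measure, smul_eq_mul, ENNReal.toReal_inv]
  rfl

/-- Alzer's approximation yields the analytic expression. -/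
lemma integral_alzerTail_eq (hN : N.IsModel p μ) (hp : p.Admissible) {c : Position} {u : User}
    (s : Link) {z : ℝ} (hz0 : 0 ≤ z) (hz : z < p.zMax c u) :
    ∫ ω, (N.caseEvent p c s).indicator
        (fun ω => alzerTail (p.m s) (N.gainThreshold p c u s z ω)) ω
        ∂(ProbabilityTheory.cond μ (N.assoc p s)) =
      p.ccdfApprox (N.A p μ s) c u s z := by
  have hM := hN.isMeasurable
  have hA := hN.A_pos hp s
  set y := p.f c u z with hy
  have hy0 : 0 ≤ y := Params.f_nonneg hp hz0 hz
  have hκ := fun k => Params.bracketCoeff_nonneg hp s hy0 k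
  have hsub : p.caseRange c ⊆ Ioi p.h := by
    rw [Params.caseRange_eq hp]
    exact Set.inter_subset_left
  have hbdd : ∀ {g : ℝ → ℝ}, IntegrableOn g (Ioi p.h) → ∀ k, IntegrableOn
      (fun r => p.laplaceTerm u s (p.bracketCoeff s y k) r * g r) (p.caseRange c) := by
    intro g hg k
    refine Integrable.bdd_mul (c := 1) (hg.mono_set hsub)
      (p.measurable_laplaceTerm u s _).aestronglyMeasurable ?_
    filter_upwards [ae_restrict_mem (Params.measurableSet_caseRange hp c)] with r hr
    rw [Real.norm_of_nonneg (Params.laplaceTerm_nonneg _ _ _ _)]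
    exact Params.laplaceTerm_le_one hp u s (hκ k) (Params.pos_of_mem_caseRange hp hr).le
  have hbr : ∀ {g : ℝ → ℝ}, IntegrableOn g (Ioi p.h) →
      IntegrableOn (fun r => p.bracket s y (p.distAt u r) r * g r) (p.caseRange c) := by
    intro g hg
    simp only [Params.bracket_eq, Finset.sum_mul, mul_assoc]
    exact integrable_finsetSum _ fun k _ => ((hbdd hg k).const_mul _).const_mul _
  -- The expansion is linear, and the threshold is linear in interference plus noise, so every term
  -- is an instance of `setIntegral_exp`.
  have hind : ∀ ω, (N.caseEvent p c s).indicator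
      (fun ω => alzerTail (p.m s) (N.gainThreshold p c u s z ω)) ω =
      ∑ k ∈ Finset.Icc 1 (p.m s), (-1 : ℝ) ^ (k + 1) * ((p.m s).choose k : ℝ) *
        (N.caseEvent p c s).indicator (fun ω => Real.exp (-(p.bracketCoeff s y k *
          N.userDist p u s ω ^ p.alpha s * (N.interference p s ω + p.sigma2)))) ω := by
    intro ω
    by_cases hc : ω ∈ N.caseEvent p c s
    · simp only [Set.indicator_of_mem hc]
      rw [alzerTail_eq_sum]
      refine Finset.sum_congr rfl fun k _ => ?_
      congr 3
      rw [gainThreshold, Params.bracketCoeff, ← hy]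
      ring
    · simp only [Set.indicator_of_notMem hc, mul_zero, Finset.sum_const_zero]
  have hint : ∀ k, IntegrableOn ((N.caseEvent p c s).indicator (fun ω => Real.exp
      (-(p.bracketCoeff s y k * N.userDist p u s ω ^ p.alpha s *
        (N.interference p s ω + p.sigma2))))) (N.assoc p s) μ := by
    intro k
    refine Integrable.of_bound ((((((hM.userDist p u s).pow_const _).const_mul _).mul
      ((hM.interference p s).add_const _)).neg.exp).indicator
        (hM.caseEvent p c s)).aestronglyMeasurable 1 (ae_restrict_of_ae ?_)
    filter_upwards [hN.ae_regular hp] with ω hω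
    refine (norm_indicator_le_norm_self _ _).trans ?_
    rw [Real.norm_of_nonneg (Real.exp_pos _).le]
    exact Real.exp_le_one_iff.2 (neg_nonpos.2 (mul_nonneg (mul_nonneg (hκ k)
      (Real.rpow_nonneg (Regular.userDist_pos hp u s ω).le _)) (hω.noise_nonneg hp s)))
  have hleft : ∫ ω in N.assoc p s, (N.caseEvent p c s).indicator
      (fun ω => alzerTail (p.m s) (N.gainThreshold p c u s z ω)) ω ∂μ =
      ∫ r in p.caseRange c, p.bracket s y (p.distAt u r) r * p.servingDensity s r := by
    simp only [hind, Params.bracket_eq, Finset.sum_mul]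
    rw [integral_finsetSum _ fun k _ => (hint k).const_mul _,
      integral_finsetSum _ fun k _ => ?_]
    · refine Finset.sum_congr rfl fun k _ => ?_
      simp only [mul_assoc]
      rw [integral_const_mul, integral_const_mul, integral_const_mul, integral_const_mul]
      have := hN.setIntegral_exp hp c u s (hκ k)
      simp only [mul_assoc] at this
      rw [this]
    · simp only [mul_assoc]
      exact ((hbdd (hN.integrableOn_servingDensity hp s) k).const_mul _).const_mul _
  -- The two serving densities add up to the full density divided by the association probability,
  -- which is the normalisation of the conditional measure.
  rw [integral_cond, hleft, Params.ccdfApprox, Fin.sum_univ_two,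
    ← integral_add (hbr (hN.integrableOn_servingPdf hp hA.le s 0))
      (hbr (hN.integrableOn_servingPdf hp hA.le s 1)), ← integral_const_mul]
  refine setIntegral_congr_fun (Params.measurableSet_caseRange hp c) fun r hr => ?_
  rw [← mul_add, Params.servingPdf_add hp _ s (Params.pos_of_mem_caseRange hp hr), A]
  ring

end IsModel

end Network

/-! ### Rates as integrals of CCDFs -/

/-- A monotone function is measurable, so antitonicity and bounds suffice for integrability. Only
the open interval matters. -/
lemma intervalIntegrable_div_one_add {F : ℝ → ℝ} {b : ℝ} (hb : 0 ≤ b)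
    (hF0 : ∀ z ∈ Ioo 0 b, 0 ≤ F z) (hF1 : ∀ z ∈ Ioo 0 b, F z ≤ 1) (hF : AntitoneOn F (Ioo 0 b)) :
    IntervalIntegrable (fun z => F z / (1 + z)) volume 0 b := by
  rw [intervalIntegrable_iff_integrableOn_Ioo_of_le hb]
  refine Integrable.of_bound ((aemeasurable_restrict_of_antitoneOn measurableSet_Ioo hF).div
    (by fun_prop)).aestronglyMeasurable 1 ?_
  filter_upwards [ae_restrict_mem measurableSet_Ioo] with z hz
  have h1 : 1 ≤ 1 + z := by linarith [hz.1]
  rw [Real.norm_of_nonneg (div_nonneg (hF0 z hz) (by linarith)), div_le_one (by linarith)]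
  exact (hF1 z hz).trans h1

lemma integral_one_div_one_add {t : ℝ} (ht : 0 ≤ t) :
    ∫ x in (0 : ℝ)..t, 1 / (1 + x) = Real.log (1 + t) := by
  rw [intervalIntegral.integral_comp_add_left (fun x => 1 / x) (1 : ℝ), add_zero,
    integral_one_div_of_pos one_pos (by linarith), div_one]

/-- Layer cake formula for the rate. -/
lemma integral_logb_one_add {Ω : Type*} [MeasurableSpace Ω] {P : Measure Ω} [IsProbabilityMeasure P]
    {f : Ω → ℝ} (hf : Measurable f) {b : ℝ} (hb : 0 ≤ b) (h0 : ∀ᵐ ω ∂P, 0 ≤ f ω)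
    (h1 : ∀ᵐ ω ∂P, f ω ≤ b) :
    ∫ ω, Real.logb 2 (1 + f ω) ∂P =
      1 / Real.log 2 * ∫ z in (0 : ℝ)..b, P.real {ω | z < f ω} / (1 + z) := by
  have hint : IntervalIntegrable (fun z => P.real {ω | z < f ω} / (1 + z)) volume 0 b :=
    intervalIntegrable_div_one_add hb (fun _ _ => measureReal_nonneg)
      (fun _ _ => measureReal_le_one)
      fun z _ z' _ hzz' => measureReal_mono fun ω hω => lt_of_le_of_lt hzz' hω
  have hg : ∀ t > 0, IntervalIntegrable (fun z : ℝ => 1 / (1 + z)) volume 0 t := fun t ht =>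
    intervalIntegrable_div_one_add (F := fun _ => 1) (le_of_lt ht) (fun _ _ => zero_le_one)
      (fun _ _ => le_rfl) antitoneOn_const
  have hcake := lintegral_comp_eq_lintegral_meas_lt_mul P h0 hf.aemeasurable hg (by
    filter_upwards [ae_restrict_mem measurableSet_Ioi] with z hz
    exact div_nonneg zero_le_one (by linarith [mem_Ioi.1 hz]))
  have hleft : ∫⁻ ω, ENNReal.ofReal (∫ t in (0 : ℝ)..f ω, 1 / (1 + t)) ∂P =
      ∫⁻ ω, ENNReal.ofReal (Real.log (1 + f ω)) ∂P := by
    refine lintegral_congr_ae ?_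
    filter_upwards [h0] with ω hω
    rw [integral_one_div_one_add hω]
  have hright : ∫⁻ t in Ioi (0 : ℝ), P {ω | t < f ω} * ENNReal.ofReal (1 / (1 + t)) =
      ENNReal.ofReal (∫ z in (0 : ℝ)..b, P.real {ω | z < f ω} / (1 + z)) := by
    rw [intervalIntegral.integral_of_le hb, ofReal_integral_eq_lintegral_ofReal
      ((intervalIntegrable_iff_integrableOn_Ioc_of_le hb).1 hint), ← Ioc_union_Ioi_eq_Ioi hb,
      lintegral_union measurableSet_Ioi (Ioc_disjoint_Ioi le_rfl)]
    -- The upper bound on `f` truncates the layer cake integral at `b`.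
    · have hz : ∫⁻ t in Ioi b, P {ω | t < f ω} * ENNReal.ofReal (1 / (1 + t)) = 0 := by
        refine (setLIntegral_congr_fun measurableSet_Ioi fun t ht => ?_).trans lintegral_zero
        have : P {ω | t < f ω} = 0 := by
          refine measure_mono_null (t := {ω | ¬ f ω ≤ b}) (fun ω hω => ?_) h1
          have hω' : t < f ω := hω
          exact not_le.2 (lt_trans ht hω')
        rw [this, zero_mul]
      rw [hz, add_zero]
      refine setLIntegral_congr_fun measurableSet_Ioc fun t ht => ?_
      rw [← ofReal_measureReal, ← ENNReal.ofReal_mul measureReal_nonneg, mul_one_div]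
    · filter_upwards [ae_restrict_mem measurableSet_Ioc] with z hz
      exact div_nonneg measureReal_nonneg (by linarith [hz.1])
  have hlog : ∫ ω, Real.log (1 + f ω) ∂P = ∫ z in (0 : ℝ)..b, P.real {ω | z < f ω} / (1 + z) := by
    rw [integral_eq_lintegral_of_nonneg_ae, ← hleft, hcake, hright, ENNReal.toReal_ofReal]
    · exact intervalIntegral.integral_nonneg hb fun z hz =>
        div_nonneg measureReal_nonneg (by linarith [hz.1])
    · filter_upwards [h0] with ω hω
      exact Real.log_nonneg (by linarith)
    · exact (by fun_prop : Measurable fun ω => Real.log (1 + f ω)).aestronglyMeasurable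
  rw [← hlog, ← integral_const_mul]
  simp only [Real.logb, div_eq_mul_inv, one_mul, mul_comm]

namespace Network

variable {Ω : Type*} [MeasurableSpace Ω] {N : Network Ω} {p : Params} {μ : Measure Ω}
  [IsProbabilityMeasure μ]

/-- The SINR of UE `u` in position `c`, and `0` in the other position. -/
def caseSinr (N : Network Ω) (p : Params) (c : Position) (u : User) (s : Link) : Ω → ℝ :=
  (N.caseEvent p c s).indicator (N.sinr p c u s)

-- Setting the SINR to zero outside the case makes its logarithmic rate vanish there, so the
-- indicator can be moved inside the logarithm.
omit [MeasurableSpace Ω] in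
lemma caseRate_eq (c : Position) (s : Link) (ω : Ω) : N.caseRate p c s ω =
    Real.logb 2 (1 + N.caseSinr p c .typical s ω) +
      Real.logb 2 (1 + N.caseSinr p c .fixed s ω) := by
  by_cases h : ω ∈ N.caseEvent p c s
  · rw [caseRate, if_pos h, caseSinr, caseSinr, Set.indicator_of_mem h, Set.indicator_of_mem h,
      pairRate]
  · rw [caseRate, if_neg h, caseSinr, caseSinr, Set.indicator_of_notMem h,
      Set.indicator_of_notMem h]
    simp

lemma IsMeasurable.caseSinr (h : N.IsMeasurable) (c : Position) (u : User) (s : Link) :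
    Measurable (N.caseSinr p c u s) := (h.sinr p c u s).indicator (h.caseEvent p c s)

lemma IsMeasurable.logb_caseSinr (h : N.IsMeasurable) (c : Position) (u : User) (s : Link) :
    Measurable fun ω => Real.logb 2 (1 + N.caseSinr p c u s ω) := by
  have := h.caseSinr (p := p) c u s
  unfold Real.logb
  fun_prop

lemma IsMeasurable.caseRate (h : N.IsMeasurable) (c : Position) (s : Link) :
    Measurable (N.caseRate p c s) := by
  have : N.caseRate p c s = fun ω => Real.logb 2 (1 + N.caseSinr p c .typical s ω) +
      Real.logb 2 (1 + N.caseSinr p c .fixed s ω) := funext (caseRate_eq c s)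
  rw [this]
  exact (h.logb_caseSinr c _ s).add (h.logb_caseSinr c _ s)

lemma IsMeasurable.tierRate (h : N.IsMeasurable) : Measurable (N.tierRate p) :=
  Measurable.ite (h.assoc p .los) ((h.caseRate _ _).add (h.caseRate _ _))
    (Measurable.ite (h.assoc p .nlos) ((h.caseRate _ _).add (h.caseRate _ _)) measurable_const)

namespace Regular

omit [MeasurableSpace Ω]

variable {ω : Ω}

lemma caseSinr_nonneg (h : N.Regular p ω) (hp : p.Admissible) (c : Position) (u : User)
    (s : Link) : 0 ≤ N.caseSinr p c u s ω :=
  Set.indicator_apply_nonneg fun _ => h.sinr_nonneg hp c u s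

lemma caseSinr_le_zMax (h : N.Regular p ω) (hp : p.Admissible) (c : Position) (u : User)
    (s : Link) : N.caseSinr p c u s ω ≤ p.zMax c u :=
  Set.indicator_apply_le' (fun _ => h.sinr_le_zMax hp c u s) fun _ => (Params.zMax_pos hp c u).le

lemma abs_logb_le (h : N.Regular p ω) (hp : p.Admissible) (c : Position) (u : User)
    (s : Link) : |Real.logb 2 (1 + N.caseSinr p c u s ω)| ≤ Real.logb 2 (1 + p.zMax c u) := by
  have h1 := h.caseSinr_nonneg hp c u s
  rw [abs_of_nonneg (Real.logb_nonneg one_lt_two (by linarith))]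
  exact Real.logb_le_logb_of_le one_lt_two (by linarith)
    (by linarith [h.caseSinr_le_zMax hp c u s])

lemma abs_caseRate_le (h : N.Regular p ω) (hp : p.Admissible) (c : Position) (s : Link) :
    |N.caseRate p c s ω| ≤
      Real.logb 2 (1 + p.zMax c .typical) + Real.logb 2 (1 + p.zMax c .fixed) := by
  rw [caseRate_eq]
  exact (abs_add_le _ _).trans (add_le_add (h.abs_logb_le hp c _ s) (h.abs_logb_le hp c _ s))

end Regular

/-! ### Decomposition of the rate and comparison with Alzer's approximation -/

namespace IsModel

lemma integrable_caseRate (hN : N.IsModel p μ) (hp : p.Admissible) (c : Position) (s : Link)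
    (A : Set Ω) : Integrable (N.caseRate p c s) (ProbabilityTheory.cond μ A) :=
  hN.integrable_cond_of_bounded hp (hN.isMeasurable.caseRate c s)
    fun _ hω => hω.abs_caseRate_le hp c s

lemma integrable_tierRate (hN : N.IsModel p μ) (hp : p.Admissible) (A : Set Ω) :
    Integrable (N.tierRate p) (ProbabilityTheory.cond μ A) := by
  refine hN.integrable_cond_of_bounded hp hN.isMeasurable.tierRate
    (C := (Real.logb 2 (1 + p.zMax .near .typical) + Real.logb 2 (1 + p.zMax .near .fixed)) +
      (Real.logb 2 (1 + p.zMax .far .typical) + Real.logb 2 (1 + p.zMax .far .fixed)))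
    fun ω hω => ?_
  have h : ∀ s, |N.caseRate p .near s ω + N.caseRate p .far s ω| ≤ _ := fun s =>
    (abs_add_le _ _).trans (add_le_add (hω.abs_caseRate_le hp .near s)
      (hω.abs_caseRate_le hp .far s))
  rw [tierRate]
  split_ifs
  · exact h _
  · exact h _
  · exact abs_zero.trans_le ((abs_nonneg _).trans (h .los))

lemma AA_eq (hN : N.IsModel p μ) : N.AA p μ = N.A p μ .los + N.A p μ .nlos :=
  measureReal_union (disjoint_assoc N p) (hN.isMeasurable.assoc p _)

lemma integrableOn_of_integrable_cond {A : Set Ω} (hA : μ A ≠ 0) {f : Ω → ℝ}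
    (hf : Integrable f (ProbabilityTheory.cond μ A)) : IntegrableOn f A μ := by
  have h := hf.smul_measure (measure_ne_top μ A)
  rwa [ProbabilityTheory.cond, smul_smul, ENNReal.mul_inv_cancel hA (measure_ne_top _ _),
    one_smul] at h

lemma setIntegral_caseRate (hN : N.IsModel p μ) (hp : p.Admissible) (c : Position) (s : Link) :
    ∫ ω in N.assoc p s, N.caseRate p c s ω ∂μ = N.A p μ s * N.componentRate p μ c s := by
  rw [componentRate, integral_cond, ← mul_assoc]
  change _ = N.A p μ s * (N.A p μ s)⁻¹ * _
  rw [mul_inv_cancel₀ (hN.A_pos hp s).ne', one_mul]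

/-- Total expectation over the two disjoint association events, on each of which the tier rate is
the sum of the rates of the two cases. -/
lemma ergodicRate_eq (hN : N.IsModel p μ) (hp : p.Admissible) :
    N.ergodicRate p μ =
      N.A p μ .los / N.AA p μ *
          (N.componentRate p μ .near .los + N.componentRate p μ .far .los) +
        N.A p μ .nlos / N.AA p μ *
          (N.componentRate p μ .near .nlos + N.componentRate p μ .far .nlos) := by
  have hM := hN.isMeasurable
  have hne : ∀ s, μ (N.assoc p s) ≠ 0 := fun s => (hN.measure_assoc_pos hp s).ne'
  have hsum : ∀ s, ∫ ω in N.assoc p s, N.tierRate p ω ∂μ =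
      N.A p μ s * (N.componentRate p μ .near s + N.componentRate p μ .far s) := by
    intro s
    rw [mul_add, ← hN.setIntegral_caseRate hp, ← hN.setIntegral_caseRate hp, ← integral_add
      (integrableOn_of_integrable_cond (hne s) (hN.integrable_caseRate hp _ s _))
      (integrableOn_of_integrable_cond (hne s) (hN.integrable_caseRate hp _ s _))]
    refine setIntegral_congr_fun (hM.assoc p s) fun ω hω => ?_
    rw [tierRate]
    cases s
    · rw [if_pos hω]
    · rw [if_neg fun h => Set.disjoint_left.1 (disjoint_assoc N p) h hω, if_pos hω]
  rw [ergodicRate, integral_cond, assocABS, setIntegral_union (disjoint_assoc N p)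
    (hM.assoc p _)
    (integrableOn_of_integrable_cond (hne _) (hN.integrable_tierRate hp _))
    (integrableOn_of_integrable_cond (hne _) (hN.integrable_tierRate hp _)), hsum, hsum]
  change (N.AA p μ)⁻¹ * _ = _
  ring

lemma isProbabilityMeasure_cond (hN : N.IsModel p μ) (hp : p.Admissible) (s : Link) :
    IsProbabilityMeasure (ProbabilityTheory.cond μ (N.assoc p s)) :=
  cond_isProbabilityMeasure (hN.measure_assoc_pos hp s).ne'

lemma componentRate_eq (hN : N.IsModel p μ) (hp : p.Admissible) (c : Position) (s : Link) :
    N.componentRate p μ c s = p.rateOfCcdf (fun u z => N.ccdf p μ c u s z) c := by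
  have hM := hN.isMeasurable
  have := hN.isProbabilityMeasure_cond hp s
  have hint : ∀ u, Integrable (fun ω => Real.logb 2 (1 + N.caseSinr p c u s ω))
      (ProbabilityTheory.cond μ (N.assoc p s)) := fun u =>
    hN.integrable_cond_of_bounded hp (hM.logb_caseSinr c u s) fun _ hω => hω.abs_logb_le hp c u s
  have hrate : ∀ u, ∫ ω, Real.logb 2 (1 + N.caseSinr p c u s ω)
      ∂(ProbabilityTheory.cond μ (N.assoc p s)) =
      1 / Real.log 2 * ∫ z in (0 : ℝ)..p.zMax c u, N.ccdf p μ c u s z / (1 + z) := by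
    intro u
    have hz := (Params.zMax_pos hp c u).le
    rw [integral_logb_one_add (hM.caseSinr c u s) hz
      ((hN.ae_regular_cond hp _).mono fun ω hω => hω.caseSinr_nonneg hp c u s)
      ((hN.ae_regular_cond hp _).mono fun ω hω => hω.caseSinr_le_zMax hp c u s)]
    congr 1
    refine intervalIntegral.integral_congr fun z hz' => ?_
    rw [Set.uIcc_of_le hz] at hz'
    -- For `z ≥ 0` the value zero taken outside the case never exceeds `z`.
    have hset : {ω | z < N.caseSinr p c u s ω} =
        N.caseEvent p c s ∩ {ω | z < N.sinr p c u s ω} := by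
      ext ω
      change z < N.caseSinr p c u s ω ↔ ω ∈ N.caseEvent p c s ∧ z < N.sinr p c u s ω
      by_cases h : ω ∈ N.caseEvent p c s
      · rw [caseSinr, Set.indicator_of_mem h]
        exact (and_iff_right h).symm
      · rw [caseSinr, Set.indicator_of_notMem h]
        exact iff_of_false (not_lt.2 hz'.1) fun h' => h h'.1
    rw [hset, ccdf]
  rw [componentRate, Params.rateOfCcdf, ← hrate, ← hrate, ← integral_add (hint _) (hint _)]
  simp only [caseRate_eq]

lemma integrable_tail (hN : N.IsModel p μ) (hp : p.Admissible) {c : Position} {u : User}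
    (s : Link) {z : ℝ} (hz0 : 0 ≤ z) (hz : z < p.zMax c u) {t : ℝ → ℝ} (ht : Measurable t)
    (ht0 : ∀ x, 0 ≤ x → 0 ≤ t x) (ht1 : ∀ x, 0 ≤ x → t x ≤ 1) (A : Set Ω) :
    Integrable ((N.caseEvent p c s).indicator fun ω => t (N.gainThreshold p c u s z ω))
      (ProbabilityTheory.cond μ A) := by
  have hM := hN.isMeasurable
  refine hN.integrable_cond_of_bounded hp (C := 1)
    ((ht.comp (hM.gainThreshold p c u s z)).indicator (hM.caseEvent p c s)) fun ω hω => ?_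
  have h := hω.gainThreshold_nonneg hp s hz0 hz
  rw [← Real.norm_eq_abs]
  refine (norm_indicator_le_norm_self _ _).trans ?_
  rw [Real.norm_of_nonneg (ht0 _ h)]
  exact ht1 _ h

lemma measurable_alzerTail (m : ℕ) : Measurable (alzerTail m) := by
  unfold alzerTail
  fun_prop

lemma integrable_alzerTail (hN : N.IsModel p μ) (hp : p.Admissible) {c : Position} {u : User}
    (s : Link) {z : ℝ} (hz0 : 0 ≤ z) (hz : z < p.zMax c u) (A : Set Ω) :
    Integrable ((N.caseEvent p c s).indicator
      fun ω => alzerTail (p.m s) (N.gainThreshold p c u s z ω)) (ProbabilityTheory.cond μ A) :=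
  hN.integrable_tail hp s hz0 hz (measurable_alzerTail _)
    (fun _ hx => alzerTail_nonneg (hp.m_pos s) hx) (fun _ hx => alzerTail_le_one (hp.m_pos s) hx) A

lemma ccdf_le_ccdfApprox (hN : N.IsModel p μ) (hp : p.Admissible) {c : Position} {u : User}
    (s : Link) {z : ℝ} (hz0 : 0 ≤ z) (hz : z < p.zMax c u) :
    N.ccdf p μ c u s z ≤ p.ccdfApprox (N.A p μ s) c u s z := by
  rw [hN.ccdf_eq_integral hp s hz, ← hN.integral_alzerTail_eq hp s hz0 hz]
  refine integral_mono_ae (hN.integrable_tail hp s hz0 hz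
    (antitone_gammaTail (hp.m_pos s)).measurable (fun _ _ => gammaTail_nonneg _ _)
    (fun _ _ => gammaTail_le_one (hp.m_pos s) _) _) (hN.integrable_alzerTail hp s hz0 hz _) ?_
  filter_upwards [hN.ae_regular_cond hp _] with ω hω
  exact Set.indicator_le_indicator
    (gammaTail_le_alzerTail (hp.m_pos s) (hω.gainThreshold_nonneg hp s hz0 hz))

lemma ccdf_eq_ccdfApprox (hN : N.IsModel p μ) (hp : p.Admissible) {c : Position} {u : User}
    {s : Link} (hm : p.m s = 1) {z : ℝ} (hz0 : 0 ≤ z) (hz : z < p.zMax c u) :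
    N.ccdf p μ c u s z = p.ccdfApprox (N.A p μ s) c u s z := by
  rw [hN.ccdf_eq_integral hp s hz, ← hN.integral_alzerTail_eq hp s hz0 hz]
  refine integral_congr_ae ?_
  filter_upwards [hN.ae_regular_cond hp _] with ω hω
  have h := gammaTail_one (hω.gainThreshold_nonneg (c := c) (u := u) hp s hz0 hz)
  by_cases hc : ω ∈ N.caseEvent p c s
  · rw [Set.indicator_of_mem hc, Set.indicator_of_mem hc, hm, h]
  · rw [Set.indicator_of_notMem hc, Set.indicator_of_notMem hc]

/-- Monotonicity in `z` is invisible in the alternating sum. It follows from the representation as a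
mean of `alzerTail`, because the threshold increases with `z`. -/
lemma ccdfApprox_anti (hN : N.IsModel p μ) (hp : p.Admissible) (c : Position) (u : User)
    (s : Link) : AntitoneOn (p.ccdfApprox (N.A p μ s) c u s) (Ioo 0 (p.zMax c u)) := by
  intro z hz z' hz' hzz'
  rw [← hN.integral_alzerTail_eq hp s hz.1.le hz.2,
    ← hN.integral_alzerTail_eq hp s hz'.1.le hz'.2]
  refine integral_mono_ae (hN.integrable_alzerTail hp s hz'.1.le hz'.2 _)
    (hN.integrable_alzerTail hp s hz.1.le hz.2 _) ?_
  filter_upwards [hN.ae_regular_cond hp _] with ω hω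
  exact Set.indicator_le_indicator (alzerTail_anti (hp.m_pos s)
    (hω.gainThreshold_nonneg hp s hz.1.le hz.2) (hω.gainThreshold_mono hp s hz.1.le hzz' hz'.2))

lemma ccdfApprox_nonneg (hN : N.IsModel p μ) (hp : p.Admissible) {c : Position} {u : User}
    (s : Link) {z : ℝ} (hz0 : 0 ≤ z) (hz : z < p.zMax c u) :
    0 ≤ p.ccdfApprox (N.A p μ s) c u s z :=
  (measureReal_nonneg).trans (hN.ccdf_le_ccdfApprox hp s hz0 hz)

lemma ccdfApprox_le_one (hN : N.IsModel p μ) (hp : p.Admissible) {c : Position} {u : User}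
    (s : Link) {z : ℝ} (hz0 : 0 ≤ z) (hz : z < p.zMax c u) :
    p.ccdfApprox (N.A p μ s) c u s z ≤ 1 := by
  have := hN.isProbabilityMeasure_cond hp s
  rw [← hN.integral_alzerTail_eq hp s hz0 hz]
  refine (integral_mono_ae (hN.integrable_alzerTail hp s hz0 hz _) (integrable_const 1) ?_).trans
    (by simp)
  filter_upwards [hN.ae_regular_cond hp _] with ω hω
  exact Set.indicator_apply_le' (fun _ => alzerTail_le_one (hp.m_pos s)
    (hω.gainThreshold_nonneg hp s hz0 hz)) fun _ => zero_le_one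

lemma rateOfCcdf_le (hN : N.IsModel p μ) (hp : p.Admissible) (c : Position) (s : Link) :
    p.rateOfCcdf (fun u z => N.ccdf p μ c u s z) c ≤
      p.rateOfCcdf (p.ccdfApprox (N.A p μ s) c · s) c := by
  have := hN.isProbabilityMeasure_cond hp s
  have h : ∀ u, ∫ z in (0 : ℝ)..p.zMax c u, N.ccdf p μ c u s z / (1 + z) ≤
      ∫ z in (0 : ℝ)..p.zMax c u, p.ccdfApprox (N.A p μ s) c u s z / (1 + z) := by
    intro u
    have hz := (Params.zMax_pos hp c u).le
    -- The comparison uses the open interval, because the denominator in `f` vanishes at `zMax`.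
    refine intervalIntegral.integral_mono_on_of_le_Ioo hz
      (intervalIntegrable_div_one_add hz (fun _ _ => measureReal_nonneg)
        (fun _ _ => measureReal_le_one) fun z _ z' _ hzz' => measureReal_mono
          (Set.inter_subset_inter_right _ fun ω hω => lt_of_le_of_lt hzz' hω))
      (intervalIntegrable_div_one_add hz (fun z hz => hN.ccdfApprox_nonneg hp s hz.1.le hz.2)
        (fun z hz => hN.ccdfApprox_le_one hp s hz.1.le hz.2) (hN.ccdfApprox_anti hp c u s))
      fun z hz => ?_
    exact div_le_div_of_nonneg_right (hN.ccdf_le_ccdfApprox hp s hz.1.le hz.2) (by linarith [hz.1])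
  have hlog : 0 ≤ 1 / Real.log 2 := by
    have := Real.log_pos one_lt_two
    positivity
  exact add_le_add (mul_le_mul_of_nonneg_left (h _) hlog) (mul_le_mul_of_nonneg_left (h _) hlog)

lemma rateOfCcdf_eq (hN : N.IsModel p μ) (hp : p.Admissible) (c : Position) {s : Link}
    (hm : p.m s = 1) :
    p.rateOfCcdf (fun u z => N.ccdf p μ c u s z) c =
      p.rateOfCcdf (p.ccdfApprox (N.A p μ s) c · s) c := by
  have h : ∀ u, ∫ z in (0 : ℝ)..p.zMax c u, N.ccdf p μ c u s z / (1 + z) =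
      ∫ z in (0 : ℝ)..p.zMax c u, p.ccdfApprox (N.A p μ s) c u s z / (1 + z) := by
    intro u
    have hz := (Params.zMax_pos hp c u).le
    -- The endpoint `zMax`, where the analytic expression takes a meaningless default value, is
    -- discarded as a null set.
    rw [intervalIntegral.integral_of_le hz, intervalIntegral.integral_of_le hz,
      integral_Ioc_eq_integral_Ioo, integral_Ioc_eq_integral_Ioo]
    refine setIntegral_congr_fun measurableSet_Ioo fun z hz => ?_
    rw [hN.ccdf_eq_ccdfApprox hp hm hz.1.le hz.2]
  rw [Params.rateOfCcdf, Params.rateOfCcdf, h, h]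

end IsModel

end Network

end Noma

end

/-! ### The theorem on the ergodic rate -/

theorem mainTheorem12 {Ω : Type*} [MeasurableSpace Ω] (μ : MeasureTheory.Measure Ω)
    [MeasureTheory.IsProbabilityMeasure μ] (p : Noma.Params) (hp : p.Admissible)
    (N : Noma.Network Ω) (hN : N.IsModel p μ) :
    -- the conditional expectations are meaningful
    ((∀ s, 0 < N.A p μ s) ∧ N.AA p μ = N.A p μ .los + N.A p μ .nlos ∧
      MeasureTheory.Integrable (N.tierRate p)
        (ProbabilityTheory.cond μ (N.assocABS p)) ∧
      ∀ c s, MeasureTheory.Integrable (N.caseRate p c s)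
        (ProbabilityTheory.cond μ (N.assoc p s))) ∧
    -- the ergodic rate of the ABS tier
    N.ergodicRate p μ =
      N.A p μ .los / N.AA p μ *
          (N.componentRate p μ .near .los + N.componentRate p μ .far .los) +
        N.A p μ .nlos / N.AA p μ *
          (N.componentRate p μ .near .nlos + N.componentRate p μ .far .nlos) ∧
    -- the component rates as truncated integrals of SINR CCDFs
    (∀ c s, N.componentRate p μ c s = p.rateOfCcdf (fun u z => N.ccdf p μ c u s z) c) ∧
    (∀ c u s z, p.zMax c u ≤ z → N.ccdf p μ c u s z = 0) ∧
    -- the CCDFs: the analytic expression results from Alzer's approximation of the Gamma CCDF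
    (∀ c u s z, 0 ≤ z → z < p.zMax c u →
      N.ccdf p μ c u s z =
          ∫ ω, (N.caseEvent p c s).indicator
            (fun ω => Noma.gammaTail (p.m s) (N.gainThreshold p c u s z ω)) ω
            ∂(ProbabilityTheory.cond μ (N.assoc p s)) ∧
        ∫ ω, (N.caseEvent p c s).indicator
            (fun ω => Noma.alzerTail (p.m s) (N.gainThreshold p c u s z ω)) ω
            ∂(ProbabilityTheory.cond μ (N.assoc p s)) =
          p.ccdfApprox (N.A p μ s) c u s z ∧
        N.ccdf p μ c u s z ≤ p.ccdfApprox (N.A p μ s) c u s z ∧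
        (p.m s = 1 → N.ccdf p μ c u s z = p.ccdfApprox (N.A p μ s) c u s z)) ∧
    -- the resulting expressions for the component rates and for the ergodic rate
    (∀ c s,
      N.componentRate p μ c s ≤ p.rateOfCcdf (p.ccdfApprox (N.A p μ s) c · s) c ∧
        (p.m s = 1 →
          N.componentRate p μ c s = p.rateOfCcdf (p.ccdfApprox (N.A p μ s) c · s) c)) ∧
    N.ergodicRate p μ ≤
      N.A p μ .los / N.AA p μ *
          (p.rateOfCcdf (p.ccdfApprox (N.A p μ .los) .near · .los) .near +
            p.rateOfCcdf (p.ccdfApprox (N.A p μ .los) .far · .los) .far) +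
        N.A p μ .nlos / N.AA p μ *
          (p.rateOfCcdf (p.ccdfApprox (N.A p μ .nlos) .near · .nlos) .near +
            p.rateOfCcdf (p.ccdfApprox (N.A p μ .nlos) .far · .nlos) .far) ∧
    ((∀ s, p.m s = 1) → N.ergodicRate p μ =
      N.A p μ .los / N.AA p μ *
          (p.rateOfCcdf (p.ccdfApprox (N.A p μ .los) .near · .los) .near +
            p.rateOfCcdf (p.ccdfApprox (N.A p μ .los) .far · .los) .far) +
        N.A p μ .nlos / N.AA p μ *
          (p.rateOfCcdf (p.ccdfApprox (N.A p μ .nlos) .near · .nlos) .near +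
            p.rateOfCcdf (p.ccdfApprox (N.A p μ .nlos) .far · .nlos) .far)) := by
  have hcomp : ∀ c s, N.componentRate p μ c s ≤
      p.rateOfCcdf (p.ccdfApprox (N.A p μ s) c · s) c := fun c s =>
    (hN.componentRate_eq hp c s).trans_le (hN.rateOfCcdf_le hp c s)
  have hcomp' : ∀ c s, p.m s = 1 → N.componentRate p μ c s =
      p.rateOfCcdf (p.ccdfApprox (N.A p μ s) c · s) c := fun c s hm =>
    (hN.componentRate_eq hp c s).trans (hN.rateOfCcdf_eq hp c hm)
  have hAA : 0 ≤ N.AA p μ := MeasureTheory.measureReal_nonneg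
  -- Non-negative weights carry the bounds on the four component rates over to the ergodic rate.
  have hA : ∀ s, 0 ≤ N.A p μ s / N.AA p μ := fun s => div_nonneg (hN.A_pos hp s).le hAA
  refine ⟨⟨hN.A_pos hp, hN.AA_eq, hN.integrable_tierRate hp _,
    fun c s => hN.integrable_caseRate hp c s _⟩, hN.ergodicRate_eq hp, hN.componentRate_eq hp,
    fun c u s z hz => hN.ccdf_eq_zero hp s hz,
    fun c u s z hz0 hz => ⟨hN.ccdf_eq_integral hp s hz, hN.integral_alzerTail_eq hp s hz0 hz,
      hN.ccdf_le_ccdfApprox hp s hz0 hz, fun hm => hN.ccdf_eq_ccdfApprox hp hm hz0 hz⟩,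
    fun c s => ⟨hcomp c s, hcomp' c s⟩, ?_, fun hm => ?_⟩
  · rw [hN.ergodicRate_eq hp]
    exact add_le_add (mul_le_mul_of_nonneg_left (add_le_add (hcomp _ _) (hcomp _ _)) (hA _))
      (mul_le_mul_of_nonneg_left (add_le_add (hcomp _ _) (hcomp _ _)) (hA _))
  · rw [hN.ergodicRate_eq hp, hcomp' _ _ (hm _), hcomp' _ _ (hm _), hcomp' _ _ (hm _),
      hcomp' _ _ (hm _)]
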